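/- Let $g\ge 0$ and $n\ge 1$ be integers. Let $\mathrm{H}_g$ be a handlebody of genus $g$ with boundary surface $\mathrm{T}_g=\partial \mathrm{H}_g$, and let $A_1,\dots,A_n\subset \mathrm{H}_g$ be a trivial system of disjoint properly embedded arcs: there are mutually disjoint properly embedded tame discs $D_1,\dots,D_n\subset \mathrm{H}_g$ such that $A_i\subset\partial D_i$ and $\partial D_i\setminus A_i\subset \mathrm{T}_g$ (tame means that $D_i$ has an open neighbourhood $N$ in $\mathrm{H}_g$ and a homeomorphism $N\cong\{x\in\mathbf{R}^3: x_0\ge 0\}$ taking $N\cap \mathrm{T}_g$ to $\{x_0=0\}$, $D_i$ to $\{x_2=0,\ |x|\le 1\}$ and $A_i$ to $\{x_2=0,\ |x|=1\}$). Let $P_{i1},P_{i2}\in \mathrm{T}_g$ be the endpoints of $A_i$, and label $P_{ij}$ by the number $2i+j-2\in\{1,\dots,2n\}$. Let $\mathrm{MCG}_{2n}(\mathrm{T}_g)$ be the group of isotopy classes of orientation preserving homeomorphisms of $\mathrm{T}_g$ mapping the set $\mathcal P_n=\{P_{ij}\}$ to itself (isotopies preserve $\mathcal P_n$), let $\mathrm{PMCG}_{2n}(\mathrm{T}_g)$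 be the subgroup of the classes of homeomorphisms fixing every point of $\mathcal P_n$, let $\mathcal{E}^g_{2n}\subseteq \mathrm{MCG}_{2n}(\mathrm{T}_g)$ be the subgroup of the classes of homeomorphisms that admit an extension to a homeomorphism of $\mathrm{H}_g$ mapping $A_1\cup\dots\cup A_n$ to itself, and let $\bar{\mathcal{E}}^g_{2n}=\mathrm{PMCG}_{2n}(\mathrm{T}_g)\cap\mathcal{E}^g_{2n}$. Let $\Sigma_{2n}$ be the symmetric group on the letters $1,\dots,2n$, let $p:\mathrm{MCG}_{2n}(\mathrm{T}_g)\to\Sigma_{2n}$ be the homomorphism sending a class to the permutation that it induces on the labels of the points of $\mathcal P_n$, and let $\Sigma'_{2n}\subseteq\Sigma_{2n}$ be the subgroup generated by the transposition $(1\ 2)$ and the permutations $(2i-1\ \ 2i+1)(2i\ \ 2i+2)$ for $i=1,\dots,n-1$. Then the sequence $$1\to\mathrm{PMCG}_{2n}(\mathrm{T}_g)\to\mathrm{MCG}_{2n}(\mathrm{T}_g)\xrightarrow{\ p\ }\Sigma_{2n}\to 1$$ is exact, and it restricts to an exact sequence $$1\to\bar{\mathcal{E}}^g_{2n}\to\mathcal{E}^g_{2n}\xrightarrow{\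 p\ }\Sigma'_{2n}\to 1 .$$ -/

import Mathlib

open CategoryTheory Topology Set

universe u

noncomputable section

/-! ### Mapping class groups of a closed oriented surface with marked points -/

/-- A self-homeomorphism of a closed connected orientable surface `S` preserves the orientation if
it acts as the identity on `H₂(S; ℤ) ≅ ℤ`. -/
def OrientationPreserving {S : Type u} [TopologicalSpace S] (f : S ≃ₜ S) : Prop :=
  ((AlgebraicTopology.singularHomologyFunctor (ModuleCat.{u} ℤ) 2).obj
    (ModuleCat.of ℤ (ULift.{u} ℤ))).map (TopCat.ofHom (f : C(S, S))) = 𝟙 _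

/-- The group of orientation preserving homeomorphisms `f` of `S` with `f(P) = P`. -/
def homeoPlus (S : Type u) [TopologicalSpace S] (P : Set S) : Subgroup (S ≃ₜ S) where
  carrier := {f | OrientationPreserving f ∧ f '' P = P}
  one_mem' := by
    refine ⟨?_, image_id P⟩
    exact CategoryTheory.Functor.map_id _ (TopCat.of S)
  mul_mem' := by
    rintro f k ⟨hf, hf'⟩ ⟨hk, hk'⟩
    refine ⟨?_, ?_⟩
    · have : TopCat.ofHom ((f * k : S ≃ₜ S) : C(S, S)) =
        TopCat.ofHom (k : C(S, S)) ≫ TopCat.ofHom (f : C(S, S)) := rfl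
      unfold OrientationPreserving at *
      rw [this, Functor.map_comp, hf, hk, Category.comp_id]
    · have : ((f * k : S ≃ₜ S) : S → S) = f ∘ k := rfl
      rw [this, image_comp, hk', hf']
  inv_mem' := by
    rintro f ⟨hf, hf'⟩
    refine ⟨?_, ?_⟩
    · have h1 : TopCat.ofHom (f : C(S, S)) ≫ TopCat.ofHom ((f⁻¹ : S ≃ₜ S) : C(S, S)) =
          𝟙 (TopCat.of S) := by
        ext x
        exact f.symm_apply_apply x
      have h2 := congrArg ((AlgebraicTopology.singularHomologyFunctor (ModuleCat.{u} ℤ) 2).obj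
        (ModuleCat.of ℤ (ULift.{u} ℤ))).map h1
      unfold OrientationPreserving at *
      rw [Functor.map_comp, hf, Category.id_comp, CategoryTheory.Functor.map_id] at h2
      exact h2
    · conv_lhs => rw [← hf']
      have : ((f⁻¹ : S ≃ₜ S) : S → S) = f.symm := rfl
      rw [this]
      exact f.toEquiv.symm_image_image P

/-- `f` and `k` are isotopic relative to the set of marked points `P`: they are joined by a
continuous family of homeomorphisms of `S` all of which preserve `P`. -/
def IsotopicRel {S : Type u} [TopologicalSpace S] (P : Set S) (f k : S ≃ₜ S) : Prop :=
  ∃ φ : unitInterval → (S ≃ₜ S), Continuous (fun q : unitInterval × S => φ q.1 q.2) ∧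
    φ 0 = f ∧ φ 1 = k ∧ ∀ t, φ t '' P = P

/-- The homeomorphisms that are isotopic to the identity. -/
def isotopicToId (S : Type u) [TopologicalSpace S] (P : Set S) : Subgroup (homeoPlus S P) where
  carrier := {f | IsotopicRel P 1 f.1}
  one_mem' := ⟨fun _ => 1, continuous_snd, rfl, rfl, fun _ => image_id P⟩
  mul_mem' := by
    rintro f k ⟨φ, hφ, h0, h1, hP⟩ ⟨ψ, hψ, k0, k1, kP⟩
    refine ⟨fun t => φ t * ψ t, ?_, by simp [h0, k0], by simp [h1, k1], fun t => ?_⟩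
    · exact hφ.comp (continuous_fst.prodMk hψ)
    · have : ((φ t * ψ t : S ≃ₜ S) : S → S) = φ t ∘ ψ t := rfl
      rw [this, image_comp, kP, hP]
  inv_mem' := by
    rintro f ⟨φ, hφ, h0, h1, hP⟩
    refine ⟨fun t => φ (unitInterval.symm t) * (f⁻¹).1, ?_, ?_, ?_, fun t => ?_⟩
    · exact hφ.comp ((unitInterval.continuous_symm.comp continuous_fst).prodMk
        ((f⁻¹).1.continuous.comp continuous_snd))
    · simp [h1]
    · simp [h0]
    · have : ((φ (unitInterval.symm t) * (f⁻¹).1 : S ≃ₜ S) : S → S) =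
        φ (unitInterval.symm t) ∘ (f⁻¹).1 := rfl
      rw [this, image_comp, (f⁻¹).2.2, hP]

instance (S : Type u) [TopologicalSpace S] (P : Set S) : (isotopicToId S P).Normal where
  conj_mem := by
    rintro f ⟨φ, hφ, h0, h1, hP⟩ k
    refine ⟨fun t => k.1 * φ t * (k⁻¹).1, ?_, ?_, ?_, fun t => ?_⟩
    · exact k.1.continuous.comp (hφ.comp (continuous_fst.prodMk
        ((k⁻¹).1.continuous.comp continuous_snd)))
    · simp [h0]
    · simp [h1]
    · have : ((k.1 * φ t * (k⁻¹).1 : S ≃ₜ S) : S → S) = k.1 ∘ φ t ∘ (k⁻¹).1 := rfl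
      rw [this, image_comp, image_comp, (k⁻¹).2.2, hP, k.2.2]

/-- The mapping class group: isotopy classes (relative to `P`) of orientation preserving
homeomorphisms of `S` fixing the set `P`. -/
abbrev MCG (S : Type u) [TopologicalSpace S] (P : Set S) : Type u :=
  homeoPlus S P ⧸ isotopicToId S P

/-- The mapping class of a homeomorphism. -/
abbrev mappingClass (S : Type u) [TopologicalSpace S] (P : Set S) : homeoPlus S P →* MCG S P :=
  QuotientGroup.mk' (isotopicToId S P)

/-- Two homeomorphisms have the same mapping class exactly when they are isotopic. -/
theorem mappingClass_eq_iff {S : Type u} [TopologicalSpace S] {P : Set S} (f k : homeoPlus S P) :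
    mappingClass S P f = mappingClass S P k ↔ IsotopicRel P f.1 k.1 := by
  rw [QuotientGroup.mk'_apply, QuotientGroup.mk'_apply, QuotientGroup.eq]
  constructor
  · rintro ⟨φ, hφ, h0, h1, hP⟩
    refine ⟨fun t => f.1 * φ t, f.1.continuous.comp hφ, by simp [h0], by simp [h1], fun t => ?_⟩
    have : ((f.1 * φ t : S ≃ₜ S) : S → S) = f.1 ∘ φ t := rfl
    rw [this, image_comp, hP, f.2.2]
  · rintro ⟨φ, hφ, h0, h1, hP⟩
    refine ⟨fun t => (f⁻¹).1 * φ t, (f⁻¹).1.continuous.comp hφ, by simp [h0], by simp [h1],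
      fun t => ?_⟩
    have : (((f⁻¹).1 * φ t : S ≃ₜ S) : S → S) = (f⁻¹).1 ∘ φ t := rfl
    rw [this, image_comp, hP, (f⁻¹).2.2]

/-- The pure mapping class group: classes of homeomorphisms fixing every marked point. -/
def PMCG (S : Type u) [TopologicalSpace S] (P : Set S) : Subgroup (MCG S P) :=
  Subgroup.map (mappingClass S P)
    { carrier := {f | ∀ x ∈ P, f.1 x = x}
      one_mem' := fun _ _ => rfl
      mul_mem' := by
        intro f k hf hk x hx
        change f.1 (k.1 x) = x
        rw [hk x hx, hf x hx]
      inv_mem' := by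
        intro f hf x hx
        change f.1.symm x = x
        rw [Homeomorph.symm_apply_eq, hf x hx] }

section Permutation

variable {S : Type u} [TopologicalSpace S] {m : ℕ} {pt : Fin m → S}

theorem exists_perm (hpt : Function.Injective pt) (f : homeoPlus S (range pt)) :
    ∃ σ : Equiv.Perm (Fin m), ∀ k, pt (σ k) = f.1 (pt k) := by
  have h : ∀ k, ∃ l, pt l = f.1 (pt k) := fun k => by
    have : f.1 (pt k) ∈ f.1 '' range pt := mem_image_of_mem _ (mem_range_self k)
    rwa [f.2.2] at this
  choose s hs using h
  have inj : Function.Injective s := fun a b hab => by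
    apply hpt
    apply f.1.injective
    rw [← hs, ← hs, hab]
  exact ⟨Equiv.ofBijective s (Finite.injective_iff_bijective.mp inj), hs⟩

/-- The permutation of the labels of the marked points induced by a homeomorphism:
the point labelled `k` is sent to the point labelled `homeoPerm f k`. -/
def homeoPerm (hpt : Function.Injective pt) :
    homeoPlus S (range pt) →* Equiv.Perm (Fin m) where
  toFun f := (exists_perm hpt f).choose
  map_one' := by
    ext k
    exact congrArg _ (hpt ((exists_perm hpt 1).choose_spec k))
  map_mul' f g := by
    ext k
    refine congrArg _ (hpt ?_)
    rw [(exists_perm hpt (f * g)).choose_spec k, Equiv.Perm.mul_apply,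
      (exists_perm hpt f).choose_spec, (exists_perm hpt g).choose_spec]
    rfl

theorem homeoPerm_spec (hpt : Function.Injective pt) (f : homeoPlus S (range pt)) (k : Fin m) :
    pt (homeoPerm hpt f k) = f.1 (pt k) :=
  (exists_perm hpt f).choose_spec k

theorem homeoPerm_eq_one [T1Space S] (hpt : Function.Injective pt) (f : homeoPlus S (range pt))
    (hf : f ∈ isotopicToId S (range pt)) : homeoPerm hpt f = 1 := by
  obtain ⟨φ, hφ, h0, h1, hP⟩ := hf
  ext k
  refine congrArg _ (hpt ?_)
  rw [homeoPerm_spec hpt]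
  have hmem : ∀ t, φ t (pt k) ∈ range pt := fun t => by
    have := mem_image_of_mem (φ t) (mem_range_self (f := pt) k)
    rwa [hP] at this
  have hfin : (range pt).Finite := finite_range pt
  have : DiscreteTopology (range pt) := hfin.isDiscrete.to_subtype
  have hc : Continuous (fun t : unitInterval => (⟨φ t (pt k), hmem t⟩ : range pt)) :=
    Continuous.subtype_mk (hφ.comp (continuous_id.prodMk continuous_const)) _
  have := congrArg Subtype.val (PreconnectedSpace.constant inferInstance hc (x := 1) (y := 0))
  simp only [h0, h1] at this
  exact this

/-- The homomorphism `p : MCG → Σ_m` given by the permutation induced on the marked points. -/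
def permHom [T1Space S] (hpt : Function.Injective pt) :
    MCG S (range pt) →* Equiv.Perm (Fin m) :=
  QuotientGroup.lift (isotopicToId S (range pt)) (homeoPerm hpt) (homeoPerm_eq_one hpt)

theorem permHom_spec [T1Space S] (hpt : Function.Injective pt) (f : homeoPlus S (range pt))
    (k : Fin m) : pt (permHom hpt (mappingClass S (range pt) f) k) = f.1 (pt k) :=
  homeoPerm_spec hpt f k

end Permutation

/-! ### Handlebodies and trivial systems of arcs -/

/-- The standard handlebody of genus `g`: a closed planar disc with `g` disjoint open round holes,
times a closed interval. -/
def stdHandlebody (g : ℕ) : Set (ℂ × ℝ) :=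
  {z : ℂ | ‖z‖ ≤ g + 1 ∧ ∀ k : ℕ, 1 ≤ k → k ≤ g → 1 / 4 ≤ ‖z - k‖} ×ˢ Icc (0 : ℝ) 1

/-- `H` is a handlebody of genus `g` with boundary surface `T = ∂H`. -/
def IsHandlebody (g : ℕ) (H : Type u) [TopologicalSpace H] (T : Set H) : Prop :=
  ∃ h : H ≃ₜ stdHandlebody g, ∀ x, x ∈ T ↔ (h x : ℂ × ℝ) ∈ frontier (stdHandlebody g)

/-- A system of `n` disjoint properly embedded arcs in `H`, where `T = ∂H`. -/
structure ArcSystem {H : Type u} [TopologicalSpace H] (T : Set H) (n : ℕ) where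
  arc : Fin n → unitInterval → H
  isEmbedding : ∀ i, IsEmbedding (arc i)
  mem_boundary_iff : ∀ i t, arc i t ∈ T ↔ t = 0 ∨ t = 1
  disjoint : ∀ i j, i ≠ j → Disjoint (range (arc i)) (range (arc j))

/-- `D` is a (tame, properly embedded) disc in `H` whose boundary circle is the union of the
arc `A` and an arc in the boundary `T = ∂H`. Tameness means that `D` has a neighbourhood in `H` which
is parametrized by the half-space `{x₀ ≥ 0}` in such a way that `T` corresponds to the plane
`{x₀ = 0}`, `D` to the half-disc `{x₂ = 0, ‖x‖ ≤ 1}`, and `A` to the half-circle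
`{x₂ = 0, ‖x‖ = 1}`. -/
def IsTrivializingDisc {H : Type u} [TopologicalSpace H] (T A D : Set H) : Prop :=
  ∃ e : EuclideanHalfSpace 3 → H, IsOpenEmbedding e ∧
    (∀ x, e x ∈ T ↔ x.1 0 = 0) ∧
    e '' {x | x.1 2 = 0 ∧ ‖x.1‖ ≤ 1} = D ∧
    e '' {x | x.1 2 = 0 ∧ ‖x.1‖ = 1} = A

namespace ArcSystem

variable {H : Type u} [TopologicalSpace H] {T : Set H} {n : ℕ}

/-- A system of arcs is trivial if it has mutually disjoint trivializing discs. (In particular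
`A i` is disjoint from `D j` for `i ≠ j`.) -/
def IsTrivial (A : ArcSystem T n) : Prop :=
  ∃ D : Fin n → Set H, (∀ i j, i ≠ j → Disjoint (D i) (D j)) ∧
    ∀ i, IsTrivializingDisc T (range (A.arc i)) (D i)

/-- The union of the arcs. -/
def union (A : ArcSystem T n) : Set H := ⋃ i, range (A.arc i)

/-- The endpoints of the arcs as points of `T = ∂H`. The labels are `0, …, 2n-1`: the initial point
of the arc number `i` (`i = 0, …, n-1`) has label `2i` and its final point has label `2i+1`. -/
def puncture (A : ArcSystem T n) (k : Fin (2 * n)) : T :=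
  ⟨A.arc ⟨k / 2, by omega⟩ (if (k : ℕ) % 2 = 0 then 0 else 1),
    (A.mem_boundary_iff _ _).2 (by split_ifs <;> simp)⟩

theorem puncture_injective (A : ArcSystem T n) : Function.Injective A.puncture := by
  intro k l h
  have h' := congrArg Subtype.val h
  simp only [puncture] at h'
  by_cases hkl : (k : ℕ) / 2 = l / 2
  · have e : (⟨(k : ℕ) / 2, by omega⟩ : Fin n) = ⟨(l : ℕ) / 2, by omega⟩ := Fin.ext hkl
    rw [e] at h'
    have h2 := (A.isEmbedding _).injective h'
    apply Fin.ext
    split_ifs at h2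
    · omega
    · exact absurd h2 (by simp)
    · exact absurd h2 (by simp)
    · omega
  · exact absurd h' (Set.disjoint_iff_forall_ne.1
      (A.disjoint _ _ (fun hh => hkl (congrArg Fin.val hh))) (mem_range_self _) (mem_range_self _))

/-- `MCG_{2n}(T)`. -/
abbrev mcg (A : ArcSystem T n) : Type u := MCG T (range A.puncture)

/-- `PMCG_{2n}(T)`. -/
abbrev pmcg (A : ArcSystem T n) : Subgroup A.mcg := PMCG T (range A.puncture)

/-- The homomorphism `MCG_{2n}(T) → Σ_{2n}`. -/
def p [T1Space H] (A : ArcSystem T n) : A.mcg →* Equiv.Perm (Fin (2 * n)) :=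
  permHom A.puncture_injective

/-- The group `ℰ` of the elements of `MCG_{2n}(T)` that admit an extension to a homeomorphism of `H`
mapping the union of the arcs to itself. -/
def extendable (A : ArcSystem T n) : Subgroup A.mcg :=
  Subgroup.map (mappingClass T (range A.puncture))
    { carrier := {f | ∃ F : H ≃ₜ H, (∀ x : T, F x = f.1 x) ∧ F '' A.union = A.union}
      one_mem' := ⟨1, fun _ => rfl, image_id A.union⟩
      mul_mem' := by
        rintro f k ⟨F, hF, hF'⟩ ⟨K, hK, hK'⟩
        refine ⟨F * K, fun x => ?_, ?_⟩
        · change F (K x) = f.1 (k.1 x)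
          rw [hK, hF]
        · have : ((F * K : H ≃ₜ H) : H → H) = F ∘ K := rfl
          rw [this, image_comp, hK', hF']
      inv_mem' := by
        rintro f ⟨F, hF, hF'⟩
        refine ⟨F.symm, fun x => ?_, ?_⟩
        · change F.symm x = (f.1.symm x : T)
          rw [Homeomorph.symm_apply_eq, hF, Homeomorph.apply_symm_apply]
        · conv_lhs => rw [← hF']
          exact F.toEquiv.symm_image_image A.union }

/-- The group `ℰ̄ = PMCG ∩ ℰ`. -/
def pureExtendable (A : ArcSystem T n) : Subgroup A.mcg := A.pmcg ⊓ A.extendable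

/-- The inclusion of `ℰ̄` into `ℰ`. -/
def pureInclusion (A : ArcSystem T n) : A.pureExtendable →* A.extendable :=
  Subgroup.inclusion inf_le_right

end ArcSystem

/-- The subgroup `Σ'_{2n}` of `Σ_{2n}` generated by `(1 2)` and `(2i-1 2i+1)(2i 2i+2)`,
`1 ≤ i ≤ n-1`. The letters `1, …, 2n` are written as `0, …, 2n-1`. -/
def sigmaPrime (n : ℕ) : Subgroup (Equiv.Perm (Fin (2 * n))) :=
  Subgroup.closure
    ({σ | ∃ h : 1 < 2 * n, σ = Equiv.swap ⟨0, by omega⟩ ⟨1, h⟩} ∪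
     {σ | ∃ (i : ℕ) (h : 2 * i + 3 < 2 * n),
        σ = Equiv.swap ⟨2 * i, by omega⟩ ⟨2 * i + 2, by omega⟩ *
          Equiv.swap ⟨2 * i + 1, by omega⟩ ⟨2 * i + 3, h⟩})

/-- The sequence `1 → A → B → C → 1` is exact. -/
def ShortExactGroups {A B C : Type*} [Group A] [Group B] [Group C] (i : A →* B) (q : B →* C) :
    Prop :=
  Function.Injective i ∧ Function.MulExact i q ∧ Function.Surjective q

end

noncomputable section

/-! ### Extension of compactly supported maps along open embeddings -/

/-! The kernel of `p` consists of the pure classes, because `p` records the action on the punctures.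
Surjectivity of `p` on the full group holds because the connected surface `T` stays connected after
removing finitely many points. Hence a puncture can be pushed next to any other one while the
remaining ones stay fixed, and the two can be swapped by a half turn in a small chart
(`exists_admissible_swap`).

For the second sequence, a homeomorphism of `H` that preserves the union of the arcs permutes the
arcs, so its action on the endpoints respects the pairs of labels. The permutations respecting the
pairs all lie in `sigmaPrime n`: such a permutation is a permutation of the pairs followed by flips
inside the pairs (`mem_sigmaPrime_of_pair_preserving`). Conversely, a flip is realized by a half
twist along an arc in a chart around its disc (`IsArcChart.exists_flip`), and two arcs can be
exchanged (`exists_arc_exchange`). The exchange does not say which endpoint goes to which, but the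
flips correct this.

The exchange is the main work, since everything is merely continuous. A foot of the first arc is
dragged to a point of the second arc's chart away from the second arc, and both arcs are shrunk to
small bridges. The chart carrying the first bridge is then an arbitrary topological chart inside the
other one. Uniqueness of local collars (`exists_collar_change`) makes it a product near the
boundary, so that the bridge has one vertical strand and a second strand given by a curve `w` in the
levels. Rotations and radial stretchings inside the levels (`exists_straightening`) give two such
bridges a common shape, and a half turn interchanges them (`exists_exchange`).

All homeomorphisms of `H` are composed of compactly supported ones in boundary charts. On `T` these
are homotopic to the identity by a straight-line homotopy in the chart, so they act trivially on
homology and preserve the orientation. This is the role of `Admissible`; the homotopy need not pass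
through homeomorphisms. -/

theorem exists_continuous_extension {Q X Y : Type*} [TopologicalSpace Q] [TopologicalSpace X]
    [TopologicalSpace Y] [T2Space Y] {e : X → Y} (he : IsOpenEmbedding e) {K : Set X}
    (hK : IsCompact K) {f : Q × X → X} (hf : Continuous f) (hfK : ∀ q x, x ∉ K → f (q, x) = x) :
    ∃ G : Q × Y → Y, Continuous G ∧ (∀ q x, G (q, e x) = e (f (q, x))) ∧
      ∀ q y, y ∉ e '' K → G (q, y) = y := by
  have h1 : ∀ q x, Function.extend e (fun x => e (f (q, x))) id (e x) = e (f (q, x)) :=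
    fun q x => he.injective.extend_apply _ _ _
  have h2 : ∀ q y, y ∉ e '' K → Function.extend e (fun x => e (f (q, x))) id y = y := by
    intro q y hy
    by_cases hr : ∃ x, e x = y
    · obtain ⟨x, rfl⟩ := hr
      rw [h1, hfK q x fun hx => hy (mem_image_of_mem e hx)]
    · rw [Function.extend_apply' _ _ _ hr, id]
  refine ⟨fun p => Function.extend e (fun x => e (f (p.1, x))) id p.2, ?_, h1, h2⟩
  rw [continuous_iff_continuousAt]
  rintro ⟨q, y⟩
  by_cases hy : y ∈ e '' K
  · obtain ⟨x, -, rfl⟩ := hy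
    -- On the open image of the chart the map is `f` in coordinates. Off the compact, hence closed,
    -- set `e '' K` it is locally the projection.
    have := (IsOpenEmbedding.id (X := Q)).prodMap he
    refine (this.continuousAt_iff (x := (q, x))).1 (Continuous.continuousAt ?_)
    refine (he.continuous.comp hf).congr fun p => ?_
    exact (h1 p.1 p.2).symm
  · have hc : IsClosed (e '' K) := (hK.image he.continuous).isClosed
    refine continuousAt_snd.congr ?_
    have : ∀ᶠ p : Q × Y in 𝓝 (q, y), p.2 ∉ e '' K :=
      (hc.isOpen_compl.preimage continuous_snd).mem_nhds hy
    filter_upwards [this] with p hp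
    exact (h2 p.1 p.2 hp).symm

theorem exists_homeomorph_extension {X Y : Type*} [TopologicalSpace X] [TopologicalSpace Y]
    [T2Space Y] {e : X → Y} (he : IsOpenEmbedding e) {K : Set X} (hK : IsCompact K) (φ : X ≃ₜ X)
    (hφ : ∀ x, x ∉ K → φ x = x) :
    ∃ F : Y ≃ₜ Y, (∀ x, F (e x) = e (φ x)) ∧ ∀ y, y ∉ e '' K → F y = y := by
  obtain ⟨G, hG, h1, h2⟩ := exists_continuous_extension (Q := Unit) he hK
    (f := fun p => φ p.2) (by fun_prop) (fun _ => hφ)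
  have hφ' : ∀ x, x ∉ K → φ.symm x = x := fun x hx => by
    rw [Homeomorph.symm_apply_eq, hφ x hx]
  obtain ⟨G', hG', h1', h2'⟩ := exists_continuous_extension (Q := Unit) he hK
    (f := fun p => φ.symm p.2) (by fun_prop) (fun _ => hφ')
  refine ⟨⟨⟨fun y => G ((), y), fun y => G' ((), y), fun y => ?_, fun y => ?_⟩, by
    change Continuous (fun y => G ((), y)); fun_prop, by
    change Continuous (fun y => G' ((), y)); fun_prop⟩, h1 (), h2 ()⟩
  · by_cases hy : y ∈ e '' K
    · obtain ⟨x, -, rfl⟩ := hy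
      simp only [h1, h1', Homeomorph.symm_apply_apply]
    · simp only [h2 _ _ hy, h2' _ _ hy]
  · by_cases hy : y ∈ e '' K
    · obtain ⟨x, -, rfl⟩ := hy
      simp only [h1, h1', Homeomorph.apply_symm_apply]
    · simp only [h2 _ _ hy, h2' _ _ hy]

/-! ### Homeomorphisms homotopic to the identity on the boundary -/

/-- `F` preserves `T`, and its restriction to `T` is homotopic to the identity. -/
def Admissible {H : Type*} [TopologicalSpace H] (T : Set H) (F : H ≃ₜ H) : Prop :=
  (∀ x, F x ∈ T ↔ x ∈ T) ∧ ∃ Φ : unitInterval × T → T, Continuous Φ ∧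
    (∀ x, Φ (0, x) = x) ∧ ∀ x, (Φ (1, x) : H) = F x

namespace Admissible

variable {H : Type u} [TopologicalSpace H] {T : Set H} {F K : H ≃ₜ H}

theorem mul (hF : Admissible T F) (hK : Admissible T K) : Admissible T (F * K) := by
  obtain ⟨hF, Φ, cΦ, Φ0, Φ1⟩ := hF
  obtain ⟨hK, Ψ, cΨ, Ψ0, Ψ1⟩ := hK
  refine ⟨fun x => (hF (K x)).trans (hK x), fun p => Φ (p.1, Ψ p), by fun_prop, fun x => ?_,
    fun x => ?_⟩
  · simp only [Φ0, Ψ0]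
  · rw [Φ1, Ψ1]; rfl

theorem inv (hF : Admissible T F) : Admissible T F⁻¹ := by
  obtain ⟨hF, Φ, cΦ, Φ0, Φ1⟩ := hF
  have hF' : ∀ x, F.symm x ∈ T ↔ x ∈ T := fun x => by rw [← hF, F.apply_symm_apply]
  -- The homotopy is `F⁻¹ ∘ Φ` run backwards: it starts at `F⁻¹ ∘ F` and ends at `F⁻¹`.
  refine ⟨hF', fun p => ⟨F.symm (Φ (unitInterval.symm p.1, p.2)), (hF' _).2 (Φ _).2⟩, ?_,
    fun x => ?_, fun x => ?_⟩
  · refine Continuous.subtype_mk (F.symm.continuous.comp (continuous_subtype_val.comp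
      (cΦ.comp ?_))) _
    fun_prop
  · ext; simp [Φ1]
  · simp only [unitInterval.symm_one, Φ0]; rfl

/-- The restriction to the boundary. -/
def restrict (hF : Admissible T F) : T ≃ₜ T := F.subtype fun x => (hF.1 x).symm

/-- Homotopy invariance of singular homology: the induced map on the second homology is that of the
identity. -/
theorem orientationPreserving (hF : Admissible T F) : OrientationPreserving hF.restrict := by
  obtain ⟨hT, Φ, cΦ, Φ0, Φ1⟩ := id hF
  let h : ContinuousMap.Homotopy (ContinuousMap.id T) (hF.restrict : C(T, T)) :=
    { toFun := Φ
      continuous_toFun := cΦ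
      map_zero_left := Φ0
      map_one_left := fun x => Subtype.ext (Φ1 x) }
  have h' : TopCat.Homotopy (𝟙 (TopCat.of T)) (TopCat.ofHom (hF.restrict : C(T, T))) := h
  have := h'.congr_homologyMap_singularChainComplexFunctor (ModuleCat.of ℤ (ULift.{u} ℤ)) 2
  unfold OrientationPreserving
  refine Eq.trans this.symm ?_
  exact CategoryTheory.Functor.map_id
    (((AlgebraicTopology.singularHomologyFunctor (ModuleCat.{u} ℤ) 2).obj
    (ModuleCat.of ℤ (ULift.{u} ℤ)))) (TopCat.of T)

end Admissible

/-! ### Boundary charts and extension by the identity -/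

/-- The closed half-space of dimension three. -/
abbrev HS : Type := ℂ × NNReal

/-- A chart of the manifold `H` with boundary `T`, defined on the half-space. -/
structure IsBoundaryChart {H : Type*} [TopologicalSpace H] (T : Set H) (e : HS → H) : Prop where
  isOpenEmbedding : IsOpenEmbedding e
  mem_iff : ∀ x, e x ∈ T ↔ x.2 = 0

theorem IsBoundaryChart.comp {H : Type*} [TopologicalSpace H] {T : Set H} {e : HS → H}
    (he : IsBoundaryChart T e) {j : HS → HS} (hj : IsOpenEmbedding j)
    (h : ∀ x, (j x).2 = 0 ↔ x.2 = 0) : IsBoundaryChart T (e ∘ j) :=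
  ⟨he.1.comp hj, fun x => (he.2 (j x)).trans (h x)⟩

theorem IsBoundaryChart.homeo_comp {H : Type*} [TopologicalSpace H] {T : Set H} {e : HS → H}
    (he : IsBoundaryChart T e) {F : H ≃ₜ H} (hF : Admissible T F) : IsBoundaryChart T (F ∘ e) :=
  ⟨F.isOpenEmbedding.comp he.1, fun x => (hF.1 (e x)).trans (he.2 x)⟩

theorem IsBoundaryChart.isOpenEmbedding_base {H : Type*} [TopologicalSpace H] {T : Set H}
    {e : HS → H} (he : IsBoundaryChart T e) :
    IsOpenEmbedding (fun z : ℂ => (⟨e (z, 0), (he.2 _).2 rfl⟩ : T)) := by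
  have hc : Continuous (fun z : ℂ => (⟨e (z, 0), (he.2 _).2 rfl⟩ : T)) :=
    Continuous.subtype_mk (he.1.continuous.comp (by fun_prop)) _
  refine ⟨⟨⟨?_⟩, ?_⟩, ?_⟩
  · have h1 : IsInducing (fun z : ℂ => e (z, 0)) :=
      he.1.isInducing.comp (isInducing_prodMkLeft (0 : NNReal))
    have : IsInducing (fun z : ℂ => (⟨e (z, 0), (he.2 _).2 rfl⟩ : T)) :=
      IsInducing.of_comp hc continuous_subtype_val h1
    exact this.eq_induced
  · intro z w h
    exact congrArg Prod.fst (he.1.injective (congrArg Subtype.val h))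
  · have : range (fun z : ℂ => (⟨e (z, 0), (he.2 _).2 rfl⟩ : T)) = Subtype.val ⁻¹' (range e) := by
      ext ⟨x, hx⟩
      constructor
      · rintro ⟨z, hz⟩
        exact ⟨(z, 0), congrArg Subtype.val hz⟩
      · rintro ⟨⟨z, s⟩, rfl⟩
        obtain rfl : s = 0 := (he.2 _).1 hx
        exact ⟨z, rfl⟩
    rw [this]
    exact he.1.isOpen_range.preimage continuous_subtype_val

/-- A compactly supported homeomorphism of the half-space which preserves the boundary plane extends
by the identity from a boundary chart. -/
theorem IsBoundaryChart.exists_admissible {H : Type*} [TopologicalSpace H] [T2Space H] {T : Set H}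
    {e : HS → H} (he : IsBoundaryChart T e) {K : Set HS} (hK : IsCompact K) (φ : HS ≃ₜ HS)
    (hφ : ∀ x, x ∉ K → φ x = x) (hφ0 : ∀ x, (φ x).2 = 0 ↔ x.2 = 0) :
    ∃ F : H ≃ₜ H, Admissible T F ∧ (∀ x, F (e x) = e (φ x)) ∧ ∀ y, y ∉ e '' K → F y = y := by
  obtain ⟨F, h1, h2⟩ := exists_homeomorph_extension he.1 hK φ hφ
  refine ⟨F, ⟨fun y => ?_, ?_⟩, h1, h2⟩
  · by_cases hy : y ∈ e '' K
    · obtain ⟨x, -, rfl⟩ := hy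
      rw [h1, he.2, he.2, hφ0]
    · rw [h2 y hy]
  · let b : ℂ → T := fun z => ⟨e (z, 0), (he.2 _).2 rfl⟩
    -- The straight-line homotopy in the boundary plane from `z` to the image of `z` under `φ`. It
    -- is stationary off the projection of `K`, so it extends to `T`.
    obtain ⟨Φ, cΦ, hΦ, hΦ'⟩ := exists_continuous_extension (Q := unitInterval)
      he.isOpenEmbedding_base (hK.image continuous_fst)
      (f := fun p => p.2 + ((p.1 : ℝ) : ℂ) * ((φ (p.2, 0)).1 - p.2)) (by fun_prop) (by
        intro q z hz
        have : (z, (0 : NNReal)) ∉ K := fun h => hz ⟨_, h, rfl⟩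
        simp [hφ _ this])
    refine ⟨Φ, cΦ, fun x => ?_, fun x => ?_⟩
    · by_cases hx : x ∈ b '' (Prod.fst '' K)
      · obtain ⟨z, -, rfl⟩ := hx
        simp only [b, hΦ]
        simp
      · exact hΦ' _ _ hx
    · by_cases hx : x ∈ b '' (Prod.fst '' K)
      · obtain ⟨z, -, rfl⟩ := hx
        have := (hφ0 (z, 0)).2 rfl
        simp only [b, hΦ, h1]
        congr 1
        ext <;> simp [this]
      · rw [hΦ' _ _ hx, h2]
        rintro ⟨⟨z, s⟩, hz, hx'⟩
        obtain rfl : s = 0 := (he.2 (z, s)).1 (hx' ▸ x.2)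
        exact hx ⟨z, ⟨_, hz, rfl⟩, Subtype.ext hx'⟩

/-! ### Level-preserving homeomorphisms of the half-space -/

/-- `φ` is the identity outside of a compact set. -/
def CompactlySupported {X : Type*} [TopologicalSpace X] (φ : X ≃ₜ X) : Prop :=
  ∃ K : Set X, IsCompact K ∧ ∀ x, x ∉ K → φ x = x

theorem CompactlySupported.mul {X : Type*} [TopologicalSpace X] {φ ψ : X ≃ₜ X}
    (hφ : CompactlySupported φ) (hψ : CompactlySupported ψ) : CompactlySupported (φ * ψ) := by
  obtain ⟨K, hK, h⟩ := hφ
  obtain ⟨L, hL, h'⟩ := hψ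
  refine ⟨K ∪ L, hK.union hL, fun x hx => ?_⟩
  rw [mem_union, not_or] at hx
  change φ (ψ x) = x
  rw [h' x hx.2, h x hx.1]

theorem CompactlySupported.inv {X : Type*} [TopologicalSpace X] {φ : X ≃ₜ X}
    (hφ : CompactlySupported φ) : CompactlySupported φ⁻¹ := by
  obtain ⟨K, hK, h⟩ := hφ
  refine ⟨K, hK, fun x hx => ?_⟩
  change φ.symm x = x
  rw [Homeomorph.symm_apply_eq, h x hx]

/-- Rotation by the angle `α r s` of the circle of radius `r` about `m s` in the level `s`. -/
def twistFun (m : NNReal → ℂ) (α : ℝ → NNReal → ℝ) (x : HS) : HS :=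
  (m x.2 + Complex.exp (α ‖x.1 - m x.2‖ x.2 * Complex.I) * (x.1 - m x.2), x.2)

/-- A twist preserves the level and the distance to the centre, and the angle depends on these
alone; so opposite angles give inverse maps. -/
theorem twistFun_twistFun (m : NNReal → ℂ) {α β : ℝ → NNReal → ℝ} (h : ∀ r s, α r s + β r s = 0)
    (x : HS) : twistFun m α (twistFun m β x) = x := by
  obtain ⟨z, s⟩ := x
  simp only [twistFun, add_sub_cancel_left, norm_mul, Complex.norm_exp_ofReal_mul_I, one_mul]
  rw [← mul_assoc, ← Complex.exp_add, ← add_mul, ← Complex.ofReal_add, h]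
  simp

theorem exists_twist (m : NNReal → ℂ) (α : ℝ → NNReal → ℝ) (h : Continuous (twistFun m α))
    (h' : Continuous (twistFun m fun r s => -α r s)) :
    ∃ φ : HS ≃ₜ HS, ∀ x, φ x = twistFun m α x :=
  ⟨⟨⟨twistFun m α, twistFun m fun r s => -α r s, fun x => twistFun_twistFun m (by simp) x,
    fun x => twistFun_twistFun m (by simp) x⟩, h, h'⟩, fun _ => rfl⟩

theorem exists_halfTurn (m : NNReal → ℂ) (hm : Continuous m) {R : ℝ} (hR : 0 < R) (S : NNReal) :
    ∃ φ : HS ≃ₜ HS, CompactlySupported φ ∧ (∀ x, (φ x).2 = x.2) ∧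
      ∀ x : HS, ‖x.1 - m x.2‖ ≤ R → x.2 ≤ S → φ x = (2 * m x.2 - x.1, x.2) := by
  -- The angle is `π` for radius at most `R` and level at most `S`, and it has faded to zero at
  -- radius `2 * R` or level `S + 1`.
  let α : ℝ → NNReal → ℝ := fun r s =>
    Real.pi * (max 0 (min 1 (2 - r / R)) * max 0 (min 1 ((S : ℝ) + 1 - s)))
  obtain ⟨φ, hφ⟩ := exists_twist m α (by unfold twistFun; fun_prop) (by unfold twistFun; fun_prop)
  refine ⟨φ, ⟨(fun p : ℂ × NNReal => (m p.2 + p.1, p.2)) '' Metric.closedBall 0 (2 * R) ×ˢ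
    Icc 0 (S + 1), ?_, fun x hx => ?_⟩, fun x => by rw [hφ]; rfl, fun x h1 h2 => ?_⟩
  · exact ((isCompact_closedBall _ _).prod isCompact_Icc).image (by fun_prop)
  · have : α ‖x.1 - m x.2‖ x.2 = 0 := by
      by_contra hα
      refine hx ⟨(x.1 - m x.2, x.2), ⟨?_, zero_le, ?_⟩, by simp⟩
      · rw [mem_closedBall_zero_iff]
        by_contra! h
        have : 2 - ‖x.1 - m x.2‖ / R ≤ 0 := by
          rw [sub_nonpos, le_div_iff₀ hR]; exact h.le
        exact hα (by simp [α, this])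
      · by_contra! h
        have h' : (S : ℝ) + 1 < x.2 := by exact_mod_cast h
        have : (S : ℝ) + 1 - x.2 ≤ 0 := by linarith
        exact hα (by simp [α, this])
    rw [hφ, twistFun, this]
    simp
  · have e1 : 1 ≤ 2 - ‖x.1 - m x.2‖ / R := by
      have := (div_le_one hR).2 h1
      linarith
    have e2 : (1 : ℝ) ≤ (S : ℝ) + 1 - x.2 := by
      have : (x.2 : ℝ) ≤ S := by exact_mod_cast h2
      linarith
    have : α ‖x.1 - m x.2‖ x.2 = Real.pi := by simp [α, e1, e2]
    rw [hφ, twistFun, this, Complex.exp_pi_mul_I]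
    ext
    · simp; ring
    · rfl

/-- A level-preserving map which is close to the identity near the levels `s ≥ c` is continuous if
it is so below the level `c`. -/
theorem continuous_of_continuousOn_lt {f : HS → HS} (hf : ∀ x, (f x).2 = x.2) {c : NNReal}
    {B : NNReal → ℝ} (hB : Continuous B) (hc : ∀ s, c ≤ s → B s = 0)
    (hfB : ∀ x, ‖(f x).1 - x.1‖ ≤ B x.2) (h : ContinuousOn f {x | x.2 < c}) : Continuous f := by
  rw [continuous_iff_continuousAt]
  intro x
  by_cases hx : x.2 < c
  · exact h.continuousAt ((isOpen_lt continuous_snd continuous_const).mem_nhds hx)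
  · have hx0 : B x.2 = 0 := hc _ (not_lt.1 hx)
    have h1 : Filter.Tendsto (fun y => (f y).1 - y.1) (𝓝 x) (𝓝 0) := by
      refine squeeze_zero_norm hfB ?_
      rw [← hx0]
      exact (hB.comp continuous_snd).tendsto x
    have hx1 : (f x).1 = x.1 := by
      have := hfB x
      rw [hx0] at this
      exact sub_eq_zero.1 (norm_le_zero_iff.1 this)
    have h2 : Filter.Tendsto (fun y => (f y).1) (𝓝 x) (𝓝 (f x).1) := by
      have := h1.add (continuous_fst.tendsto x)
      simpa [hx1] using this
    have h3 : Filter.Tendsto (fun y => (f y).2) (𝓝 x) (𝓝 (f x).2) := by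
      simp only [hf]
      exact continuous_snd.tendsto x
    exact h2.prodMk_nhds h3

/-- The map `x ↦ c|x| / (1 + |x|)` folds the line onto `[0, c)`, with section `s ↦ s / (c - s)`. The
path on the line lifts through the covering `exp`, and the imaginary part of the lift is the angle.
Nothing is claimed at the level `c`, where the angle may have no limit. -/
theorem exists_continuousOn_angle {w : NNReal → ℂ} (hw : Continuous w) {c : NNReal} (hc : 0 < c)
    (h0 : ∀ s < c, w s ≠ 0) :
    ∃ θ : NNReal → ℝ, ContinuousOn θ (Iio c) ∧
      ∀ s < c, w s = ‖w s‖ * Complex.exp (θ s * Complex.I) := by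
  have hnn : Continuous Real.nnabs := Continuous.subtype_mk continuous_abs _
  have hlt : ∀ x : ℝ, c * (Real.nnabs x / (1 + Real.nnabs x)) < c := fun x => by
    refine mul_lt_of_lt_one_right hc ?_
    rw [div_lt_one (by positivity)]
    exact lt_add_of_pos_left _ one_pos
  have hcont : Continuous fun x : ℝ => c * (Real.nnabs x / (1 + Real.nnabs x)) := by
    refine continuous_const.mul (Continuous.div ?_ ?_ fun x => by positivity) <;> fun_prop
  let γ : C(ℝ, {z : ℂ // z ≠ 0}) :=
    ⟨fun x => ⟨w (c * (Real.nnabs x / (1 + Real.nnabs x))), h0 _ (hlt x)⟩, by fun_prop⟩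
  obtain ⟨Λ, ⟨-, hΛ⟩, -⟩ := Complex.isCoveringMap_exp.existsUnique_continuousMap_lifts γ 0
    (Complex.log (γ 0)) (Subtype.ext (Complex.exp_log (γ 0).2))
  refine ⟨fun s => (Λ ((s : ℝ) / (c - s))).im, ?_, fun s hs => ?_⟩
  · refine Complex.continuous_im.comp_continuousOn (Λ.continuous.comp_continuousOn ?_)
    refine ContinuousOn.div (by fun_prop) (by fun_prop) fun s hs => ?_
    have : (s : ℝ) < c := by exact_mod_cast hs
    linarith
  · have hs' : (s : ℝ) < c := by exact_mod_cast hs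
    have e : c * (Real.nnabs ((s : ℝ) / (c - s)) / (1 + Real.nnabs ((s : ℝ) / (c - s)))) = s := by
      apply NNReal.coe_injective
      have h1 : (0 : ℝ) < c - s := by linarith
      have h2 : (0 : ℝ) < c := hc
      simp only [NNReal.coe_mul, NNReal.coe_div, NNReal.coe_add, Real.coe_nnabs, NNReal.coe_one]
      rw [abs_of_nonneg (by positivity)]
      field_simp
      ring
    have h3 : Complex.exp (Λ ((s : ℝ) / (c - s))) = w s := by
      have := congrArg Subtype.val (congrFun hΛ ((s : ℝ) / (c - s)))
      simp only [γ, ContinuousMap.coe_mk, e] at this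
      exact this
    rw [← h3, Complex.norm_exp, Complex.ofReal_exp, ← Complex.exp_add, Complex.re_add_im]

/-- Rotations in the levels move `y + w s` to `y + ‖w s‖ u`. There is no condition on the angles
`arg (w s)`, which may be unbounded when `w s` tends to zero. -/
theorem exists_rotation {w : NNReal → ℂ} (hw : Continuous w) {c : NNReal} (hc : 0 < c)
    (h0 : ∀ s, w s = 0 ↔ c ≤ s) (y u : ℂ) (hu : ‖u‖ = 1) :
    ∃ φ : HS ≃ₜ HS, (∀ x, (φ x).2 = x.2) ∧
      (∀ x : HS, 2 * ‖w x.2‖ ≤ ‖x.1 - y‖ → φ x = x) ∧ (∀ s, φ (y, s) = (y, s)) ∧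
      ∀ s, φ (y + w s, s) = (y + ‖w s‖ * u, s) := by
  have hne : ∀ s < c, w s ≠ 0 := fun s hs h => hs.not_ge ((h0 s).1 h)
  obtain ⟨θ, cθ, hθ⟩ := exists_continuousOn_angle hw hc hne
  -- The full correction angle applies up to radius `‖w s‖`, where the moving strand lies, and fades
  -- out at `2 * ‖w s‖`. The twisted region thus shrinks to a point as `w s` tends to zero.
  let α : ℝ → NNReal → ℝ := fun r s =>
    if s < c then (u.arg - θ s) * max 0 (min 1 (2 - r / ‖w s‖)) else 0
  have key : ∀ σ : ℝ, Continuous (twistFun (fun _ => y) fun r s => σ * α r s) ∧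
      ∀ x : HS, 2 * ‖w x.2‖ ≤ ‖x.1 - y‖ → twistFun (fun _ => y) (fun r s => σ * α r s) x = x := by
    intro σ
    have hid : ∀ x : HS, 2 * ‖w x.2‖ ≤ ‖x.1 - y‖ →
        twistFun (fun _ => y) (fun r s => σ * α r s) x = x := by
      intro x hx
      have : α ‖x.1 - y‖ x.2 = 0 := by
        by_cases hs : x.2 < c
        · have : 2 - ‖x.1 - y‖ / ‖w x.2‖ ≤ 0 := by
            rw [sub_nonpos, le_div_iff₀ (norm_pos_iff.2 (hne _ hs))]
            exact hx
          simp [α, this]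
        · simp [α, hs]
      simp [twistFun, this]
    -- A point that moves stays on a circle of radius less than `2 * ‖w s‖`, so it moves by at most
    -- `4 * ‖w s‖`. This gives continuity at the level `c` even if the angle is unbounded there.
    refine ⟨continuous_of_continuousOn_lt (fun _ => rfl) (c := c) (B := fun s => 4 * ‖w s‖)
      (by fun_prop) (fun s hs => by simp [(h0 s).2 hs]) (fun x => ?_) ?_, hid⟩
    · by_cases hx : 2 * ‖w x.2‖ ≤ ‖x.1 - y‖
      · rw [hid x hx, sub_self, norm_zero]
        positivity
      · have h1 : ‖(twistFun (fun _ => y) (fun r s => σ * α r s) x).1 - y‖ = ‖x.1 - y‖ := by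
          simp only [twistFun, add_sub_cancel_left, norm_mul, Complex.norm_exp_ofReal_mul_I,
            one_mul]
        have h2 := norm_sub_le_norm_sub_add_norm_sub
          (twistFun (fun _ => y) (fun r s => σ * α r s) x).1 y x.1
        rw [h1, norm_sub_rev y] at h2
        linarith
    · have hα : ContinuousOn (fun x : HS => α ‖x.1 - y‖ x.2) {x | x.2 < c} := by
        have h1 : ContinuousOn (fun x : HS => θ x.2) {x | x.2 < c} :=
          cθ.comp continuousOn_snd fun x hx => hx
        have h2 : ContinuousOn (fun x : HS => ‖x.1 - y‖ / ‖w x.2‖) {x | x.2 < c} :=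
          ContinuousOn.div (by fun_prop) (by fun_prop) fun x hx => norm_ne_zero_iff.2 (hne _ hx)
        refine ((continuousOn_const (c := u.arg)).sub h1).mul ((continuousOn_const (c := (0 : ℝ))).sup
          ((continuousOn_const (c := (1 : ℝ))).inf
            ((continuousOn_const (c := (2 : ℝ))).sub h2))) |>.congr fun x hx => ?_
        simp [α, show x.2 < c from hx]
      exact (continuousOn_const.add ((Complex.continuous_exp.comp_continuousOn
        ((Complex.continuous_ofReal.comp_continuousOn (continuousOn_const.mul hα)).mul
        continuousOn_const)).mul (continuousOn_fst.sub continuousOn_const))).prodMk continuousOn_snd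
  obtain ⟨φ, hφ⟩ := exists_twist (fun _ => y) α (by simpa using (key 1).1)
    (by simpa using (key (-1)).1)
  refine ⟨φ, fun x => by rw [hφ]; rfl, fun x hx => ?_, fun s => ?_, fun s => ?_⟩
  · rw [hφ]
    simpa using (key 1).2 x hx
  · simp [hφ, twistFun]
  · rw [hφ, twistFun]
    by_cases hs : s < c
    · have : α ‖w s‖ s = u.arg - θ s := by
        have : (2 : ℝ) - ‖w s‖ / ‖w s‖ = 1 := by
          rw [div_self (norm_ne_zero_iff.2 (hne s hs))]; norm_num
        simp [α, hs, this]
      ext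
      · simp only [add_sub_cancel_left, this]
        congr 1
        have hu' : Complex.exp (u.arg * Complex.I) = u := by
          have := Complex.norm_mul_exp_arg_mul_I u
          rwa [hu, Complex.ofReal_one, one_mul] at this
        calc _ = Complex.exp ((u.arg - θ s : ℝ) * Complex.I) *
              (‖w s‖ * Complex.exp (θ s * Complex.I)) := by rw [← hθ s hs]
          _ = ‖w s‖ * Complex.exp (u.arg * Complex.I) := by
            rw [mul_left_comm, ← Complex.exp_add]
            congr 2
            push_cast
            ring
          _ = _ := by rw [hu']
      · rfl
    · simp [(h0 s).2 (not_lt.1 hs)]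

/-- Radial stretching in the levels moves the circle of radius `a s` about `y` to the circle of
radius `a s + d s`. -/
theorem exists_stretch {a d : NNReal → ℝ} (ca : Continuous a) (cd : Continuous d) {c : NNReal}
    (ha : ∀ s < c, 0 < a s) (hd : ∀ s < c, 0 ≤ d s) (h0 : ∀ s, c ≤ s → a s = 0 ∧ d s = 0) (y : ℂ) :
    ∃ φ : HS ≃ₜ HS, (∀ x, (φ x).2 = x.2) ∧
      (∀ x : HS, a x.2 + 2 * d x.2 ≤ ‖x.1 - y‖ → φ x = x) ∧ (∀ s, φ (y, s) = (y, s)) ∧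
      ∀ u : ℂ, ‖u‖ = 1 → ∀ s, φ (y + a s * u, s) = (y + ((a s + d s : ℝ) : ℂ) * u, s) := by
  have ha0 : ∀ s, 0 ≤ a s := fun s => by
    by_cases hs : s < c
    · exact (ha s hs).le
    · exact (h0 s (not_lt.1 hs)).1.ge
  have hd0 : ∀ s, 0 ≤ d s := fun s => by
    by_cases hs : s < c
    · exact hd s hs
    · exact (h0 s (not_lt.1 hs)).2.ge
  -- The radius `r` becomes `(1 + k) r`: linear from `[0, a]` onto `[0, a + d]`, equal to `(a + 2d +
  -- r) / 2` on `[a, a + 2d]`, and unchanged beyond. The factor `1 - k'` gives the inverse, with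
  -- middle piece `2r - a - 2d`. The inner maxima keep the denominators positive below the level
  -- `c`.
  let k : ℝ → NNReal → ℝ := fun r s => max 0 ((a s + 2 * d s - max r (a s)) / (2 * max r (a s)))
  let k' : ℝ → NNReal → ℝ := fun r s =>
    max 0 ((a s + 2 * d s - max r (a s + d s)) / max r (a s + d s))
  let f : HS → HS := fun x => (x.1 + k ‖x.1 - y‖ x.2 * (x.1 - y), x.2)
  let f' : HS → HS := fun x => (x.1 - k' ‖x.1 - y‖ x.2 * (x.1 - y), x.2)
  have kid : ∀ r s, a s + 2 * d s ≤ r → k r s = 0 := fun r s h => by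
    have h1 : a s ≤ r := by linarith [hd0 s]
    simp only [k, max_eq_left h1]
    exact max_eq_left (div_nonpos_of_nonpos_of_nonneg (by linarith) (by linarith [ha0 s]))
  have kid' : ∀ r s, a s + 2 * d s ≤ r → k' r s = 0 := fun r s h => by
    have h1 : a s + d s ≤ r := by linarith [hd0 s]
    simp only [k', max_eq_left h1]
    exact max_eq_left (div_nonpos_of_nonpos_of_nonneg (by linarith) (by linarith [ha0 s, hd0 s]))
  have k0 : ∀ r s, 0 ≤ k r s := fun r s => le_max_left _ _
  have k0' : ∀ r s, 0 ≤ k' r s := fun r s => le_max_left _ _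
  have kA : ∀ r s, 0 < a s → r ≤ a s → k r s = d s / a s := fun r s h1 h2 => by
    simp only [k, max_eq_right h2]
    rw [max_eq_right (div_nonneg (by linarith [hd0 s]) (by linarith))]
    field_simp
    ring
  have kA' : ∀ r s, 0 < a s → r ≤ a s + d s → k' r s = d s / (a s + d s) := fun r s h1 h2 => by
    simp only [k', max_eq_right h2]
    rw [max_eq_right (div_nonneg (by linarith [hd0 s]) (by linarith [hd0 s]))]
    congr 1
    ring
  have kB : ∀ r s, 0 < a s → a s ≤ r → r ≤ a s + 2 * d s →
      k r s = (a s + 2 * d s - r) / (2 * r) := fun r s h1 h2 h3 => by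
    simp only [k, max_eq_left h2]
    rw [max_eq_right (div_nonneg (by linarith) (by linarith))]
  have kB' : ∀ r s, 0 < a s → a s + d s ≤ r → r ≤ a s + 2 * d s →
      k' r s = (a s + 2 * d s - r) / r := fun r s h1 h2 h3 => by
    simp only [k', max_eq_left h2]
    rw [max_eq_right (div_nonneg (by linarith) (by linarith [hd0 s]))]
  have hz : ∀ r s, 0 ≤ r → ¬ 0 < a s → a s + 2 * d s ≤ r := fun r s hr h => by
    have : c ≤ s := not_lt.1 fun hs => h (ha s hs)
    rw [(h0 s this).1, (h0 s this).2]
    simpa using hr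
  have k1' : ∀ r s, 0 ≤ r → k' r s ≤ 1 := fun r s hr => by
    refine max_le zero_le_one (div_le_one_of_le₀ ?_ (le_max_of_le_left hr))
    linarith [le_max_right r (a s + d s), ha0 s, hd0 s]
  -- Equivalent to `(1 - k')(1 + k) = 1`, where `k'` is taken at the new radius.
  have kk : ∀ r s, 0 ≤ r → k' (r + k r s * r) s * (1 + k r s) = k r s := by
    intro r s hr
    have hd := hd0 s
    by_cases h3 : a s + 2 * d s ≤ r
    · simp [kid r s h3, kid' r s h3]
    have h1 : 0 < a s := by
      by_contra h
      exact h3 (hz r s hr h)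
    rcases le_total r (a s) with h2 | h2
    · rw [kA r s h1 h2, kA' _ s h1]
      · field_simp
      · have : d s / a s * r ≤ d s / a s * a s := by gcongr
        rw [div_mul_cancel₀ _ h1.ne'] at this
        linarith
    · have hr' : 0 < r := by linarith
      have e : r + (a s + 2 * d s - r) / (2 * r) * r = (a s + 2 * d s + r) / 2 := by
        field_simp
        ring
      rw [kB r s h1 h2 (not_le.1 h3).le, e, kB' _ s h1 (by linarith) (by linarith)]
      have : a s + 2 * d s + r ≠ 0 := by linarith
      field_simp
      ring
  have kk' : ∀ r s, 0 ≤ r → k (r - k' r s * r) s * (1 - k' r s) = k' r s := by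
    intro r s hr
    have hd := hd0 s
    by_cases h3 : a s + 2 * d s ≤ r
    · simp [kid r s h3, kid' r s h3]
    have h1 : 0 < a s := by
      by_contra h
      exact h3 (hz r s hr h)
    have h4 : 0 < a s + d s := by linarith
    rcases le_total r (a s + d s) with h2 | h2
    · rw [kA' r s h1 h2, kA _ s h1]
      · field_simp
        ring
      · have : r - d s / (a s + d s) * r = a s * (r / (a s + d s)) := by
          field_simp
          ring
        rw [this]
        exact mul_le_of_le_one_right h1.le ((div_le_one h4).2 h2)
    · have hr' : 0 < r := by linarith
      have e : r - (a s + 2 * d s - r) / r * r = 2 * r - a s - 2 * d s := by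
        field_simp
        ring
      rw [kB' r s h1 h2 (not_le.1 h3).le, e, kB _ s h1 (by linarith) (by linarith)]
      have : 2 * r - a s - 2 * d s ≠ 0 := by linarith
      field_simp
      ring
  have hff : ∀ x, f' (f x) = x := by
    rintro ⟨z, s⟩
    have e1 : z + k ‖z - y‖ s * (z - y) - y = ((1 + k ‖z - y‖ s : ℝ) : ℂ) * (z - y) := by
      push_cast; ring
    have e2 : ‖z + k ‖z - y‖ s * (z - y) - y‖ = ‖z - y‖ + k ‖z - y‖ s * ‖z - y‖ := by
      rw [e1, norm_mul, Complex.norm_of_nonneg (by linarith [k0 ‖z - y‖ s])]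
      ring
    ext
    · simp only [f, f', e2]
      rw [e1, ← mul_assoc, ← Complex.ofReal_mul, kk _ _ (norm_nonneg _)]
      ring
    · rfl
  have hff' : ∀ x, f (f' x) = x := by
    rintro ⟨z, s⟩
    have e1 : z - k' ‖z - y‖ s * (z - y) - y = ((1 - k' ‖z - y‖ s : ℝ) : ℂ) * (z - y) := by
      push_cast; ring
    have e2 : ‖z - k' ‖z - y‖ s * (z - y) - y‖ = ‖z - y‖ - k' ‖z - y‖ s * ‖z - y‖ := by
      rw [e1, norm_mul, Complex.norm_of_nonneg (by linarith [k1' ‖z - y‖ s (norm_nonneg _)])]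
      ring
    ext
    · simp only [f, f', e2]
      rw [e1, ← mul_assoc, ← Complex.ofReal_mul, kk' _ _ (norm_nonneg _)]
      ring
    · rfl
  have cm : Continuous fun x : HS => max ‖x.1 - y‖ (a x.2) := by fun_prop
  have cm' : Continuous fun x : HS => max ‖x.1 - y‖ (a x.2 + d x.2) := by fun_prop
  have cf : Continuous f := by
    refine continuous_of_continuousOn_lt (fun _ => rfl) (c := c) (B := fun s => a s + 2 * d s)
      (by fun_prop) (fun s hs => by simp [h0 s hs]) (fun x => ?_) ?_
    · simp only [f, add_sub_cancel_left, norm_mul, Complex.norm_of_nonneg (k0 _ _)]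
      have hd := hd0 x.2
      by_cases h3 : a x.2 + 2 * d x.2 ≤ ‖x.1 - y‖
      · rw [kid _ _ h3]
        linarith [ha0 x.2]
      have h1 : 0 < a x.2 := by
        by_contra h
        exact h3 (hz _ _ (norm_nonneg _) h)
      rcases le_total ‖x.1 - y‖ (a x.2) with h2 | h2
      · rw [kA _ _ h1 h2]
        have : d x.2 / a x.2 * ‖x.1 - y‖ ≤ d x.2 / a x.2 * a x.2 := by gcongr
        rw [div_mul_cancel₀ _ h1.ne'] at this
        linarith
      · have hr' : 0 < ‖x.1 - y‖ := by linarith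
        rw [kB _ _ h1 h2 (not_le.1 h3).le, div_mul_eq_mul_div, div_le_iff₀ (by linarith)]
        nlinarith
    · have hk : ContinuousOn (fun x : HS => k ‖x.1 - y‖ x.2) {x | x.2 < c} := by
        have cn : Continuous fun x : HS => a x.2 + 2 * d x.2 - max ‖x.1 - y‖ (a x.2) := by fun_prop
        have hq : ContinuousOn (fun x : HS => (a x.2 + 2 * d x.2 - max ‖x.1 - y‖ (a x.2)) /
            (2 * max ‖x.1 - y‖ (a x.2))) {x | x.2 < c} := by
          refine cn.continuousOn.div (cm.const_mul 2).continuousOn fun x hx => ?_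
          exact (mul_pos two_pos (lt_max_of_lt_right (ha _ hx))).ne'
        exact (continuousOn_const (c := (0 : ℝ))).sup hq
      exact (continuousOn_fst.add ((Complex.continuous_ofReal.comp_continuousOn hk).mul
        (continuousOn_fst.sub continuousOn_const))).prodMk continuousOn_snd
  have cf' : Continuous f' := by
    refine continuous_of_continuousOn_lt (fun _ => rfl) (c := c) (B := fun s => a s + 2 * d s)
      (by fun_prop) (fun s hs => by simp [h0 s hs]) (fun x => ?_) ?_
    · simp only [f', sub_sub_cancel_left, norm_neg, norm_mul, Complex.norm_of_nonneg (k0' _ _)]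
      by_cases h3 : a x.2 + 2 * d x.2 ≤ ‖x.1 - y‖
      · rw [kid' _ _ h3]
        linarith [ha0 x.2, hd0 x.2]
      · have := mul_le_of_le_one_left (norm_nonneg (x.1 - y)) (k1' _ x.2 (norm_nonneg (x.1 - y)))
        linarith
    · have hk : ContinuousOn (fun x : HS => k' ‖x.1 - y‖ x.2) {x | x.2 < c} := by
        have cn : Continuous fun x : HS => a x.2 + 2 * d x.2 - max ‖x.1 - y‖ (a x.2 + d x.2) := by
          fun_prop
        have hq : ContinuousOn (fun x : HS => (a x.2 + 2 * d x.2 - max ‖x.1 - y‖ (a x.2 + d x.2)) /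
            max ‖x.1 - y‖ (a x.2 + d x.2)) {x | x.2 < c} := by
          refine cn.continuousOn.div cm'.continuousOn fun x hx => ?_
          have hx' : x.2 < c := hx
          have : 0 < a x.2 + d x.2 := add_pos_of_pos_of_nonneg (ha _ hx') (hd _ hx')
          exact (lt_max_of_lt_right this).ne'
        exact (continuousOn_const (c := (0 : ℝ))).sup hq
      exact (continuousOn_fst.sub ((Complex.continuous_ofReal.comp_continuousOn hk).mul
        (continuousOn_fst.sub continuousOn_const))).prodMk continuousOn_snd
  refine ⟨⟨⟨f, f', hff, hff'⟩, cf, cf'⟩, fun _ => rfl, fun x hx => ?_, fun s => ?_,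
    fun u hu s => ?_⟩
  · change f x = x
    simp [f, kid _ _ hx]
  · change f _ = _
    simp [f]
  · change f _ = _
    ext
    · simp only [f, add_sub_cancel_left, norm_mul, hu, mul_one, Complex.norm_of_nonneg (ha0 s)]
      by_cases h1 : 0 < a s
      · have : (a s : ℂ) ≠ 0 := by exact_mod_cast h1.ne'
        rw [kA _ _ h1 le_rfl]
        push_cast
        field_simp
        ring
      · have : c ≤ s := not_lt.1 fun hs => h1 (ha s hs)
        simp [h0 s this]
    · rfl

/-! ### Bridges in the half-space -/

/-- An arc in the half-space which consists of a vertical strand over `y` and a strand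
`s ↦ y + w s`, which meet in the level `c` when `w c = 0`. -/
def bridge (y : ℂ) (w : NNReal → ℂ) (c : NNReal) : Set HS :=
  {x | x.2 ≤ c ∧ (x.1 = y ∨ x.1 = y + w x.2)}

theorem bridge_eq_image (y : ℂ) (w : NNReal → ℂ) (c : NNReal) :
    bridge y w c = (fun s => ((y, s) : HS)) '' Iic c ∪ (fun s => ((y + w s, s) : HS)) '' Iic c := by
  ext ⟨z, s⟩
  constructor
  · rintro ⟨h, h1 | h1⟩
    · exact Or.inl ⟨s, h, Prod.ext h1.symm rfl⟩
    · exact Or.inr ⟨s, h, Prod.ext h1.symm rfl⟩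
  · rintro (⟨t, h, h1⟩ | ⟨t, h, h1⟩)
    · obtain ⟨rfl, rfl⟩ := Prod.mk.inj h1
      exact ⟨h, Or.inl rfl⟩
    · obtain ⟨rfl, rfl⟩ := Prod.mk.inj h1
      exact ⟨h, Or.inr rfl⟩

/-- A rotation puts the moving strand on the ray from `y` in direction `u`; a stretch then moves it
from distance `‖w s‖` to the prescribed distance `L s`. Both fix the vertical strand and act only
within distance `2 * L s ≤ 4` of it, so bridges that are far apart can be straightened
independently. -/
theorem exists_straightening {w : NNReal → ℂ} (hw : Continuous w) {c : NNReal} (hc : 0 < c)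
    (h0 : ∀ s, w s = 0 ↔ c ≤ s) {L : NNReal → ℝ} (cL : Continuous L) (hL : ∀ s, ‖w s‖ ≤ L s)
    (hL2 : ∀ s, L s ≤ 2) (hL0 : ∀ s, c ≤ s → L s = 0) (y u : ℂ) (hu : ‖u‖ = 1) :
    ∃ φ : HS ≃ₜ HS, CompactlySupported φ ∧ (∀ x, (φ x).2 = x.2) ∧
      (∀ x : HS, 4 ≤ ‖x.1 - y‖ → φ x = x) ∧ (∀ s, φ (y, s) = (y, s)) ∧
      ∀ s, φ (y + w s, s) = (y + L s * u, s) := by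
  obtain ⟨φ, h1, h2, h3, h4⟩ := exists_rotation hw hc h0 y u hu
  obtain ⟨ψ, k1, k2, k3, k4⟩ := exists_stretch (a := fun s => ‖w s‖) (d := fun s => L s - ‖w s‖)
    (by fun_prop) (by fun_prop) (c := c)
    (fun s hs => norm_pos_iff.2 fun h => hs.not_ge ((h0 s).1 h))
    (fun s _ => sub_nonneg.2 (hL s)) (fun s hs => by simp [(h0 s).2 hs, hL0 s hs]) y
  have hid : ∀ x : HS, 2 * L x.2 ≤ ‖x.1 - y‖ → ψ (φ x) = x := fun x hx => by
    rw [h2, k2]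
    · linarith [norm_nonneg (w x.2)]
    · linarith [hL x.2]
  refine ⟨ψ * φ, ⟨Metric.closedBall y 4 ×ˢ Icc 0 c, (isCompact_closedBall _ _).prod isCompact_Icc,
    fun x hx => hid x ?_⟩, fun x => (k1 _).trans (h1 x), fun x hx => hid x ?_, fun s => ?_,
    fun s => ?_⟩
  · by_cases hx' : x.2 ≤ c
    · have : 4 < ‖x.1 - y‖ := by
        by_contra! h
        exact hx ⟨mem_closedBall_iff_norm.2 h, zero_le, hx'⟩
      linarith [hL2 x.2]
    · rw [hL0 _ (not_le.1 hx').le]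
      simp
  · linarith [hL2 x.2]
  · change ψ (φ _) = _
    rw [h3, k3]
  · change ψ (φ _) = _
    rw [h4, k4 u hu]
    simp

/-- Both bridges are straightened to the common width `‖w s‖ + ‖w' s‖`, which dominates each width
and vanishes from the level `c` on. The directions `1` at `0` and `-1` at `10` make the results
symmetric under the half turn about `5`, and conjugating that half turn by the straightenings
exchanges the original bridges. -/
theorem exists_exchange {c : NNReal} (hc : 0 < c) {w w' : NNReal → ℂ} (hw : Continuous w)
    (hw' : Continuous w') (h0 : ∀ s, w s = 0 ↔ c ≤ s) (h0' : ∀ s, w' s = 0 ↔ c ≤ s)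
    (h1 : ∀ s, ‖w s‖ ≤ 1) (h1' : ∀ s, ‖w' s‖ ≤ 1) :
    ∃ φ : HS ≃ₜ HS, CompactlySupported φ ∧ (∀ x, (φ x).2 = x.2) ∧
      φ '' bridge 0 w c = bridge 10 w' c ∧ φ '' bridge 10 w' c = bridge 0 w c := by
  have hL0 : ∀ s, c ≤ s → ‖w s‖ + ‖w' s‖ = 0 := fun s hs => by
    rw [(h0 s).2 hs, (h0' s).2 hs, norm_zero, add_zero]
  have hL2 : ∀ s, ‖w s‖ + ‖w' s‖ ≤ 2 := fun s => by linarith [h1 s, h1' s]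
  obtain ⟨φ, a1, a2, a3, a4, a5⟩ := exists_straightening hw hc h0
    (L := fun s => ‖w s‖ + ‖w' s‖) (by fun_prop) (fun s => by simp) hL2 hL0 0 1 (by simp)
  obtain ⟨ψ, b1, b2, b3, b4, b5⟩ := exists_straightening hw' hc h0'
    (L := fun s => ‖w s‖ + ‖w' s‖) (by fun_prop) (fun s => by simp) hL2 hL0 10 (-1) (by simp)
  obtain ⟨τ, c1, c2, c3⟩ := exists_halfTurn (fun _ => 5) continuous_const (R := 10) (by norm_num) c
  have p1 : ∀ s, ψ (φ (0, s)) = (0, s) := fun s => by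
    rw [a4, b3]
    norm_num
  have p2 : ∀ s, ψ (φ (0 + w s, s)) = (((‖w s‖ + ‖w' s‖ : ℝ) : ℂ), s) := fun s => by
    rw [a5, b3]
    · simp
    -- The strand has been moved to distance at most `2` from `0`, hence at least `8` from `10`,
    -- outside the radius `4` in which `ψ` acts.
    · have := norm_sub_norm_le (10 : ℂ) ((‖w s‖ + ‖w' s‖ : ℝ) : ℂ)
      rw [Complex.norm_of_nonneg (by positivity), norm_sub_rev] at this
      have h10 : ‖(10 : ℂ)‖ = 10 := by norm_num
      simp only [zero_add, mul_one]
      linarith [hL2 s]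
  have p3 : ∀ s, ψ (φ (10, s)) = (10, s) := fun s => by
    rw [a3, b4]
    norm_num
  have p4 : ∀ s, ψ (φ (10 + w' s, s)) = (10 - ((‖w s‖ + ‖w' s‖ : ℝ) : ℂ), s) := fun s => by
    rw [a3, b5]
    · simp only [mul_neg, mul_one, sub_eq_add_neg]
    · have := norm_sub_norm_le (10 : ℂ) (-w' s)
      have h10 : ‖(10 : ℂ)‖ = 10 := by norm_num
      rw [norm_neg, sub_neg_eq_add] at this
      simp only [sub_zero]
      linarith [h1' s]
  have q1 : ∀ s ≤ c, τ (0, s) = (10, s) := fun s hs => by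
    rw [c3 _ (by norm_num) hs]
    norm_num
  have q2 : ∀ s ≤ c, τ (((‖w s‖ + ‖w' s‖ : ℝ) : ℂ), s) = (10 - ((‖w s‖ + ‖w' s‖ : ℝ) : ℂ), s) :=
    fun s hs => by
      rw [c3 _ _ hs]
      · norm_num
      · have := norm_sub_le ((‖w s‖ + ‖w' s‖ : ℝ) : ℂ) 5
        rw [Complex.norm_of_nonneg (by positivity)] at this
        have h5 : ‖(5 : ℂ)‖ = 5 := by norm_num
        simp only
        linarith [hL2 s]
  have q3 : ∀ s ≤ c, τ (10, s) = (0, s) := fun s hs => by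
    rw [c3 _ (by norm_num) hs]
    norm_num
  have q4 : ∀ s ≤ c, τ (10 - ((‖w s‖ + ‖w' s‖ : ℝ) : ℂ), s) = (((‖w s‖ + ‖w' s‖ : ℝ) : ℂ), s) :=
    fun s hs => by
      rw [c3 _ _ hs]
      · ext
        · simp only
          ring
        · rfl
      · have e : 10 - ((‖w s‖ + ‖w' s‖ : ℝ) : ℂ) - 5 = 5 - ((‖w s‖ + ‖w' s‖ : ℝ) : ℂ) := by ring
        have := norm_sub_le 5 ((‖w s‖ + ‖w' s‖ : ℝ) : ℂ)
        rw [Complex.norm_of_nonneg (by positivity)] at this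
        have h5 : ‖(5 : ℂ)‖ = 5 := by norm_num
        simp only [e]
        linarith [hL2 s]
  have hconj : ∀ x y, τ (ψ (φ x)) = ψ (φ y) → ((ψ * φ)⁻¹ * τ * (ψ * φ)) x = y := fun x y h => by
    change (ψ * φ).symm (τ (ψ (φ x))) = y
    rw [Homeomorph.symm_apply_eq, h]
    rfl
  have r1 : ∀ s ≤ c, ((ψ * φ)⁻¹ * τ * (ψ * φ)) (0, s) = (10, s) := fun s hs => by
    apply hconj; rw [p1, p3, q1 s hs]
  have r2 : ∀ s ≤ c, ((ψ * φ)⁻¹ * τ * (ψ * φ)) (0 + w s, s) = (10 + w' s, s) := fun s hs => by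
    apply hconj; rw [p2, p4, q2 s hs]
  have r3 : ∀ s ≤ c, ((ψ * φ)⁻¹ * τ * (ψ * φ)) (10, s) = (0, s) := fun s hs => by
    apply hconj; rw [p1, p3, q3 s hs]
  have r4 : ∀ s ≤ c, ((ψ * φ)⁻¹ * τ * (ψ * φ)) (10 + w' s, s) = (0 + w s, s) := fun s hs => by
    apply hconj; rw [p2, p4, q4 s hs]
  have hlev : ∀ x, ((ψ * φ)⁻¹ x).2 = x.2 := fun x => by
    obtain ⟨y, rfl⟩ := (ψ * φ).surjective x
    have : (ψ * φ)⁻¹ ((ψ * φ) y) = y := (ψ * φ).symm_apply_apply y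
    rw [this]
    exact ((b2 (φ y)).trans (a2 y)).symm
  refine ⟨(ψ * φ)⁻¹ * τ * (ψ * φ), ((b1.mul a1).inv.mul c1).mul (b1.mul a1), fun x =>
    (hlev _).trans ((c2 _).trans ((b2 _).trans (a2 x))), ?_, ?_⟩
  · rw [bridge_eq_image, bridge_eq_image, image_union, image_image, image_image]
    exact congrArg₂ _ (image_congr r1) (image_congr r2)
  · rw [bridge_eq_image, bridge_eq_image, image_union, image_image, image_image]
    exact congrArg₂ _ (image_congr r3) (image_congr r4)

/-- The map is radial for the norm `max ‖z‖ s`: a radius `r` goes to `min r (max (ε r) (2r - 4))`,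
with inverse `u ↦ max u (min (u / ε) ((u + 4) / 2))`. The functions `κ` and `κ'` are the
corresponding factors, with denominators kept away from zero. -/
theorem exists_shrinking {ε : NNReal} (hε : 0 < ε) (hε1 : ε ≤ 1) :
    ∃ φ : HS ≃ₜ HS, (∀ x, x ∉ Metric.closedBall (0 : ℂ) 4 ×ˢ Icc (0 : NNReal) 4 → φ x = x) ∧
      (∀ x, (φ x).2 = 0 ↔ x.2 = 0) ∧
      ∀ x : HS, ‖x.1‖ ≤ 2 → x.2 ≤ 2 → φ x = ((ε : ℝ) * x.1, ε * x.2) := by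
  have e0 : (0 : ℝ) < ε := hε
  have e1 : (ε : ℝ) ≤ 1 := hε1
  let N : HS → ℝ := fun x => max ‖x.1‖ x.2
  have hN : ∀ x, 0 ≤ N x := fun x => le_max_of_le_left (norm_nonneg _)
  have cN : Continuous N := by fun_prop
  let κ : ℝ → ℝ := fun r => min 1 (max ε (2 - 4 / max r 2))
  let κ' : ℝ → ℝ := fun u => max 1 (min (ε : ℝ)⁻¹ ((1 + 4 / max u (2 * ε)) / 2))
  have κpos : ∀ r, 0 < κ r := fun r => lt_min one_pos (lt_max_of_lt_left e0)
  have κpos' : ∀ r, 0 < κ' r := fun r => lt_max_of_lt_left one_pos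
  have ei : 1 ≤ (ε : ℝ)⁻¹ := (one_le_inv₀ e0).2 e1
  have κ2 : ∀ r : ℝ, r ≤ 2 → κ r = ε := fun r hr => by
    simp only [κ, max_eq_right hr]
    norm_num [e0.le, e1]
  have κ4 : ∀ r, 4 ≤ r → κ r = 1 := fun r hr => by
    simp only [κ, max_eq_left (show 2 ≤ r by linarith)]
    refine min_eq_left (le_max_of_le_right ?_)
    have : 4 / r ≤ 1 := (div_le_one (by linarith)).2 hr
    linarith
  have κ4' : ∀ r, 4 ≤ r → κ' r = 1 := fun r hr => by
    simp only [κ', max_eq_left (show 2 * (ε : ℝ) ≤ r by linarith)]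
    refine max_eq_left (min_le_of_right_le ?_)
    have : 4 / r ≤ 1 := (div_le_one (by linarith)).2 hr
    linarith
  have κ2' : ∀ r : ℝ, r ≤ 2 * (ε : ℝ) → κ' r = (ε : ℝ)⁻¹ := fun r hr => by
    simp only [κ', max_eq_right hr]
    rw [min_eq_left, max_eq_right ei]
    have : 4 / (2 * (ε : ℝ)) = 2 * (ε : ℝ)⁻¹ := by field_simp; norm_num
    rw [this]
    linarith
  have kk : ∀ r, 0 ≤ r → κ' (κ r * r) * κ r = 1 := by
    intro r hr
    rcases le_total r 2 with h2 | h2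
    · rw [κ2 r h2, κ2', inv_mul_cancel₀ e0.ne']
      nlinarith
    rcases le_total 4 r with h4 | h4
    · rw [κ4 r h4, one_mul, κ4' r h4, one_mul]
    have r0 : 0 < r := by linarith
    rcases le_total (2 - 4 / r) ε with h | h
    · have : κ r = ε := by
        simp only [κ, max_eq_left h2, max_eq_left h, min_eq_right e1]
      rw [this]
      have h5 : κ' (ε * r) = (ε : ℝ)⁻¹ := by
        simp only [κ', max_eq_left (show 2 * (ε : ℝ) ≤ ε * r by nlinarith)]
        rw [min_eq_left, max_eq_right ei]
        have h' : 2 * r ≤ ε * r + 4 := by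
          rw [sub_le_iff_le_add, ← sub_le_iff_le_add', le_div_iff₀ r0] at h
          linarith
        rw [le_div_iff₀ two_pos, inv_eq_one_div, div_mul_eq_mul_div, div_le_iff₀ e0]
        have : (1 + 4 / (ε * r)) * ε = (ε * r + 4) / r := by field_simp
        rw [this, le_div_iff₀ r0]
        linarith
      rw [h5, inv_mul_cancel₀ e0.ne']
    · have h6 : 2 - 4 / r ≤ 1 := by
        have : 1 ≤ 4 / r := (one_le_div r0).2 h4
        linarith
      have : κ r = 2 - 4 / r := by
        simp only [κ, max_eq_left h2, max_eq_right h, min_eq_right h6]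
      have h7 : (2 - 4 / r) * r = 2 * r - 4 := by field_simp
      rw [this, h7]
      have h8 : ε * r ≤ 2 * r - 4 := by rw [← h7]; gcongr
      have h9 : 0 < 2 * r - 4 := by nlinarith
      have h10 : (1 + 4 / (2 * r - 4)) / 2 = (2 - 4 / r)⁻¹ := by
        rw [show 2 - 4 / r = (2 * r - 4) / r by rw [← h7]; field_simp]
        field_simp
        ring
      have h11 : 0 < 2 - 4 / r := by linarith
      simp only [κ', max_eq_left (show 2 * (ε : ℝ) ≤ 2 * r - 4 by nlinarith), h10]
      rw [min_eq_right (inv_anti₀ e0 h), max_eq_right ((one_le_inv₀ h11).2 h6),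
        inv_mul_cancel₀ h11.ne']
  have kk' : ∀ r, 0 ≤ r → κ (κ' r * r) * κ' r = 1 := by
    intro r hr
    rcases le_total r (2 * ε) with h2 | h2
    · rw [κ2' r h2, κ2, mul_inv_cancel₀ e0.ne']
      rw [inv_mul_le_iff₀ e0]
      linarith
    rcases le_total 4 r with h4 | h4
    · rw [κ4' r h4, one_mul, κ4 r h4, one_mul]
    have r0 : 0 < r := by linarith
    have r4 : (1 + 4 / r) / 2 = (r + 4) / (2 * r) := by field_simp
    rcases le_total (ε : ℝ)⁻¹ ((1 + 4 / r) / 2) with h | h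
    · have : κ' r = (ε : ℝ)⁻¹ := by
        simp only [κ', max_eq_left h2, min_eq_left h, max_eq_right ei]
      rw [this]
      have h5 : κ ((ε : ℝ)⁻¹ * r) = ε := by
        have : 2 ≤ (ε : ℝ)⁻¹ * r := by
          rw [inv_mul_eq_div, le_div_iff₀ e0]; exact h2
        simp only [κ, max_eq_left this]
        rw [max_eq_left, min_eq_right e1]
        have h' : 2 * r ≤ ε * r + 4 * ε := by
          rw [r4, inv_eq_one_div, div_le_div_iff₀ e0 (by linarith)] at h
          linarith
        have : 4 / ((ε : ℝ)⁻¹ * r) = 4 * ε / r := by field_simp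
        rw [this, sub_le_iff_le_add, ← sub_le_iff_le_add', le_div_iff₀ r0]
        linarith
      rw [h5, mul_inv_cancel₀ e0.ne']
    · have h6 : 1 ≤ (1 + 4 / r) / 2 := by
        have : 1 ≤ 4 / r := (one_le_div r0).2 h4
        linarith
      have : κ' r = (r + 4) / (2 * r) := by
        simp only [κ', max_eq_left h2]
        rw [min_eq_right h, max_eq_right h6, r4]
      have h7 : (r + 4) / (2 * r) * r = (r + 4) / 2 := by field_simp
      rw [this, h7]
      have h8 : 2 - 4 / ((r + 4) / 2) = 2 * r / (r + 4) := by field_simp; ring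
      have h9 : (ε : ℝ) ≤ 2 * r / (r + 4) := by
        rw [r4] at h
        rw [← inv_inv (ε : ℝ), ← inv_div]
        exact inv_anti₀ (by positivity) h
      simp only [κ, max_eq_left (show 2 ≤ (r + 4) / 2 by linarith), h8, max_eq_right h9]
      rw [min_eq_right ((div_le_one (by linarith)).2 (by linarith))]
      field_simp
  have cκ : Continuous fun x => κ (N x) := by
    refine continuous_const.min (continuous_const.max (continuous_const.sub
      (continuous_const.div (cN.max continuous_const) fun x => ?_)))
    exact (lt_max_of_lt_right two_pos).ne'
  have cκ' : Continuous fun x => κ' (N x) := by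
    refine continuous_const.max (continuous_const.min (Continuous.div_const (continuous_const.add
      (continuous_const.div (cN.max continuous_const) fun x => ?_)) _))
    exact (lt_max_of_lt_right (mul_pos two_pos e0)).ne'
  let f : (ℝ → ℝ) → HS → HS := fun k x => (k (N x) * x.1, (k (N x)).toNNReal * x.2)
  have hNf : ∀ k : ℝ → ℝ, (∀ r, 0 < k r) → ∀ x, N (f k x) = k (N x) * N x := by
    intro k hk x
    simp only [f, N, norm_mul, Complex.norm_of_nonneg (hk _).le, NNReal.coe_mul,
      Real.coe_toNNReal _ (hk _).le, mul_max_of_nonneg _ _ (hk (max ‖x.1‖ x.2)).le]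
  have hff : ∀ k k' : ℝ → ℝ, (∀ r, 0 < k r) → (∀ r, 0 < k' r) →
      (∀ r, 0 ≤ r → k' (k r * r) * k r = 1) → ∀ x, f k' (f k x) = x := by
    intro k k' hk hk' h x
    have h1 := h (N x) (hN x)
    ext
    · change (k' (N (f k x)) : ℂ) * (k (N x) * x.1) = x.1
      rw [hNf k hk, ← mul_assoc, ← Complex.ofReal_mul, h1]
      simp
    · change (((k' (N (f k x))).toNNReal * ((k (N x)).toNNReal * x.2) : NNReal) : ℝ) = x.2
      rw [hNf k hk, NNReal.coe_mul, NNReal.coe_mul, Real.coe_toNNReal _ (hk _).le,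
        Real.coe_toNNReal _ (hk' _).le, ← mul_assoc, h1, one_mul]
  have cf : ∀ k : ℝ → ℝ, (Continuous fun x => k (N x)) → Continuous (f k) := fun k hk =>
    ((Complex.continuous_ofReal.comp hk).mul continuous_fst).prodMk
      ((continuous_real_toNNReal.comp hk).mul continuous_snd)
  refine ⟨⟨⟨f κ, f κ', hff κ κ' κpos κpos' kk, hff κ' κ κpos' κpos kk'⟩, cf κ cκ, cf κ' cκ'⟩,
    fun x hx => ?_, fun x => ?_, fun x h1 h2 => ?_⟩
  · change f κ x = x
    have : 4 ≤ N x := by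
      by_contra! h
      have h1 : ‖x.1‖ < 4 := (le_max_left _ _).trans_lt h
      have h2 : (x.2 : ℝ) < 4 := (le_max_right _ _).trans_lt h
      exact hx ⟨mem_closedBall_zero_iff.2 h1.le, zero_le, by exact_mod_cast h2.le⟩
    simp [f, κ4 _ this]
  · change (f κ x).2 = 0 ↔ _
    simp [f, (κpos (N x)).not_ge]
  · change f κ x = _
    have h2' : (x.2 : ℝ) ≤ 2 := by exact_mod_cast h2
    have : N x ≤ 2 := max_le h1 h2'
    simp [f, κ2 _ this]

/-! ### Uniqueness of local collars -/

/-- Extension of a self-map of `X` by the identity along `e : X → Y`. -/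
def extendMap {X Y : Type*} (e : X → Y) (f : X → X) : Y → Y :=
  Function.extend e (fun x => e (f x)) id

theorem extendMap_apply {X Y : Type*} {e : X → Y} (he : Function.Injective e) (f : X → X) (x : X) :
    extendMap e f (e x) = e (f x) :=
  he.extend_apply _ _ _

theorem extendMap_of_notMem {X Y : Type*} {e : X → Y} (f : X → X) {y : Y} (hy : y ∉ range e) :
    extendMap e f y = y :=
  Function.extend_apply' _ _ _ hy

theorem continuous_extendMap {X Y : Type*} [TopologicalSpace X] [TopologicalSpace Y] [T2Space Y]
    {e : X → Y} (he : IsOpenEmbedding e) {K : Set X} (hK : IsCompact K) {f : X → X}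
    (hf : Continuous f) (hfK : ∀ x, x ∉ K → f x = x) : Continuous (extendMap e f) := by
  obtain ⟨G, hG, h1, h2⟩ := exists_continuous_extension (Q := Unit) he hK
    (f := fun p => f p.2) (by fun_prop) (fun _ => hfK)
  have : extendMap e f = fun y => G ((), y) := by
    funext y
    by_cases hy : y ∈ range e
    · obtain ⟨x, rfl⟩ := hy
      rw [extendMap_apply he.injective, h1]
    · rw [extendMap_of_notMem f hy, h2]
      exact fun h => hy (image_subset_range _ _ h)
  rw [this]
  fun_prop

/-- A bump function on the plane. -/
def bump (z : ℂ) : NNReal := 1 - ‖z‖₊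

theorem continuous_bump : Continuous bump := by unfold bump; fun_prop

theorem bump_le_one (z : ℂ) : bump z ≤ 1 := tsub_le_self

/-- Pushes the half-space into its part over the graph of `bump`. -/
def pushUp (x : HS) : HS := (x.1, max x.2 (bump x.1 + x.2 / 2))

/-- A left inverse of `pushUp`. -/
def pullDown (x : HS) : HS := (x.1, min x.2 (2 * (x.2 - bump x.1)))

/-- The support of the push. -/
def pushSupport : Set HS := Metric.closedBall (0 : ℂ) 1 ×ˢ Icc (0 : NNReal) 2

theorem isCompact_pushSupport : IsCompact pushSupport :=
  (isCompact_closedBall _ _).prod isCompact_Icc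

theorem continuous_pushUp : Continuous pushUp := by
  have := continuous_bump
  unfold pushUp
  fun_prop

theorem continuous_pullDown : Continuous pullDown := by
  have := continuous_bump
  unfold pullDown
  fun_prop

theorem pushUp_of_le {x : HS} (h : 2 * bump x.1 ≤ x.2) : pushUp x = x := by
  ext
  · rfl
  · have : 2 * (bump x.1 : ℝ) ≤ x.2 := by exact_mod_cast h
    simp only [pushUp, NNReal.coe_max, NNReal.coe_add, NNReal.coe_div, NNReal.coe_ofNat]
    exact max_eq_left (by linarith)

theorem pullDown_of_le {x : HS} (h : 2 * bump x.1 ≤ x.2) : pullDown x = x := by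
  have h1 : bump x.1 ≤ x.2 := le_trans (le_mul_of_one_le_left zero_le one_le_two) h
  ext
  · rfl
  · have : 2 * (bump x.1 : ℝ) ≤ x.2 := by exact_mod_cast h
    simp only [pullDown, NNReal.coe_min, NNReal.coe_mul, NNReal.coe_sub h1, NNReal.coe_ofNat]
    exact min_eq_left (by linarith)

theorem two_mul_bump_le {x : HS} (hx : x ∉ pushSupport) : 2 * bump x.1 ≤ x.2 := by
  by_cases h : ‖x.1‖ ≤ 1
  · have h2 : 2 < x.2 := by
      by_contra! h2
      exact hx ⟨mem_closedBall_zero_iff.2 h, zero_le, h2⟩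
    calc 2 * bump x.1 ≤ 2 * 1 := by gcongr; exact bump_le_one _
      _ ≤ x.2 := by rw [mul_one]; exact h2.le
  · have : bump x.1 = 0 := tsub_eq_zero_of_le (not_le.1 h).le
    simp [this]

theorem pullDown_pushUp (x : HS) : pullDown (pushUp x) = x := by
  rcases le_total (2 * bump x.1) x.2 with h | h
  · rw [pushUp_of_le h, pullDown_of_le h]
  · have h' : (x.2 : ℝ) ≤ 2 * bump x.1 := by exact_mod_cast h
    have e : pushUp x = (x.1, bump x.1 + x.2 / 2) := by
      ext
      · rfl
      · simp only [pushUp, NNReal.coe_max, NNReal.coe_add, NNReal.coe_div, NNReal.coe_ofNat]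
        exact max_eq_right (by linarith)
    rw [e]
    ext
    · rfl
    · simp only [pullDown, add_tsub_cancel_left, NNReal.coe_min, NNReal.coe_add, NNReal.coe_mul,
        NNReal.coe_div, NNReal.coe_ofNat]
      rw [min_eq_right] <;> linarith

theorem pushUp_pullDown {x : HS} (hx : bump x.1 ≤ x.2) : pushUp (pullDown x) = x := by
  rcases le_total (2 * bump x.1) x.2 with h | h
  · rw [pullDown_of_le h, pushUp_of_le h]
  · have h' : (x.2 : ℝ) ≤ 2 * bump x.1 := by exact_mod_cast h
    have hx' : (bump x.1 : ℝ) ≤ x.2 := by exact_mod_cast hx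
    ext
    · rfl
    · simp only [pushUp, pullDown, NNReal.coe_max, NNReal.coe_min, NNReal.coe_add, NNReal.coe_mul,
        NNReal.coe_div, NNReal.coe_ofNat, NNReal.coe_sub hx]
      rw [min_eq_right, max_eq_right] <;> linarith

theorem pushUp_zero (z : ℂ) : pushUp (z, 0) = (z, bump z) := by simp [pushUp]

/-- The region under the graph of `bump`. -/
def bumpRegion : Set HS := {x | ‖x.1‖ ≤ 1 ∧ x.2 ≤ bump x.1}

theorem isCompact_bumpRegion : IsCompact bumpRegion := by
  refine isCompact_pushSupport.of_isClosed_subset ?_ fun x hx => ?_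
  · have := continuous_bump
    have h1 : IsClosed {x : HS | ‖x.1‖ ≤ 1} := isClosed_le (by fun_prop) (by fun_prop)
    have h2 : IsClosed {x : HS | x.2 ≤ bump x.1} := isClosed_le (by fun_prop) (by fun_prop)
    exact h1.inter h2
  · refine ⟨mem_closedBall_zero_iff.2 hx.1, zero_le, hx.2.trans ((bump_le_one _).trans one_le_two)⟩

open Classical in
/-- The map which carries the collar `c'` to the collar `c` close to the boundary. -/
def collarMap {Y : Type*} (c c' : HS → Y) (y : Y) : Y :=
  if y ∈ c' '' bumpRegion then Function.extend c' c id y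
  else extendMap c pushUp (extendMap c' pullDown y)

section Collar

variable {Y : Type*} [TopologicalSpace Y] {c c' : HS → Y}

theorem collarMap_apply (hc' : IsOpenEmbedding c') {x : HS} (hx : x ∈ bumpRegion) :
    collarMap c c' (c' x) = c x := by
  rw [collarMap, if_pos (mem_image_of_mem _ hx), hc'.injective.extend_apply]

/-- The content is that the two clauses of `collarMap` agree over the graph of `bump`: `pullDown`
lowers the graph to the plane, where the two collars coincide by `h0`, and `pushUp` raises it again
along `c`. -/
theorem collarMap_of_notMem (hc : IsOpenEmbedding c) (hc' : IsOpenEmbedding c')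
    (h0 : ∀ z, c (z, 0) = c' (z, 0)) {y : Y} (hy : ∀ x, y = c' x → bump x.1 ≤ x.2) :
    collarMap c c' y = extendMap c pushUp (extendMap c' pullDown y) := by
  by_cases h : y ∈ c' '' bumpRegion
  · obtain ⟨⟨z, s⟩, hx, rfl⟩ := h
    obtain rfl : s = bump z := le_antisymm hx.2 (hy _ rfl)
    rw [collarMap_apply hc' hx, extendMap_apply hc'.injective, ← pushUp_zero, pullDown_pushUp, ← h0,
      extendMap_apply hc.injective]
  · rw [collarMap, if_neg h]

/-- Pasting along two closed sets: the image of the region under the graph, and the complement of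
the part strictly below the graph. No relation between the collars off the base is needed. -/
theorem continuous_collarMap [T2Space Y] (hc : IsOpenEmbedding c) (hc' : IsOpenEmbedding c')
    (h0 : ∀ z, c (z, 0) = c' (z, 0)) : Continuous (collarMap c c') := by
  have hA : IsClosed (c' '' bumpRegion) :=
    (isCompact_bumpRegion.image hc'.continuous).isClosed
  have hB : IsClosed (c' '' {x | x.2 < bump x.1})ᶜ :=
    (hc'.isOpenMap _ (isOpen_lt continuous_snd
      (continuous_bump.comp continuous_fst))).isClosed_compl
  have hU : c' '' bumpRegion ∪ (c' '' {x | x.2 < bump x.1})ᶜ = univ := by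
    rw [← univ_subset_iff]
    intro y _
    by_cases h : y ∈ c' '' {x | x.2 < bump x.1}
    · obtain ⟨x, hx, rfl⟩ := h
      refine Or.inl ⟨x, ⟨?_, le_of_lt hx⟩, rfl⟩
      by_contra! h1
      have : bump x.1 = 0 := tsub_eq_zero_of_le h1.le
      have hx' : x.2 < bump x.1 := hx
      rw [this] at hx'
      exact not_lt_zero hx'
    · exact Or.inr h
  rw [← continuousOn_univ, ← hU]
  refine ContinuousOn.union_of_isClosed ?_ ?_ hA hB
  · refine ContinuousOn.congr (f := Function.extend c' c id) ?_ ?_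
    · rintro _ ⟨x, -, rfl⟩
      refine ContinuousAt.continuousWithinAt (hc'.continuousAt_iff.1 ?_)
      rw [show Function.extend c' c id ∘ c' = c from
        funext fun x => hc'.injective.extend_apply _ _ _]
      exact hc.continuous.continuousAt
    · rintro y hy
      rw [collarMap, if_pos hy]
  · refine ContinuousOn.congr (f := extendMap c pushUp ∘ extendMap c' pullDown) ?_ fun y hy => ?_
    · refine Continuous.continuousOn (Continuous.comp ?_ ?_)
      · exact continuous_extendMap hc isCompact_pushSupport continuous_pushUp
          fun x hx => pushUp_of_le (two_mul_bump_le hx)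
      · exact continuous_extendMap hc' isCompact_pushSupport continuous_pullDown
          fun x hx => pullDown_of_le (two_mul_bump_le hx)
    · refine collarMap_of_notMem hc hc' h0 fun x hx => ?_
      by_contra! h
      exact hy ⟨x, h, hx.symm⟩

theorem extendMap_pullDown_pushUp (hc : IsOpenEmbedding c) (y : Y) :
    extendMap c pullDown (extendMap c pushUp y) = y := by
  by_cases hy : y ∈ range c
  · obtain ⟨x, rfl⟩ := hy
    rw [extendMap_apply hc.injective, extendMap_apply hc.injective, pullDown_pushUp]
  · rw [extendMap_of_notMem _ hy, extendMap_of_notMem _ hy]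

/-- Swapping the collars inverts both clauses. Under the graph this is clear; above it, the push
along `c'` is undone by the pull along `c'`, and the pull along `c` by the push along `c`. -/
theorem collarMap_collarMap (hc : IsOpenEmbedding c) (hc' : IsOpenEmbedding c')
    (h0 : ∀ z, c (z, 0) = c' (z, 0)) (y : Y) : collarMap c c' (collarMap c' c y) = y := by
  by_cases hy : y ∈ c '' bumpRegion
  · obtain ⟨x, hx, rfl⟩ := hy
    rw [collarMap_apply hc hx, collarMap_apply hc' hx]
  · have hy' : ∀ x, y = c x → bump x.1 ≤ x.2 := fun x hx => by
      by_contra! h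
      refine hy ⟨x, ⟨?_, h.le⟩, hx.symm⟩
      by_contra! h1
      have : bump x.1 = 0 := tsub_eq_zero_of_le h1.le
      rw [this] at h
      exact not_lt_zero h
    have e1 : extendMap c pushUp (extendMap c pullDown y) = y := by
      by_cases hr : y ∈ range c
      · obtain ⟨x, rfl⟩ := hr
        rw [extendMap_apply hc.injective, extendMap_apply hc.injective,
          pushUp_pullDown (hy' x rfl)]
      · rw [extendMap_of_notMem _ hr, extendMap_of_notMem _ hr]
    rw [collarMap_of_notMem hc' hc (fun z => (h0 z).symm) hy', collarMap_of_notMem hc hc' h0,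
      extendMap_pullDown_pushUp hc', e1]
    intro x hx
    by_cases hr : extendMap c pullDown y ∈ range c'
    · obtain ⟨x', hx'⟩ := hr
      rw [← hx', extendMap_apply hc'.injective] at hx
      rw [← hc'.injective hx]
      exact (le_add_of_nonneg_right zero_le).trans (le_max_right _ _)
    · rw [extendMap_of_notMem _ hr] at hx
      exact absurd ⟨x, hx.symm⟩ hr

/-- Two collars with the same base agree, close to a point of the boundary and up to a compactly
supported homeomorphism which is the identity on the boundary. -/
theorem exists_collar_change [T2Space Y] (hc : IsOpenEmbedding c) (hc' : IsOpenEmbedding c')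
    (h0 : ∀ z, c (z, 0) = c' (z, 0)) :
    ∃ F : Y ≃ₜ Y, (∀ x ∈ bumpRegion, F (c' x) = c x) ∧ (∀ z, F (c (z, 0)) = c (z, 0)) ∧
      ∀ y, y ∉ c '' pushSupport → y ∉ c' '' pushSupport → F y = y := by
  have hid : ∀ y, y ∉ c '' pushSupport → y ∉ c' '' pushSupport → collarMap c c' y = y := by
    intro y hy hy'
    have e1 : extendMap c' pullDown y = y := by
      by_cases hr : y ∈ range c'
      · obtain ⟨x, rfl⟩ := hr
        rw [extendMap_apply hc'.injective, pullDown_of_le (two_mul_bump_le fun h => hy' ⟨x, h, rfl⟩)]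
      · rw [extendMap_of_notMem _ hr]
    have e2 : extendMap c pushUp y = y := by
      by_cases hr : y ∈ range c
      · obtain ⟨x, rfl⟩ := hr
        rw [extendMap_apply hc.injective, pushUp_of_le (two_mul_bump_le fun h => hy ⟨x, h, rfl⟩)]
      · rw [extendMap_of_notMem _ hr]
    rw [collarMap_of_notMem hc hc' h0, e1, e2]
    rintro x rfl
    refine le_trans (le_mul_of_one_le_left zero_le one_le_two)
      (two_mul_bump_le fun h => hy' ⟨x, h, rfl⟩)
  refine ⟨⟨⟨collarMap c c', collarMap c' c, collarMap_collarMap hc' hc fun z => (h0 z).symm,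
    collarMap_collarMap hc hc' h0⟩, continuous_collarMap hc hc' h0,
    continuous_collarMap hc' hc fun z => (h0 z).symm⟩, fun x hx => collarMap_apply hc' hx,
    fun z => ?_, hid⟩
  change collarMap c c' (c (z, 0)) = _
  -- Over the unit disc, the point lies under the graph and the collars agree at level zero.
  -- Elsewhere it lies outside both supports.
  by_cases hz : ‖z‖ ≤ 1
  · rw [h0, collarMap_apply hc' ⟨hz, zero_le⟩, h0]
  · have : ∀ d : HS → Y, IsOpenEmbedding d → d (z, 0) ∉ d '' pushSupport := by
      rintro d hd ⟨x, hx, h⟩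
      rw [hd.injective h] at hx
      exact hz (mem_closedBall_zero_iff.1 hx.1)
    exact hid _ (this c hc) (h0 z ▸ this c' hc')

end Collar

/-! ### Small boundary charts -/

/-- Multiplication by a positive number in the half-space. -/
def scale (r : ℝ) (x : HS) : HS := (r * x.1, r.toNNReal * x.2)

theorem scale_one (x : HS) : scale 1 x = x := by simp [scale]

theorem scale_scale {r t : ℝ} (hr : 0 < r) (h : t * r = 1) (x : HS) : scale t (scale r x) = x := by
  have ht : 0 < t := pos_of_mul_pos_left (h ▸ one_pos) hr.le
  ext
  · simp only [scale]
    rw [← mul_assoc, ← Complex.ofReal_mul, h, Complex.ofReal_one, one_mul]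
  · simp only [scale, NNReal.coe_mul, Real.coe_toNNReal _ hr.le, Real.coe_toNNReal _ ht.le]
    rw [← mul_assoc, h, one_mul]

theorem scale_snd_eq_zero_iff {r : ℝ} (hr : 0 < r) (x : HS) : (scale r x).2 = 0 ↔ x.2 = 0 := by
  simp [scale, hr]

/-- Rescale by a factor depending on `N`, so that radii in `[b, ∞)` are compressed onto `[b, R)` by
`r ↦ R - (R - b) b / r`, which fixes `b`. Homogeneity of `N` makes the inverse explicit. A general
`N` serves both the maximum norm and the Euclidean one. -/
theorem exists_radial_embedding {N : HS → ℝ} (cN : Continuous N)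
    (hN : ∀ r > 0, ∀ x, N (scale r x) = r * N x) {b R : ℝ} (hb : 0 < b) (hbR : b < R) :
    ∃ j : HS → HS, IsOpenEmbedding j ∧ (∀ x, (j x).2 = 0 ↔ x.2 = 0) ∧ (∀ x, N x ≤ b → j x = x) ∧
      ∀ x, N (j x) < R := by
  let κ : ℝ → ℝ := fun r => (R - (R - b) * b / max r b) / max r b
  let κ' : ℝ → ℝ := fun u => (R - b) * b / ((R - max u b) * max u b)
  have hRb : 0 < R - b := sub_pos.2 hbR
  have hM : ∀ r, 0 < max r b := fun r => lt_max_of_lt_right hb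
  have κpos : ∀ r, 0 < κ r := fun r => by
    refine div_pos (sub_pos.2 ?_) (hM r)
    rw [div_lt_iff₀ (hM r)]
    have := le_max_right r b
    nlinarith
  have κpos' : ∀ u, u < R → 0 < κ' u := fun u hu =>
    div_pos (mul_pos hRb hb) (mul_pos (sub_pos.2 (max_lt hu hbR)) (hM u))
  have κb : ∀ r, r ≤ b → κ r = 1 := fun r hr => by
    simp only [κ, max_eq_right hr]
    field_simp
    ring
  have κb' : ∀ r, r ≤ b → κ' r = 1 := fun r hr => by
    simp only [κ', max_eq_right hr]
    exact div_self (mul_pos hRb hb).ne'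
  have κge : ∀ r, b ≤ r → κ r * r = R - (R - b) * b / r := fun r hr => by
    have : r ≠ 0 := by linarith
    simp only [κ, max_eq_left hr]
    field_simp
  have κlt : ∀ r, κ r * r < R := fun r => by
    rcases le_total r b with h | h
    · rw [κb r h]; linarith
    · rw [κge r h]
      have : 0 < (R - b) * b / r := div_pos (mul_pos hRb hb) (by linarith)
      linarith
  have kk : ∀ r, κ' (κ r * r) * κ r = 1 := fun r => by
    rcases le_total r b with h | h
    · rw [κb r h, one_mul, κb' r h, one_mul]
    · have h0 : 0 < r := by linarith
      have h1 : b ≤ κ r * r := by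
        rw [κge r h, le_sub_comm, div_le_iff₀ h0]
        exact mul_le_mul_of_nonneg_left h hRb.le
      have h2 : R - κ r * r = (R - b) * b / r := by rw [κge r h]; ring
      simp only [κ', max_eq_left h1, h2]
      have := (κpos r).ne'
      field_simp
  have kk' : ∀ u, u < R → κ (κ' u * u) * κ' u = 1 := fun u hu => by
    rcases le_total u b with h | h
    · rw [κb' u h, one_mul, κb u h, one_mul]
    · have h0 : 0 < u := by linarith
      have hRu : 0 < R - u := by linarith
      have e : κ' u * u = (R - b) * b / (R - u) := by
        simp only [κ', max_eq_left h]
        field_simp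
      have h1 : b ≤ κ' u * u := by
        rw [e, le_div_iff₀ hRu, mul_comm]
        exact mul_le_mul_of_nonneg_right (by linarith) hb.le
      have h2 : κ (κ' u * u) * (κ' u * u) = u := by
        rw [κge _ h1, e]
        field_simp
        ring
      rw [← mul_assoc] at h2
      exact mul_right_cancel₀ h0.ne' (by rw [h2, one_mul])
  have cκ : Continuous fun x => κ (N x) := by
    have c1 : Continuous fun x => max (N x) b := cN.max continuous_const
    exact (continuous_const.sub (continuous_const.div c1 fun x => (hM _).ne')).div c1
      fun x => (hM _).ne'
  have cκ' : ContinuousOn (fun x => κ' (N x)) {x | N x < R} := by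
    have c1 : Continuous fun x => max (N x) b := cN.max continuous_const
    refine continuousOn_const.div ((continuous_const.sub c1).mul c1).continuousOn fun x hx => ?_
    exact (mul_pos (sub_pos.2 (max_lt hx hbR)) (hM _)).ne'
  let Φ : OpenPartialHomeomorph HS HS :=
    { toFun := fun x => scale (κ (N x)) x
      invFun := fun x => scale (κ' (N x)) x
      source := univ
      target := {x | N x < R}
      map_source' := fun x _ => by
        change N _ < R
        rw [hN _ (κpos _)]
        exact κlt _
      map_target' := fun _ _ => mem_univ _
      left_inv' := fun x _ => by
        simp only [hN _ (κpos _)]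
        exact scale_scale (κpos _) (kk _) x
      right_inv' := fun x hx => by
        have hx' : N x < R := hx
        simp only [hN _ (κpos' _ hx')]
        exact scale_scale (κpos' _ hx') (kk' _ hx') x
      open_source := isOpen_univ
      open_target := isOpen_lt cN continuous_const
      continuousOn_toFun := by
        refine Continuous.continuousOn ?_
        exact ((Complex.continuous_ofReal.comp cκ).mul continuous_fst).prodMk
          ((continuous_real_toNNReal.comp cκ).mul continuous_snd)
      continuousOn_invFun :=
        ((Complex.continuous_ofReal.comp_continuousOn cκ').mul continuousOn_fst).prodMk
          ((continuous_real_toNNReal.comp_continuousOn cκ').mul continuousOn_snd) }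
  refine ⟨Φ, Φ.isOpenEmbedding rfl, fun x => scale_snd_eq_zero_iff (κpos _) x, fun x hx => ?_,
    fun x => Φ.map_source (mem_univ x)⟩
  change scale (κ (N x)) x = x
  rw [κb _ hx, scale_one]

/-- The half-space is embedded onto a small neighbourhood of the origin. -/
theorem exists_small_embedding {V : Set HS} (hV : V ∈ 𝓝 (0 : HS)) :
    ∃ b : ℝ, 0 < b ∧ ∃ j : HS → HS, IsOpenEmbedding j ∧ (∀ x, (j x).2 = 0 ↔ x.2 = 0) ∧
      (∀ x : HS, ‖x.1‖ ≤ b → x.2 ≤ b → j x = x) ∧ ∀ x, j x ∈ V := by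
  obtain ⟨R, hR, hV⟩ := Metric.mem_nhds_iff.1 hV
  obtain ⟨j, h1, h2, h3, h4⟩ := exists_radial_embedding (N := fun x : HS => max ‖x.1‖ x.2)
    (by fun_prop) (fun r hr x => by
      simp only [scale, norm_mul, Complex.norm_of_nonneg hr.le, NNReal.coe_mul,
        Real.coe_toNNReal _ hr.le, mul_max_of_nonneg _ _ hr.le]) (half_pos hR) (half_lt_self hR)
  refine ⟨R / 2, half_pos hR, j, h1, h2, fun x hx hx' => h3 x (max_le hx hx'), fun x => hV ?_⟩
  have := h4 x
  rw [max_lt_iff] at this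
  rw [Metric.mem_ball, Prod.dist_eq, max_lt_iff]
  refine ⟨by simpa using this.1, ?_⟩
  rw [NNReal.dist_eq]
  simpa using this.2

/-! ### Moving points of the boundary -/

section Charts

variable {H : Type*} [TopologicalSpace H] {T : Set H}

/-- Translation along the boundary plane. -/
def translation (z : ℂ) : HS ≃ₜ HS := (Homeomorph.addRight z).prodCongr (Homeomorph.refl NNReal)

theorem translation_apply (z : ℂ) (x : HS) : translation z x = (x.1 + z, x.2) := rfl

theorem IsBoundaryChart.exists_small {e : HS → H} (he : IsBoundaryChart T e) (z : ℂ) {U : Set H}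
    (hU : U ∈ 𝓝 (e (z, 0))) :
    ∃ e' : HS → H, IsBoundaryChart T e' ∧ e' 0 = e (z, 0) ∧ range e' ⊆ range e ∩ U := by
  have he' : IsBoundaryChart T (e ∘ translation z) :=
    he.comp (translation z).isOpenEmbedding fun _ => Iff.rfl
  have h0 : (e ∘ translation z) 0 = e (z, 0) := by
    simp [translation_apply]
  obtain ⟨b, hb, j, h1, h2, h3, h4⟩ := exists_small_embedding
    (he'.1.continuous.continuousAt.preimage_mem_nhds (h0.symm ▸ hU))
  refine ⟨_, he'.comp h1 h2, ?_, ?_⟩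
  · have : j 0 = 0 := h3 0 (by simpa using hb.le) (by simpa using hb.le)
    simp only [Function.comp_apply, this]
    exact h0
  · rintro _ ⟨x, rfl⟩
    exact ⟨mem_range_self _, h4 x⟩

/-- Every point of `T` is the origin of a boundary chart. -/
def HasBoundaryCharts (T : Set H) : Prop :=
  ∀ p ∈ T, ∃ e : HS → H, IsBoundaryChart T e ∧ e 0 = p

theorem HasBoundaryCharts.exists_chart (hT : HasBoundaryCharts T) {p : H} (hp : p ∈ T) {U : Set H}
    (hU : U ∈ 𝓝 p) : ∃ e : HS → H, IsBoundaryChart T e ∧ e 0 = p ∧ range e ⊆ U := by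
  obtain ⟨e, he, rfl⟩ := hT p hp
  obtain ⟨e', h1, h2, h3⟩ := he.exists_small 0 hU
  exact ⟨e', h1, h2, h3.trans inter_subset_right⟩

theorem IsBoundaryChart.exists_extension [T2Space H] {e : HS → H} (he : IsBoundaryChart T e)
    {φ : HS ≃ₜ HS} (hφ : CompactlySupported φ) (hφ0 : ∀ x, (φ x).2 = 0 ↔ x.2 = 0) :
    ∃ F : H ≃ₜ H, Admissible T F ∧ (∀ x, F (e x) = e (φ x)) ∧ ∀ y, y ∉ range e → F y = y := by
  obtain ⟨K, hK, h⟩ := hφ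
  obtain ⟨F, h1, h2, h3⟩ := he.exists_admissible hK φ h hφ0
  exact ⟨F, h1, h2, fun y hy => h3 y fun hy' => hy (image_subset_range _ _ hy')⟩

/-- Two points of the boundary in the same chart are exchanged by a homeomorphism supported in this
chart. -/
theorem IsBoundaryChart.exists_swap [T2Space H] {e : HS → H} (he : IsBoundaryChart T e) (z : ℂ) :
    ∃ F : H ≃ₜ H, Admissible T F ∧ F (e 0) = e (z, 0) ∧ F (e (z, 0)) = e 0 ∧
      ∀ y, y ∉ range e → F y = y := by
  obtain ⟨φ, h1, h2, h3⟩ := exists_halfTurn (fun _ => z / 2) continuous_const (R := ‖z‖ + 1)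
    (by positivity) 0
  obtain ⟨F, k1, k2, k3⟩ := he.exists_extension h1 fun x => by rw [h2]
  have hz : ‖z / 2‖ ≤ ‖z‖ + 1 := by
    rw [norm_div, Complex.norm_ofNat]
    linarith [norm_nonneg z]
  refine ⟨F, k1, ?_, ?_, k3⟩
  · rw [k2, h3 _ _ le_rfl]
    · congr 1
      ext <;> simp
      ring_nf
    · simpa using hz
  · rw [k2, h3 _ _ le_rfl]
    · congr 1
      ext <;> simp
      ring_nf
    · have : z - z / 2 = z / 2 := by ring
      simpa [this] using hz

/-- A punctured plane is connected, so in a separation of `S \ {p}` the punctured chart around `p`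
lies on one side. Adding the whole chart to that side would separate `S` itself. -/
theorem isPreconnected_diff_singleton [T1Space H] {S : Set H} (hS : IsPreconnected S) (hST : S ⊆ T)
    {p : H} (hp : p ∈ S) {e : HS → H} (he : IsBoundaryChart T e) (hep : e 0 = p)
    (heS : range e ∩ T ⊆ S) : IsPreconnected (S \ {p}) := by
  have hC : IsPreconnected ((fun z : ℂ => e (z, 0)) '' {0}ᶜ) :=
    (isConnected_compl_singleton_of_one_lt_rank (by simp) 0).isPreconnected.image _
      (he.1.continuous.comp (by fun_prop)).continuousOn
  have hCS : (fun z : ℂ => e (z, 0)) '' {0}ᶜ ⊆ S \ {p} := by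
    rintro _ ⟨z, hz, rfl⟩
    refine ⟨heS ⟨mem_range_self _, (he.2 _).2 rfl⟩, fun h => hz ?_⟩
    rw [← hep] at h
    exact congrArg Prod.fst (he.1.injective h)
  have hCx : ∀ x ∈ range e, x ∈ S \ {p} → x ∈ (fun z : ℂ => e (z, 0)) '' {0}ᶜ := by
    rintro _ ⟨⟨z, s⟩, rfl⟩ ⟨h1, h2⟩
    obtain rfl : s = 0 := (he.2 _).1 (hST h1)
    refine ⟨z, fun hz => h2 ?_, rfl⟩
    rw [mem_singleton_iff.1 hz]
    exact hep
  have key : ∀ u v : Set H, IsOpen u → IsOpen v → S \ {p} ⊆ u ∪ v → (S \ {p}) ∩ (u ∩ v) = ∅ →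
      (fun z : ℂ => e (z, 0)) '' {0}ᶜ ⊆ u → S \ {p} ⊆ u ∨ S \ {p} ⊆ v := by
    intro u v hu hv huv hd hCu
    have := isPreconnected_iff_subset_of_disjoint.1 hS (u ∪ range e) (v \ {p})
      (hu.union he.1.isOpen_range) (hv.sdiff isClosed_singleton) ?_ ?_
    · rcases this with h | h
      · refine Or.inl fun x hx => ?_
        rcases h hx.1 with h' | h'
        · exact h'
        · exact hCu (hCx x h' hx)
      · exact absurd rfl (h hp).2
    · intro x hx
      by_cases hxp : x = p
      · exact Or.inl (Or.inr (hxp ▸ hep ▸ mem_range_self _))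
      · rcases huv ⟨hx, hxp⟩ with h | h
        · exact Or.inl (Or.inl h)
        · exact Or.inr ⟨h, hxp⟩
    · rw [← subset_empty_iff, ← hd]
      rintro x ⟨hx, h1, h2⟩
      refine ⟨⟨hx, h2.2⟩, ?_, h2.1⟩
      rcases h1 with h1 | h1
      · exact h1
      · exact hCu (hCx x h1 ⟨hx, h2.2⟩)
  rw [isPreconnected_iff_subset_of_disjoint]
  intro u v hu hv huv hd
  have hd' : (fun z : ℂ => e (z, 0)) '' {0}ᶜ ∩ (u ∩ v) = ∅ := by
    rw [← subset_empty_iff, ← hd]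
    exact inter_subset_inter_left _ hCS
  rcases isPreconnected_iff_subset_of_disjoint.1 hC u v hu hv (hCS.trans huv) hd' with h | h
  · exact key u v hu hv huv hd h
  · exact (key v u hv hu (union_comm u v ▸ huv) (inter_comm u v ▸ hd) h).symm

theorem isPreconnected_diff_finite [T1Space H] (hT : HasBoundaryCharts T) (hc : IsPreconnected T)
    {Q : Set H} (hQ : Q.Finite) : IsPreconnected (T \ Q) := by
  induction Q, hQ using Set.Finite.induction_on with
  | empty => simpa using hc
  | @insert p Q hp hQ ih =>
    have e1 : T \ insert p Q = (T \ Q) \ {p} := by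
      rw [sdiff_sdiff, union_singleton]
    by_cases hpT : p ∈ T
    · obtain ⟨e, h1, h2, h3⟩ := hT.exists_chart hpT (hQ.isClosed.isOpen_compl.mem_nhds hp)
      rw [e1]
      exact isPreconnected_diff_singleton ih sdiff_subset ⟨hpT, hp⟩ h1 h2
        fun x hx => ⟨hx.2, h3 hx.1⟩
    · rw [e1, sdiff_singleton_eq_self fun h => hpT h.1]
      exact ih

/-- The group of admissible homeomorphisms fixing `Z` acts transitively on `T \ Z`. -/
theorem exists_admissible_move [T2Space H] (hT : HasBoundaryCharts T) (hc : IsPreconnected T)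
    {Z : Set H} (hZ : IsClosed Z) (hZT : (T ∩ Z).Finite) {p q : H} (hp : p ∈ T \ Z)
    (hq : q ∈ T \ Z) :
    ∃ F : H ≃ₜ H, Admissible T F ∧ (∀ y ∈ Z, F y = y) ∧ F p = q := by
  have hconn : IsPreconnected (T \ Z) := by
    rw [← sdiff_self_inter]
    exact isPreconnected_diff_finite hT hc hZT
  -- Being related by such a homeomorphism is transitive and symmetric, so on a connected set it
  -- suffices to relate nearby points, which a half turn in a small chart does.
  refine hconn.induction₂ (fun p q => ∃ F : H ≃ₜ H, Admissible T F ∧ (∀ y ∈ Z, F y = y) ∧ F p = q)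
    ?_ ?_ ?_ hp hq
  · rintro x ⟨hx, hxZ⟩
    obtain ⟨e, h1, rfl, h3⟩ := hT.exists_chart hx (hZ.isOpen_compl.mem_nhds hxZ)
    have : range e ∈ 𝓝 (e 0) := h1.1.isOpen_range.mem_nhds (mem_range_self _)
    filter_upwards [self_mem_nhdsWithin, mem_nhdsWithin_of_mem_nhds this] with y hy hy'
    obtain ⟨⟨z, s⟩, rfl⟩ := hy'
    obtain rfl : s = 0 := (h1.2 _).1 hy.1
    obtain ⟨F, k1, k2, -, k4⟩ := h1.exists_swap z
    exact ⟨F, k1, fun y hy => k4 y fun hy' => h3 hy' hy, k2⟩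
  · rintro x y z - - - ⟨F, h1, h2, rfl⟩ ⟨K, k1, k2, rfl⟩
    refine ⟨K * F, k1.mul h1, fun y hy => ?_, rfl⟩
    change K (F y) = y
    rw [h2 y hy, k2 y hy]
  · rintro x y - - ⟨F, h1, h2, rfl⟩
    refine ⟨F⁻¹, h1.inv, fun y hy => ?_, F.symm_apply_apply x⟩
    change F.symm y = y
    rw [Homeomorph.symm_apply_eq, h2 y hy]

/-- Two points of `T` are exchanged by an admissible homeomorphism fixing a given closed set. -/
theorem exists_admissible_swap [T2Space H] (hT : HasBoundaryCharts T) (hc : IsPreconnected T)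
    {Z : Set H} (hZ : IsClosed Z) (hZT : (T ∩ Z).Finite) {p q : H} (hp : p ∈ T \ Z)
    (hq : q ∈ T \ Z) (hpq : p ≠ q) :
    ∃ F : H ≃ₜ H, Admissible T F ∧ (∀ y ∈ Z, F y = y) ∧ F p = q ∧ F q = p := by
  obtain ⟨e, h1, h2, h3⟩ := hT.exists_chart hq.1 (hZ.isOpen_compl.mem_nhds hq.2)
  have hZ' : (T ∩ (Z ∪ {q})).Finite := by
    rw [inter_union_distrib_left]
    exact hZT.union ((finite_singleton q).subset inter_subset_right)
  have hq' : e (1, 0) ∉ Z ∪ {q} := by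
    rintro (h | h)
    · exact h3 (mem_range_self _) h
    · rw [← h2] at h
      exact one_ne_zero (congrArg Prod.fst (h1.1.injective h))
  -- Bring `p` to the point `1` of a chart centred at `q`, keeping `q` fixed; a half turn in this
  -- chart swaps the two points, and conjugating it by `F` swaps `p` and `q`.
  obtain ⟨F, k1, k2, k3⟩ := exists_admissible_move hT hc (hZ.union isClosed_singleton) hZ'
    (p := p) (q := e (1, 0)) ⟨hp.1, fun h => h.elim hp.2 hpq⟩ ⟨(h1.2 _).2 rfl, hq'⟩
  obtain ⟨K, l1, l2, l3, l4⟩ := h1.exists_swap 1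
  have hF : F q = q := k2 q (Or.inr rfl)
  refine ⟨F⁻¹ * K * F, (k1.inv.mul l1).mul k1, fun y hy => ?_, ?_, ?_⟩
  · change F.symm (K (F y)) = y
    rw [Homeomorph.symm_apply_eq, k2 y (Or.inl hy), l4 y fun h => h3 h hy]
  · change F.symm (K (F p)) = q
    rw [Homeomorph.symm_apply_eq, k3, l3, hF, h2]
  · change F.symm (K (F q)) = p
    rw [Homeomorph.symm_apply_eq, hF, k3, ← h2, l2]

end Charts

/-! ### The chart of a trivial arc -/

/-- The half-circle, sheared such that one strand is vertical, is the bridge of this width. -/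
def arcWidth (s : NNReal) : ℂ := ((2 * √(1 - (s : ℝ) ^ 2) : ℝ) : ℂ)

theorem continuous_arcWidth : Continuous arcWidth := by unfold arcWidth; fun_prop

theorem norm_arcWidth (s : NNReal) : ‖arcWidth s‖ = 2 * √(1 - (s : ℝ) ^ 2) :=
  Complex.norm_of_nonneg (by positivity)

theorem norm_arcWidth_le (s : NNReal) : ‖arcWidth s‖ ≤ 2 := by
  rw [norm_arcWidth]
  have : √(1 - (s : ℝ) ^ 2) ≤ 1 := Real.sqrt_le_one.2 (by nlinarith [sq_nonneg (s : ℝ)])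
  linarith

theorem arcWidth_zero : arcWidth 0 = 2 := by simp [arcWidth]

theorem arcWidth_eq_zero_iff (s : NNReal) : arcWidth s = 0 ↔ 1 ≤ s := by
  rw [← norm_eq_zero, norm_arcWidth, mul_eq_zero, or_iff_right two_ne_zero,
    Real.sqrt_eq_zero', sub_nonpos, one_le_sq_iff₀ s.coe_nonneg]
  exact_mod_cast Iff.rfl

/-- The half-space in coordinates. -/
def halfSpaceHomeomorph : HS ≃ₜ EuclideanHalfSpace 3 where
  toFun x := ⟨!₂[(x.2 : ℝ), x.1.re, x.1.im], by simp⟩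
  invFun y := (⟨y.1 1, y.1 2⟩, ⟨y.1 0, y.2⟩)
  left_inv x := by
    refine Prod.ext (Complex.ext ?_ ?_) (NNReal.eq ?_) <;> rfl
  right_inv y := by
    ext i
    fin_cases i
    · rfl
    · simp
    · simp
  continuous_toFun := by
    refine Continuous.subtype_mk ?_ _
    refine (PiLp.continuous_toLp 2 _).comp (continuous_pi fun i => ?_)
    fin_cases i <;> simp <;> fun_prop
  continuous_invFun := by
    have h : ∀ i, Continuous fun y : EuclideanHalfSpace 3 => y.1 i := fun i => by fun_prop
    refine Continuous.prodMk ?_ (Continuous.subtype_mk (h 0) _)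
    have : (fun y : EuclideanHalfSpace 3 => (⟨y.1 1, y.1 2⟩ : ℂ)) =
        fun y => (y.1 1 : ℂ) + (y.1 2 : ℂ) * Complex.I := by
      funext y
      exact Complex.mk_eq_add_mul_I _ _
    rw [this]
    have h1 := h 1
    have h2 := h 2
    fun_prop

/-- The Euclidean norm on the half-space. -/
def euclNorm (x : HS) : ℝ := √(‖x.1‖ ^ 2 + (x.2 : ℝ) ^ 2)

theorem continuous_euclNorm : Continuous euclNorm := by unfold euclNorm; fun_prop

theorem euclNorm_scale {r : ℝ} (hr : 0 < r) (x : HS) : euclNorm (scale r x) = r * euclNorm x := by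
  unfold euclNorm scale
  rw [norm_mul, Complex.norm_of_nonneg hr.le, NNReal.coe_mul, Real.coe_toNNReal _ hr.le,
    ← Real.sqrt_sq hr.le, ← Real.sqrt_mul (sq_nonneg r), Real.sqrt_sq hr.le]
  congr 1
  ring

theorem isCompact_euclNorm_le : IsCompact {x : HS | euclNorm x ≤ 1} := by
  refine ((isCompact_closedBall (0 : ℂ) 1).prod (isCompact_Icc (a := (0 : NNReal))
    (b := 1))).of_isClosed_subset (isClosed_le continuous_euclNorm continuous_const) fun x hx => ?_
  have hx' : ‖x.1‖ ^ 2 + (x.2 : ℝ) ^ 2 ≤ 1 := by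
    simpa [euclNorm, Real.sqrt_le_one] using hx
  refine ⟨mem_closedBall_zero_iff.2 ?_, zero_le, ?_⟩
  · exact (sq_le_one_iff₀ (norm_nonneg _)).1 (by nlinarith [sq_nonneg (x.2 : ℝ)])
  · exact_mod_cast (sq_le_one_iff₀ x.2.coe_nonneg).1 (by nlinarith [sq_nonneg ‖x.1‖])

theorem norm_halfSpaceHomeomorph (x : HS) : ‖(halfSpaceHomeomorph x).1‖ = euclNorm x := by
  rw [EuclideanSpace.norm_eq, euclNorm]
  congr 1
  simp [halfSpaceHomeomorph, Fin.sum_univ_three, Complex.sq_norm, Complex.normSq_apply]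
  ring

/-- Squeezing in the direction transverse to the half-disc. -/
def squeeze (δ : ℝ) (x : HS) : HS := (x.1.re + (δ * x.1.im : ℝ) * Complex.I, x.2)

theorem squeeze_of_im_eq_zero (δ : ℝ) {x : HS} (hx : x.1.im = 0) : squeeze δ x = x := by
  ext <;> simp [squeeze, hx]
  rw [← Complex.re_add_im x.1, hx]
  simp

theorem isOpenEmbedding_squeeze {δ : ℝ} (hδ : 0 < δ) : IsOpenEmbedding (squeeze δ) := by
  have h : ∀ a b : ℝ, b * a = 1 → ∀ x, squeeze b (squeeze a x) = x := by
    intro a b hab x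
    ext
    · simp only [squeeze, Complex.add_re, Complex.ofReal_re, Complex.mul_re, Complex.I_re, mul_zero,
        Complex.ofReal_im, Complex.I_im, mul_one, sub_self, add_zero, Complex.add_im, zero_add,
        Complex.mul_im, ← mul_assoc, hab, one_mul]
      exact Complex.re_add_im x.1
    · rfl
  have c : ∀ a, Continuous (squeeze a) := fun a => by unfold squeeze; fun_prop
  exact (Homeomorph.mk ⟨squeeze δ, squeeze δ⁻¹, h _ _ (inv_mul_cancel₀ hδ.ne'),
    h _ _ (mul_inv_cancel₀ hδ.ne')⟩ (c _) (c _)).isOpenEmbedding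

/-- The shear which makes one strand of the half-circle vertical. -/
def shear : HS ≃ₜ HS where
  toFun x := (x.1 - (√(1 - (x.2 : ℝ) ^ 2) : ℝ), x.2)
  invFun x := (x.1 + (√(1 - (x.2 : ℝ) ^ 2) : ℝ), x.2)
  left_inv x := by simp
  right_inv x := by simp
  continuous_toFun := by fun_prop
  continuous_invFun := by fun_prop

theorem shear_image_bridge :
    shear '' bridge 0 arcWidth 1 = {x | x.1.im = 0 ∧ euclNorm x = 1} := by
  have hs : ∀ s : NNReal, s ≤ 1 → 0 ≤ 1 - (s : ℝ) ^ 2 := fun s hs => by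
    have := (sq_le_one_iff₀ s.coe_nonneg).2 (by exact_mod_cast hs)
    linarith
  ext x
  constructor
  · rintro ⟨⟨z, s⟩, ⟨h1, h2⟩, rfl⟩
    have key : ∀ t : ℝ, t = √(1 - (s : ℝ) ^ 2) ∨ t = -√(1 - (s : ℝ) ^ 2) →
        ((t : ℂ), s) ∈ {x : HS | x.1.im = 0 ∧ euclNorm x = 1} := by
      intro t ht
      refine ⟨Complex.ofReal_im _, ?_⟩
      have : t ^ 2 = 1 - (s : ℝ) ^ 2 := by
        rcases ht with rfl | rfl
        · exact Real.sq_sqrt (hs s h1)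
        · rw [neg_sq, Real.sq_sqrt (hs s h1)]
      simp [euclNorm, this]
    rcases h2 with h2 | h2
    · convert key _ (Or.inr rfl) using 1
      have h2' : z = 0 := h2
      ext <;> simp [shear, h2']
    · convert key _ (Or.inl rfl) using 1
      have h2' : z = 0 + arcWidth s := h2
      ext
      · change z - (√(1 - (s : ℝ) ^ 2) : ℝ) = (√(1 - (s : ℝ) ^ 2) : ℝ)
        rw [h2', arcWidth]
        push_cast
        ring
      · rfl
  · rintro ⟨h1, h2⟩
    obtain ⟨z, s⟩ := x
    obtain ⟨t, rfl⟩ : ∃ t : ℝ, z = t := ⟨z.re, by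
      rw [← Complex.re_add_im z]
      have h1' : z.im = 0 := h1
      simp [h1']⟩
    rw [euclNorm, Real.sqrt_eq_one, Complex.norm_real, Real.norm_eq_abs, sq_abs] at h2
    have h2' : t ^ 2 + (s : ℝ) ^ 2 = 1 := h2
    have hs1 : s ≤ 1 := by
      exact_mod_cast (sq_le_one_iff₀ s.coe_nonneg).1 (by nlinarith [sq_nonneg t])
    refine ⟨shear.symm ((t : ℂ), s), ⟨hs1, ?_⟩, shear.apply_symm_apply _⟩
    have ht : t ^ 2 = √(1 - (s : ℝ) ^ 2) ^ 2 := by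
      rw [Real.sq_sqrt (hs s hs1)]
      linarith
    change (t : ℂ) + (√(1 - (s : ℝ) ^ 2) : ℝ) = 0 ∨
      (t : ℂ) + (√(1 - (s : ℝ) ^ 2) : ℝ) = 0 + arcWidth s
    rcases sq_eq_sq_iff_eq_or_eq_neg.1 ht with h | h
    · right
      rw [h, arcWidth]
      push_cast
      ring
    · left
      rw [h]
      push_cast
      ring

section

variable {H : Type*} [TopologicalSpace H] {T : Set H}

/-- `e` is a boundary chart in which `A` is the standard bridge. -/
structure IsArcChart (T A : Set H) (e : HS → H) : Prop extends IsBoundaryChart T e where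
  image_bridge : e '' bridge 0 arcWidth 1 = A

/-- The given chart may leave `U`, so it is confined to a thin neighbourhood of the disc: compress
it radially into radius `1 + η`, then squeeze it by `η` transversally to the disc. Neither operation
moves the half-circle, and the preceding shear turns the standard bridge into it. -/
theorem IsTrivializingDisc.exists_isArcChart {A D : Set H} (h : IsTrivializingDisc T A D)
    {U : Set H} (hU : IsOpen U) (hD : D ⊆ U) :
    ∃ e : HS → H, IsArcChart T A e ∧ range e ⊆ U := by
  obtain ⟨e, h1, h2, rfl, rfl⟩ := h
  have ce : Continuous fun x => e (halfSpaceHomeomorph x) :=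
    h1.continuous.comp halfSpaceHomeomorph.continuous
  have him : ∀ x : HS, (halfSpaceHomeomorph x).1 2 = x.1.im := fun x => rfl
  have cm : Continuous fun p : (ℝ × ℝ) × HS => e (halfSpaceHomeomorph
      (squeeze p.1.1 (scale p.1.2 p.2))) := by
    refine ce.comp ?_
    unfold squeeze scale
    fun_prop
  -- At the parameters `(0, 1)` the squeeze projects the unit half-ball into the half-disc, hence
  -- into `D ⊆ U`. Compactness keeps its image in `U` for nearby parameters `(η, 1 + η)`.
  obtain ⟨u, v, hu, -, hu1, hv1, huv⟩ := generalized_tube_lemma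
    (isCompact_singleton (x := ((0 : ℝ), (1 : ℝ)))) isCompact_euclNorm_le (hU.preimage cm) (by
      rintro ⟨p, x⟩ ⟨hp, hx⟩
      obtain rfl : p = (0, 1) := hp
      refine hD ⟨_, ⟨?_, ?_⟩, rfl⟩
      · rw [him]
        simp [squeeze]
      · rw [norm_halfSpaceHomeomorph]
        refine le_trans (Real.sqrt_le_sqrt ?_) hx
        simp only [scale_one, squeeze]
        gcongr
        simpa using Complex.abs_re_le_norm x.1)
  obtain ⟨η, hη, hηu⟩ : ∃ η : ℝ, 0 < η ∧ (η, 1 + η) ∈ u := by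
    have : (fun η : ℝ => (η, 1 + η)) ⁻¹' u ∈ 𝓝 (0 : ℝ) :=
      (hu.preimage (by fun_prop)).mem_nhds (by simpa using hu1)
    obtain ⟨ε, hε, h⟩ := Metric.mem_nhds_iff.1 this
    exact ⟨ε / 2, half_pos hε, h (by simp [abs_of_pos hε, hε])⟩
  obtain ⟨j, j1, j2, j3, j4⟩ := exists_radial_embedding continuous_euclNorm
    (fun r hr x => euclNorm_scale hr x) one_pos (lt_add_of_pos_right 1 hη)
  have hη1 : 0 < 1 + η := by linarith
  refine ⟨fun x => e (halfSpaceHomeomorph (squeeze η (j (shear x)))), ⟨⟨?_, fun x => ?_⟩, ?_⟩, ?_⟩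
  · exact h1.comp (halfSpaceHomeomorph.isOpenEmbedding.comp
      ((isOpenEmbedding_squeeze hη).comp (j1.comp shear.isOpenEmbedding)))
  · rw [h2]
    have : (halfSpaceHomeomorph (squeeze η (j (shear x)))).1 0 = ((j (shear x)).2 : ℝ) := rfl
    rw [this, NNReal.coe_eq_zero, j2]
    rfl
  · have e1 : (fun x => e (halfSpaceHomeomorph (squeeze η (j (shear x))))) '' bridge 0 arcWidth 1 =
        e '' (halfSpaceHomeomorph '' (shear '' bridge 0 arcWidth 1)) := by
      rw [image_image, image_image]
      refine image_congr fun x hx => ?_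
      have hx' := mem_image_of_mem shear hx
      rw [shear_image_bridge] at hx'
      rw [j3 _ hx'.2.le, squeeze_of_im_eq_zero _ hx'.1]
    rw [e1, shear_image_bridge]
    congr 1
    ext y
    obtain ⟨x, rfl⟩ := halfSpaceHomeomorph.surjective y
    rw [halfSpaceHomeomorph.injective.mem_set_image]
    simp only [mem_ofPred_eq, him, norm_halfSpaceHomeomorph]
  · rintro _ ⟨x, rfl⟩
    have hlt := j4 (shear x)
    have e2 : scale (1 + η) (scale (1 + η)⁻¹ (j (shear x))) = j (shear x) :=
      scale_scale (inv_pos.2 hη1) (mul_inv_cancel₀ hη1.ne') _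
    have hmem : ((η, 1 + η), scale (1 + η)⁻¹ (j (shear x))) ∈ u ×ˢ v := by
      refine ⟨hηu, hv1 ?_⟩
      change euclNorm _ ≤ 1
      rw [euclNorm_scale (inv_pos.2 hη1), inv_mul_le_iff₀ hη1, mul_one]
      exact hlt.le
    have := huv hmem
    simp only [mem_preimage, e2] at this
    exact this

end

/-! ### Exchanging bridges -/

/-- A small bridge in an arbitrary chart close to the point `10` of the boundary plane can be exchanged
with the same bridge at the origin of the standard chart. -/
theorem exists_exchange_of_chart {ψ : HS → HS} (hψ : IsOpenEmbedding ψ)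
    (hψ2 : ∀ x, (ψ x).2 = 0 ↔ x.2 = 0) (hψ0 : ψ 0 = (10, 0)) (hψ1 : ∀ x, ‖(ψ x).1 - 10‖ < 1)
    {c : NNReal} (hc : 0 < c) (hc1 : c ≤ 1 / 2) {w : NNReal → ℂ} (hw : Continuous w)
    (h0 : ∀ s, w s = 0 ↔ c ≤ s) (h1 : ∀ s, ‖w s‖ ≤ 1 / 2) :
    ∃ φ : HS ≃ₜ HS, CompactlySupported φ ∧ (∀ x, (φ x).2 = 0 ↔ x.2 = 0) ∧
      φ '' bridge 0 w c = ψ '' bridge 0 w c ∧ φ '' (ψ '' bridge 0 w c) = bridge 0 w c := by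
  let β : ℂ → ℂ := fun z => (ψ (z, 0)).1
  have hβ : ∀ z, ψ (z, 0) = (β z, 0) := fun z => Prod.ext rfl ((hψ2 _).2 rfl)
  have cβ : IsOpenEmbedding β := by
    have h : IsBoundaryChart {x : HS | x.2 = 0} ψ := ⟨hψ, hψ2⟩
    let k : {x : HS | x.2 = 0} ≃ₜ ℂ :=
      { toFun := fun x => x.1.1
        invFun := fun z => ⟨(z, 0), rfl⟩
        left_inv := fun x => Subtype.ext (Prod.ext rfl x.2.symm)
        right_inv := fun _ => rfl
        continuous_toFun := by fun_prop
        continuous_invFun := by fun_prop }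
    exact k.isOpenEmbedding.comp h.isOpenEmbedding_base
  have β0 : β 0 = 10 := congrArg Prod.fst hψ0
  have β1 : ∀ z, ‖β z - 10‖ < 1 := fun z => hψ1 (z, 0)
  have hd : IsOpenEmbedding (Prod.map β (id : NNReal → NNReal)) :=
    cβ.prodMap IsOpenEmbedding.id
  -- `ψ` and the product collar over the boundary map `β` have the same base. After `F` the chart
  -- `ψ` is this product on the region under the bump, so levels are preserved there.
  obtain ⟨F, f1, f2, f3⟩ := exists_collar_change hd hψ fun z => (hβ z).symm
  have ffar : ∀ x : HS, 1 ≤ ‖x.1 - 10‖ → F x = x := fun x hx => by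
    refine f3 x ?_ ?_
    · rintro ⟨y, -, rfl⟩
      exact hx.not_gt (β1 y.1)
    · rintro ⟨y, -, rfl⟩
      exact hx.not_gt (hψ1 y)
  have fK : CompactlySupported F := by
    refine ⟨_, (isCompact_pushSupport.image hd.continuous).union
      (isCompact_pushSupport.image hψ.continuous), fun x hx => ?_⟩
    rw [mem_union, not_or] at hx
    exact f3 x hx.1 hx.2
  have fbot : ∀ x : HS, x.2 = 0 → F x = x := by
    rintro ⟨z, s⟩ hs
    obtain rfl : s = 0 := hs
    by_cases hz : z ∈ range β
    · obtain ⟨z, rfl⟩ := hz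
      exact f2 z
    · refine f3 _ ?_ ?_
      · rintro ⟨y, -, hy⟩
        exact hz ⟨y.1, congrArg Prod.fst hy⟩
      · rintro ⟨⟨y, t⟩, -, hy⟩
        obtain rfl : t = 0 := (hψ2 (y, t)).1 (by rw [hy])
        exact hz ⟨y, congrArg Prod.fst hy⟩
  have f0 : ∀ x, (F x).2 = 0 ↔ x.2 = 0 := fun x =>
    ⟨fun h => by rw [← F.injective (fbot _ h)]; exact h, fun h => by rw [fbot x h]; exact h⟩
  have f0' : ∀ x, (F.symm x).2 = 0 ↔ x.2 = 0 := fun x => by rw [← f0, F.apply_symm_apply]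
  -- Injectivity of `β` is all that is known about the new strand: no bound on its angle is
  -- available as it approaches the vertical one.
  have hw' : ∀ s, β (w s) - 10 = 0 ↔ c ≤ s := fun s => by
    rw [← h0, ← β0, sub_eq_zero, cβ.injective.eq_iff]
  have fb : F '' bridge 0 w c = bridge 0 w c := by
    have : ∀ x ∈ bridge 0 w c, F x = id x := by
      rintro x ⟨-, h⟩
      refine ffar x ?_
      have h3 : ‖x.1‖ ≤ 1 / 2 := by
        rcases h with h | h
        · rw [h]; norm_num
        · rw [h, zero_add]; exact h1 _
      have h2 := norm_sub_norm_le (10 : ℂ) x.1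
      rw [norm_sub_rev, Complex.norm_ofNat] at h2
      linarith
    rw [image_congr this, image_id]
  have fψ : F '' (ψ '' bridge 0 w c) = bridge 10 (fun s => β (w s) - 10) c := by
    -- The bounds `1 / 2` on height and width put the bridge under the graph of `bump`, where `F` is
    -- controlled.
    have hreg : ∀ z : ℂ, ∀ s ≤ c, ‖z‖ ≤ 1 / 2 → F (ψ (z, s)) = (β z, s) := by
      intro z s hs hz
      refine f1 (z, s) ⟨hz.trans (by norm_num), ?_⟩
      have : (‖z‖₊ : NNReal) ≤ 1 / 2 := by exact_mod_cast hz
      refine (hs.trans hc1).trans (le_tsub_of_add_le_left ?_)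
      calc ‖z‖₊ + 1 / 2 ≤ 1 / 2 + 1 / 2 := by gcongr
        _ = 1 := add_halves 1
    rw [image_image, bridge_eq_image, bridge_eq_image, image_union, image_image, image_image]
    refine congrArg₂ _ (image_congr fun s hs => ?_) (image_congr fun s hs => ?_)
    · rw [hreg _ s hs (by norm_num), β0]
    · rw [zero_add, hreg _ s hs (h1 s)]
      ext <;> simp
  obtain ⟨G, g1, g2, g3, g4⟩ := exists_exchange hc hw (w' := fun s => β (w s) - 10)
    ((cβ.continuous.comp hw).sub continuous_const) h0 hw' (fun s => (h1 s).trans (by norm_num))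
    (fun s => (β1 _).le)
  have gcomp : ∀ S : Set HS, (F⁻¹ * G * F : HS ≃ₜ HS) '' S = F.symm '' (G '' (F '' S)) := by
    intro S
    rw [image_image, image_image]
    rfl
  have fψ' : F.symm '' bridge 10 (fun s => β (w s) - 10) c = ψ '' bridge 0 w c := by
    rw [← fψ]
    exact F.toEquiv.symm_image_image _
  have fb' : F.symm '' bridge 0 w c = bridge 0 w c := by
    conv_lhs => rw [← fb]
    exact F.toEquiv.symm_image_image _
  refine ⟨F⁻¹ * G * F, (fK.inv.mul g1).mul fK, fun x => ?_, ?_, ?_⟩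
  · change (F.symm (G (F x))).2 = 0 ↔ _
    rw [f0', g2, f0]
  · rw [gcomp, fb, g3, fψ']
  · rw [gcomp, fψ, g4, fb']

theorem shrink_image_bridge {φ : HS ≃ₜ HS} {ε : NNReal} (hε : 0 < ε)
    (hφ : ∀ x : HS, ‖x.1‖ ≤ 2 → x.2 ≤ 2 → φ x = ((ε : ℝ) * x.1, ε * x.2)) :
    φ '' bridge 0 arcWidth 1 = bridge 0 (fun s => (ε : ℝ) * arcWidth (s / ε)) ε := by
  have h2 : ∀ s : NNReal, s ≤ 1 → s ≤ 2 := fun s hs => hs.trans one_le_two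
  have hi : (fun s => ε * s) '' Iic 1 = Iic ε := by
    ext s
    constructor
    · rintro ⟨t, ht, rfl⟩
      exact mul_le_of_le_one_right zero_le (mem_Iic.1 ht)
    · intro hs
      exact ⟨s / ε, mem_Iic.2 (div_le_one_of_le₀ (mem_Iic.1 hs) zero_le), mul_div_cancel₀ _ hε.ne'⟩
  rw [bridge_eq_image, bridge_eq_image, image_union, ← hi]
  simp only [image_image]
  refine congrArg₂ _ (image_congr fun s hs => ?_) (image_congr fun s hs => ?_)
  · rw [hφ _ (by simp) (h2 s hs)]
    simp
  · rw [hφ _ (by simpa using norm_arcWidth_le s) (h2 s hs), mul_div_cancel_left₀ _ hε.ne']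
    simp

/-! ### Flipping an arc and exchanging two arcs -/

section

variable {H : Type*} [TopologicalSpace H] {T : Set H}

theorem IsArcChart.inter_eq {A : Set H} {e : HS → H} (he : IsArcChart T A e) :
    T ∩ A = {e 0, e (2, 0)} := by
  ext y
  constructor
  · rintro ⟨h, h'⟩
    rw [← he.image_bridge] at h'
    obtain ⟨⟨z, s⟩, ⟨-, h2⟩, rfl⟩ := h'
    obtain rfl : s = 0 := (he.mem_iff _).1 h
    rcases h2 with h2 | h2
    · left
      rw [show z = 0 from h2]
      rfl
    · right
      rw [show z = 0 + arcWidth 0 from h2, arcWidth_zero, zero_add]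
      rfl
  · rw [← he.image_bridge]
    rintro (rfl | rfl)
    · exact ⟨(he.mem_iff _).2 rfl, ⟨_, ⟨zero_le, Or.inl rfl⟩, rfl⟩⟩
    · refine ⟨(he.mem_iff _).2 rfl, ⟨_, ⟨zero_le, Or.inr ?_⟩, rfl⟩⟩
      simp [arcWidth_zero]

/-- A half twist along an arc. -/
theorem IsArcChart.exists_flip [T2Space H] {A : Set H} {e : HS → H} (he : IsArcChart T A e) :
    ∃ F : H ≃ₜ H, Admissible T F ∧ F '' A = A ∧ F (e 0) = e (2, 0) ∧ F (e (2, 0)) = e 0 ∧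
      ∀ y, y ∉ range e → F y = y := by
  -- In each level the centre of rotation is the midpoint of the two strands, so the half turn
  -- interchanges them.
  obtain ⟨φ, h1, h2, h3⟩ := exists_halfTurn (fun s => arcWidth s / 2)
    (continuous_arcWidth.div_const 2) two_pos 1
  obtain ⟨F, k1, k2, k3⟩ := he.exists_extension h1 fun x => by rw [h2]
  have hn : ∀ s, ‖arcWidth s / 2‖ ≤ 2 := fun s => by
    rw [norm_div, Complex.norm_ofNat]
    linarith [norm_arcWidth_le s, norm_nonneg (arcWidth s)]
  have e1 : ∀ s ≤ 1, φ (0, s) = (0 + arcWidth s, s) := fun s hs => by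
    rw [h3 _ _ hs]
    · ext
      · simp only [sub_zero, zero_add]
        ring
      · rfl
    · simpa using hn s
  have e2 : ∀ s ≤ 1, φ (0 + arcWidth s, s) = (0, s) := fun s hs => by
    rw [h3 _ _ hs]
    · ext
      · simp only [zero_add]
        ring
      · rfl
    · have : (0 + arcWidth s) - arcWidth s / 2 = arcWidth s / 2 := by ring
      simp only [this]
      exact hn s
  have e3 := e1 0 zero_le
  have e4 := e2 0 zero_le
  rw [arcWidth_zero, zero_add] at e3 e4
  refine ⟨F, k1, ?_, (k2 _).trans (congrArg e e3), (k2 _).trans (congrArg e e4), k3⟩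
  rw [← he.image_bridge, image_image]
  simp only [k2]
  rw [← image_image e φ, bridge_eq_image, image_union, image_image, image_image,
    image_congr (s := Iic 1) e1, image_congr (s := Iic 1) e2, union_comm]

/-- Two trivial arcs are exchanged by an admissible homeomorphism fixing a given closed set. -/
theorem exists_arc_exchange [T2Space H] (hT : HasBoundaryCharts T) (hc : IsPreconnected T)
    {Z A A' : Set H} (hZ : IsClosed Z) (hZT : (T ∩ Z).Finite) {e e' : HS → H}
    (he : IsArcChart T A e) (he' : IsArcChart T A' e') (hA' : IsClosed A')
    (hd : Disjoint (range e) (Z ∪ A')) (hd' : Disjoint (range e') Z) :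
    ∃ F : H ≃ₜ H, Admissible T F ∧ (∀ y ∈ Z, F y = y) ∧ F '' A = A' ∧ F '' A' = A := by
  have hfin : (T ∩ (Z ∪ A')).Finite := by
    rw [inter_union_distrib_left, he'.inter_eq]
    exact hZT.union (Set.toFinite _)
  have hq : e' (10, 0) ∉ Z ∪ A' := by
    rintro (h | h)
    · exact disjoint_left.1 hd' (mem_range_self _) h
    · have : e' (10, 0) ∈ T ∩ A' := ⟨(he'.mem_iff _).2 rfl, h⟩
      rw [he'.inter_eq] at this
      rcases this with h | h
      · have := congrArg Prod.fst (he'.isOpenEmbedding.injective h)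
        norm_num at this
      · have := congrArg Prod.fst (he'.isOpenEmbedding.injective h)
        norm_num at this
  -- The foot `e 0` is dragged to the point `10` of the chart `e'`, away from the endpoints `0` and
  -- `2` of `A'`. The arc `A'` and the set `Z` are fixed during the move.
  obtain ⟨F₁, a1, a2, a3⟩ := exists_admissible_move hT hc (hZ.union hA') hfin (p := e 0)
    (q := e' (10, 0)) ⟨(he.mem_iff _).2 rfl, disjoint_left.1 hd (mem_range_self _)⟩
    ⟨(he'.mem_iff _).2 rfl, hq⟩
  have hf : IsBoundaryChart T (F₁ ∘ e) := he.toIsBoundaryChart.homeo_comp a1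
  have hfr : ∀ y ∈ Z ∪ A', y ∉ range (F₁ ∘ e) := by
    rintro y hy ⟨x, hx⟩
    have : e x = y := F₁.injective (by rw [a2 y hy]; exact hx)
    exact disjoint_left.1 hd ⟨x, this⟩ hy
  have hU : IsOpen (e' '' {x | ‖x.1 - 10‖ < 1}) :=
    he'.isOpenEmbedding.isOpenMap _ (isOpen_lt (by fun_prop) continuous_const)
  have hV : (F₁ ∘ e) ⁻¹' (e' '' {x | ‖x.1 - 10‖ < 1}) ∈ 𝓝 (0 : HS) := by
    refine (hU.preimage hf.1.continuous).mem_nhds ?_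
    rw [mem_preimage, Function.comp_apply, a3]
    exact ⟨(10, 0), by simp, rfl⟩
  -- The moved chart, restricted by `j`, has image in `e'` over the unit disc about `10`, and
  -- therefore factors through `e'` as `ψ`.
  obtain ⟨b, hb, j, j1, j2, j3, j4⟩ := exists_small_embedding hV
  choose ψ ψ1 ψ2 using j4
  have hcomp : e' ∘ ψ = (F₁ ∘ e) ∘ j := funext ψ2
  have hψ : IsOpenEmbedding ψ :=
    IsOpenEmbedding.of_comp ψ he'.isOpenEmbedding (hcomp ▸ hf.1.comp j1)
  have hψ2 : ∀ x, (ψ x).2 = 0 ↔ x.2 = 0 := fun x => by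
    rw [← he'.mem_iff, ψ2, hf.2, j2]
  have hψ0 : ψ 0 = (10, 0) := by
    apply he'.isOpenEmbedding.injective
    rw [ψ2, j3 0 (by simpa using hb.le) (by simpa using hb.le)]
    exact a3
  -- The bound by `b` keeps the shrunk bridge where `j` is the identity. The bound `1 / 4` makes its
  -- width at most `1 / 2`.
  obtain ⟨ε, hε, hε1, hεb⟩ : ∃ ε : NNReal, 0 < ε ∧ ε ≤ 1 / 4 ∧ 2 * (ε : ℝ) ≤ b := by
    refine ⟨min (1 / 4) (b / 2).toNNReal, lt_min (by norm_num) (by simpa using hb),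
      min_le_left _ _, ?_⟩
    have : ((min (1 / 4) (b / 2).toNNReal : NNReal) : ℝ) ≤ b / 2 :=
      (NNReal.coe_le_coe.2 (min_le_right _ _)).trans_eq (Real.coe_toNNReal _ (half_pos hb).le)
    linarith
  have hε1' : (ε : ℝ) ≤ 1 / 4 := by exact_mod_cast hε1
  obtain ⟨φ, p1, p2, p3⟩ := exists_shrinking hε
    (NNReal.coe_le_coe.1 (by rw [NNReal.coe_one]; linarith))
  have hφ : CompactlySupported φ := ⟨_, (isCompact_closedBall _ _).prod isCompact_Icc, p1⟩
  set w : NNReal → ℂ := fun s => (ε : ℝ) * arcWidth (s / ε) with hw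
  have hφw : φ '' bridge 0 arcWidth 1 = bridge 0 w ε := shrink_image_bridge hε p3
  have hw2 : ∀ s, ‖w s‖ ≤ 2 * ε := fun s => by
    simp only [hw, norm_mul, Complex.norm_of_nonneg ε.coe_nonneg]
    rw [mul_comm]
    exact mul_le_mul_of_nonneg_right (norm_arcWidth_le _) ε.coe_nonneg
  have hw0 : ∀ s, w s = 0 ↔ ε ≤ s := fun s => by
    have : ((ε : ℝ) : ℂ) ≠ 0 := by exact_mod_cast hε.ne'
    simp only [hw, mul_eq_zero, this, false_or]
    rw [arcWidth_eq_zero_iff, one_le_div hε]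
  obtain ⟨G, g1, g2, g3, g4⟩ := exists_exchange_of_chart hψ hψ2 hψ0 ψ1 hε
    (NNReal.coe_le_coe.1 (by push_cast; linarith)) (w := w)
    (continuous_const.mul (continuous_arcWidth.comp (by fun_prop))) hw0
    (fun s => (hw2 s).trans (by linarith))
  -- `F₂` shrinks the moved arc in its own chart, `F₃` shrinks `A'` in `e'`, and `F₄` exchanges the
  -- two small bridges. The desired map is `F₄` conjugated by `F₃ * F₂ * F₁`.
  obtain ⟨F₂, b1, b2, b3⟩ := hf.exists_extension hφ p2
  obtain ⟨F₃, c1, c2, c3⟩ := he'.exists_extension hφ p2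
  obtain ⟨F₄, d1, d2, d3⟩ := he'.exists_extension g1 g2
  have hA1 : F₂ '' (F₁ '' A) = e' '' (ψ '' bridge 0 w ε) := by
    rw [← he.image_bridge, ← image_comp F₁ e, image_image]
    simp only [b2]
    rw [← image_image (F₁ ∘ e) φ, hφw, image_image]
    refine image_congr fun x hx => ?_
    have hx1 : ‖x.1‖ ≤ 2 * ε := by
      rcases hx.2 with h | h
      · rw [h]; simp
      · rw [h, zero_add]; exact hw2 _
    have hx2 : (x.2 : ℝ) ≤ ε := by exact_mod_cast hx.1
    rw [ψ2, j3 x (hx1.trans hεb) (by linarith)]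
  -- `F₃` acts within distance `4` of the origin of `e'`, while the shrunk copy of `A` lies within
  -- distance `1` of `10`.
  have hA2 : F₃ '' (F₂ '' (F₁ '' A)) = e' '' (ψ '' bridge 0 w ε) := by
    rw [hA1, image_image]
    refine image_congr ?_
    rintro _ ⟨x, -, rfl⟩
    rw [c2, p1]
    intro h
    have h1 : ‖(ψ x).1 - 10‖ < 1 := ψ1 x
    have h2 := mem_closedBall_zero_iff.1 h.1
    have h3 := norm_sub_norm_le (10 : ℂ) (ψ x).1
    rw [norm_sub_rev, Complex.norm_ofNat] at h3
    linarith
  have hB : F₃ '' (F₂ '' (F₁ '' A')) = e' '' bridge 0 w ε := by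
    have h1 : F₁ '' A' = A' := by
      rw [image_congr (g := id) fun y hy => a2 y (Or.inr hy), image_id]
    have h2 : F₂ '' A' = A' := by
      rw [image_congr (g := id) fun y hy => b3 y (hfr y (Or.inr hy)), image_id]
    rw [h1, h2, ← he'.image_bridge, image_image]
    simp only [c2]
    rw [← image_image e' φ, hφw]
  have hE1 : F₄ '' (e' '' bridge 0 w ε) = e' '' (ψ '' bridge 0 w ε) := by
    rw [image_image]
    simp only [d2]
    rw [← image_image e' G, g3]
  have hE2 : F₄ '' (e' '' (ψ '' bridge 0 w ε)) = e' '' bridge 0 w ε := by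
    rw [image_image]
    simp only [d2]
    rw [← image_image e' G, g4]
  have hZ' : ∀ y ∈ Z, (F₃ * F₂ * F₁) y = y := fun y hy => by
    change F₃ (F₂ (F₁ y)) = y
    rw [a2 y (Or.inl hy), b3 y (hfr y (Or.inl hy)), c3 y fun h => disjoint_left.1 hd' h hy]
  have hΨ : ∀ S : Set H, (F₃ * F₂ * F₁ : H ≃ₜ H) '' S = F₃ '' (F₂ '' (F₁ '' S)) := fun S => by
    rw [image_image, image_image]
    rfl
  have hadm : Admissible T (F₃ * F₂ * F₁) := (c1.mul b1).mul a1
  have hconj : ∀ S S' : Set H, F₄ '' ((F₃ * F₂ * F₁ : H ≃ₜ H) '' S) = (F₃ * F₂ * F₁ : H ≃ₜ H) '' S' →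
      ((F₃ * F₂ * F₁)⁻¹ * F₄ * (F₃ * F₂ * F₁) : H ≃ₜ H) '' S = S' := by
    intro S S' h
    have : ((F₃ * F₂ * F₁)⁻¹ * F₄ * (F₃ * F₂ * F₁) : H ≃ₜ H) '' S =
        (F₃ * F₂ * F₁ : H ≃ₜ H).symm '' (F₄ '' ((F₃ * F₂ * F₁ : H ≃ₜ H) '' S)) := by
      rw [image_image, image_image]
      rfl
    rw [this, h]
    exact (F₃ * F₂ * F₁ : H ≃ₜ H).toEquiv.symm_image_image _
  refine ⟨(F₃ * F₂ * F₁)⁻¹ * F₄ * (F₃ * F₂ * F₁), (hadm.inv.mul d1).mul hadm, fun y hy => ?_,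
    hconj _ _ ?_, hconj _ _ ?_⟩
  · change (F₃ * F₂ * F₁ : H ≃ₜ H).symm (F₄ ((F₃ * F₂ * F₁ : H ≃ₜ H) y)) = y
    rw [Homeomorph.symm_apply_eq, hZ' y hy, d3 y fun h => disjoint_left.1 hd' h hy]
  · rw [hΨ, hΨ, hA2, hB, hE2]
  · rw [hΨ, hΨ, hA2, hB, hE1]

end

/-! ### The boundary of the standard handlebody -/

theorem frontier_snd_nonneg : frontier {q : ℂ × ℝ | 0 ≤ q.2} = {q | q.2 = 0} := by
  have : {q : ℂ × ℝ | 0 ≤ q.2} = univ ×ˢ Ici 0 := by ext; simp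
  rw [this, frontier_univ_prod_eq, frontier_Ici]
  ext
  simp

/-- Where a set is locally flat, it has boundary charts. -/
theorem exists_boundaryChart_of_flat {S : Set (ℂ × ℝ)} (Ψ : OpenPartialHomeomorph (ℂ × ℝ) (ℂ × ℝ))
    (hΨ : ∀ y ∈ Ψ.source, y ∈ S ↔ 0 ≤ (Ψ y).2) {p : S} (hp : p.1 ∈ Ψ.source) (hp0 : Ψ p = 0) :
    ∃ e : HS → S, IsBoundaryChart {x : S | x.1 ∈ frontier S} e ∧ e 0 = p := by
  let ι : HS → ℂ × ℝ := fun x => (x.1, x.2)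
  have cι : Continuous ι := by fun_prop
  have hV : ι ⁻¹' Ψ.target ∈ 𝓝 (0 : HS) := by
    refine (Ψ.open_target.preimage cι).mem_nhds ?_
    have : ι 0 = Ψ p := hp0.symm
    rw [mem_preimage, this]
    exact Ψ.map_source hp
  obtain ⟨b, hb, j, j1, j2, j3, j4⟩ := exists_small_embedding hV
  have hS : ∀ x, Ψ.symm (ι (j x)) ∈ S := fun x => by
    rw [hΨ _ (Ψ.map_target (j4 x)), Ψ.right_inv (j4 x)]
    exact (j x).2.2
  refine ⟨fun x => ⟨Ψ.symm (ι (j x)), hS x⟩, ⟨?_, fun x => ?_⟩, Subtype.ext ?_⟩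
  · refine IsOpenEmbedding.of_continuous_injective_isOpenMap ?_ ?_ ?_
    · refine Continuous.subtype_mk ?_ _
      exact Ψ.continuousOn_symm.comp_continuous (cι.comp j1.continuous) j4
    · intro x y h
      have h1 : (((j x).1, ((j x).2 : ℝ)) : ℂ × ℝ) = ((j y).1, ((j y).2 : ℝ)) :=
        Ψ.symm.injOn (j4 x) (j4 y) (congrArg Subtype.val h)
      obtain ⟨h2, h3⟩ := Prod.mk.inj h1
      exact j1.injective (Prod.ext h2 (NNReal.coe_injective h3))
    · intro O hO
      have hW : IsOpen {q : ℂ × ℝ | (q.1, q.2.toNNReal) ∈ j '' O} :=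
        (j1.isOpenMap O hO).preimage (by fun_prop)
      have : (fun x => (⟨Ψ.symm (ι (j x)), hS x⟩ : S)) '' O =
          Subtype.val ⁻¹' (Ψ.source ∩ Ψ ⁻¹' {q : ℂ × ℝ | (q.1, q.2.toNNReal) ∈ j '' O}) := by
        ext y
        constructor
        · rintro ⟨x, hx, rfl⟩
          refine ⟨Ψ.map_target (j4 x), ?_⟩
          simp only [mem_preimage, Ψ.right_inv (j4 x)]
          exact ⟨x, hx, by simp [ι]⟩
        · rintro ⟨h1, x, hx, h2⟩
          refine ⟨x, hx, Subtype.ext ?_⟩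
          have : ι (j x) = Ψ y := by
            rw [h2]
            exact Prod.ext rfl (Real.coe_toNNReal _ ((hΨ _ h1).1 y.2))
          simp only [this]
          exact Ψ.left_inv h1
      rw [this]
      exact (Ψ.isOpen_inter_preimage hW).preimage continuous_subtype_val
  · have h : Ψ.IsImage S {q | 0 ≤ q.2} := fun y hy => (hΨ y hy).symm
    have h1 := h.frontier (Ψ.map_target (j4 x))
    rw [frontier_snd_nonneg, Ψ.right_inv (j4 x)] at h1
    change Ψ.symm (ι (j x)) ∈ frontier S ↔ _
    rw [← h1, ← j2]
    exact NNReal.coe_eq_zero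
  · have : j 0 = 0 := j3 0 (by simpa using hb.le) (by simpa using hb.le)
    change Ψ.symm (ι (j 0)) = p.1
    rw [this, show ι 0 = Ψ p from hp0.symm]
    exact Ψ.left_inv hp

/-- Logarithmic coordinates centred at `c`. -/
theorem exists_log_coordinate {c z₀ : ℂ} (h : z₀ ≠ c) {O : Set ℂ} (hO : IsOpen O) (hz : z₀ ∈ O) :
    ∃ η : OpenPartialHomeomorph ℂ ℂ, z₀ ∈ η.source ∧ η.source ⊆ O ∧ η z₀ = 0 ∧
      ∀ z ∈ η.source, (0 ≤ (η z).re ↔ ‖z₀ - c‖ ≤ ‖z - c‖) ∧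
        ((η z).re ≤ 0 ↔ ‖z - c‖ ≤ ‖z₀ - c‖) := by
  have h0 : z₀ - c ≠ 0 := sub_ne_zero.2 h
  -- After normalizing `c` to `0` and `z₀` to `1`, the real part of the logarithm is `log (‖z - c‖ /
  -- ‖z₀ - c‖)`, so its sign tells the sides of the circle apart.
  let a : ℂ ≃ₜ ℂ := (Homeomorph.subRight c).trans (Homeomorph.mulRight₀ (z₀ - c)⁻¹ (inv_ne_zero h0))
  have ha : ∀ z, a z = (z - c) * (z₀ - c)⁻¹ := fun z => rfl
  let η := (a.toOpenPartialHomeomorph.trans Complex.expOpenPartialHomeomorph.symm).restrOpen O hO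
  have hη : ∀ z, η z = Complex.log (a z) := fun z => rfl
  have hs : ∀ z, z ∈ η.source ↔ a z ∈ Complex.slitPlane ∧ z ∈ O := fun z => by
    simp [η, Complex.expOpenPartialHomeomorph]
  have ha0 : a z₀ = 1 := by rw [ha, mul_inv_cancel₀ h0]
  refine ⟨η, ?_, fun z hz => ((hs z).1 hz).2, ?_, fun z hz => ?_⟩
  · rw [hs, ha0]
    exact ⟨Complex.one_mem_slitPlane, hz⟩
  · rw [hη, ha0, Complex.log_one]
  · have h1 : a z ≠ 0 := Complex.slitPlane_ne_zero ((hs z).1 hz).1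
    have h2 : 0 < ‖z₀ - c‖ := norm_pos_iff.2 h0
    have h3 : ‖a z‖ = ‖z - c‖ / ‖z₀ - c‖ := by rw [ha, norm_mul, norm_inv, div_eq_mul_inv]
    rw [hη, Complex.log_re, Real.log_nonneg_iff (norm_pos_iff.2 h1),
      Real.log_nonpos_iff (norm_nonneg _), h3, one_le_div h2, div_le_one h2]
    exact ⟨Iff.rfl, Iff.rfl⟩

/-- The planar domain whose product with an interval is the standard handlebody. -/
def planarDomain (g : ℕ) : Set ℂ :=
  {z : ℂ | ‖z‖ ≤ g + 1 ∧ ∀ k : ℕ, 1 ≤ k → k ≤ g → 1 / 4 ≤ ‖z - k‖}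

/-- The boundary circles are disjoint: the holes have radius `1 / 4` and distinct integer centres,
and the outer circle has radius `g + 1`. So near a boundary point only one inequality matters, and
the logarithm about the centre of that circle straightens it. -/
theorem planarDomain_flat (g : ℕ) {z₀ : ℂ} (hz : z₀ ∈ planarDomain g) :
    planarDomain g ∈ 𝓝 z₀ ∨ ∃ η : OpenPartialHomeomorph ℂ ℂ, z₀ ∈ η.source ∧ η z₀ = 0 ∧
      ∀ z ∈ η.source, z ∈ planarDomain g ↔ 0 ≤ (η z).re := by
  have hopen : ∀ (s : Set ℕ), IsOpen {z : ℂ | ∀ k ∈ Finset.Icc 1 g, k ∉ s → 1 / 4 < ‖z - k‖} := by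
    intro s
    have : {z : ℂ | ∀ k ∈ Finset.Icc 1 g, k ∉ s → 1 / 4 < ‖z - k‖} =
        ⋂ k ∈ Finset.Icc 1 g, {z : ℂ | k ∉ s → 1 / 4 < ‖z - k‖} := by
      ext; simp
    rw [this]
    refine isOpen_biInter_finset fun k _ => ?_
    by_cases hk : k ∈ s
    · simp [hk]
    · simp only [hk, not_false_eq_true, forall_const]
      exact isOpen_lt continuous_const (by fun_prop)
  have hopen' : IsOpen {z : ℂ | ‖z‖ < g + 1} := isOpen_lt continuous_norm continuous_const
  by_cases h1 : ‖z₀‖ = g + 1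
  · right
    have hne : z₀ ≠ 0 := by
      rintro rfl
      rw [norm_zero] at h1
      linarith [(Nat.cast_nonneg g : (0 : ℝ) ≤ g)]
    have hz0 : z₀ ∈ {z : ℂ | ∀ k ∈ Finset.Icc 1 g, k ∉ (∅ : Set ℕ) → 1 / 4 < ‖z - k‖} := by
      intro k hk _
      rw [Finset.mem_Icc] at hk
      have h2 := norm_sub_norm_le z₀ k
      have h3 : (k : ℝ) ≤ g := by exact_mod_cast hk.2
      rw [h1, Complex.norm_natCast] at h2
      linarith
    obtain ⟨η, a1, a2, a3, a4⟩ := exists_log_coordinate hne (hopen ∅) hz0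
    -- The sign is reversed because the domain lies inside the outer circle, whereas it lies outside
    -- the holes.
    refine ⟨η.trans (Homeomorph.neg ℂ).toOpenPartialHomeomorph, by simpa using a1, by simp [a3],
      fun z hz => ?_⟩
    have hz' : z ∈ η.source := by simpa using hz
    have h4 := (a4 z hz').2
    rw [sub_zero, sub_zero, h1] at h4
    have h5 : ((η.trans (Homeomorph.neg ℂ).toOpenPartialHomeomorph) z).re = -(η z).re := rfl
    rw [h5, neg_nonneg, h4]
    refine ⟨fun h => h.1, fun h => ⟨h, fun k hk hk' => ?_⟩⟩
    exact (a2 hz' k (Finset.mem_Icc.2 ⟨hk, hk'⟩) (notMem_empty _)).le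
  have h1' : ‖z₀‖ < g + 1 := lt_of_le_of_ne hz.1 h1
  by_cases h2 : ∃ k : ℕ, 1 ≤ k ∧ k ≤ g ∧ ‖z₀ - k‖ = 1 / 4
  · right
    obtain ⟨k, hk, hk', hk2⟩ := h2
    have hne : z₀ ≠ k := by
      rintro rfl
      norm_num at hk2
    have hz0 : z₀ ∈ {z : ℂ | ∀ l ∈ Finset.Icc 1 g, l ∉ ({k} : Set ℕ) → 1 / 4 < ‖z - l‖} ∩
        {z : ℂ | ‖z‖ < g + 1} := by
      refine ⟨fun l hl hl' => ?_, h1'⟩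
      have hlk : (1 : ℝ) ≤ ‖(k : ℂ) - l‖ := by
        have : ((k : ℂ) - l) = ((k - l : ℤ) : ℂ) := by push_cast; ring
        rw [this, Complex.norm_intCast]
        have h3 : (k : ℤ) - l ≠ 0 := by
          intro h
          exact hl' (by simp only [mem_singleton_iff]; omega)
        exact_mod_cast Int.one_le_abs h3
      have := norm_sub_le_norm_sub_add_norm_sub (k : ℂ) z₀ l
      rw [norm_sub_rev (k : ℂ) z₀, hk2] at this
      linarith
    obtain ⟨η, a1, a2, a3, a4⟩ := exists_log_coordinate hne ((hopen {k}).inter hopen') hz0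
    refine ⟨η, a1, a3, fun z hz => ?_⟩
    rw [(a4 z hz).1, hk2]
    refine ⟨fun h => h.2 k hk hk', fun h => ⟨le_of_lt (a2 hz).2, fun l hl hl' => ?_⟩⟩
    by_cases hlk : l = k
    · rw [hlk]
      exact h
    · exact ((a2 hz).1 l (Finset.mem_Icc.2 ⟨hl, hl'⟩) hlk).le
  · left
    push Not at h2
    have : {z : ℂ | ∀ k ∈ Finset.Icc 1 g, k ∉ (∅ : Set ℕ) → 1 / 4 < ‖z - k‖} ∩
        {z : ℂ | ‖z‖ < g + 1} ∈ 𝓝 z₀ := by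
      refine ((hopen ∅).inter hopen').mem_nhds ⟨fun k hk _ => ?_, h1'⟩
      rw [Finset.mem_Icc] at hk
      exact lt_of_le_of_ne (hz.2 k hk.1 hk.2) (h2 k hk.1 hk.2).symm
    filter_upwards [this] with z hz
    exact ⟨le_of_lt hz.2, fun k hk hk' => (hz.1 k (Finset.mem_Icc.2 ⟨hk, hk'⟩)
      (notMem_empty _)).le⟩

theorem Icc_flat {s₀ : ℝ} (hs : s₀ ∈ Icc (0 : ℝ) 1) :
    Icc (0 : ℝ) 1 ∈ 𝓝 s₀ ∨ ∃ ν : OpenPartialHomeomorph ℝ ℝ, s₀ ∈ ν.source ∧ ν s₀ = 0 ∧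
      ∀ s ∈ ν.source, s ∈ Icc (0 : ℝ) 1 ↔ 0 ≤ ν s := by
  rcases hs.1.eq_or_lt with rfl | h0
  · refine Or.inr ⟨(OpenPartialHomeomorph.refl ℝ).restrOpen (Iio 1) isOpen_Iio, by simp, rfl,
      fun s hs => ?_⟩
    have hs' : s < 1 := by simpa using hs
    exact ⟨fun h => h.1, fun h => ⟨h, hs'.le⟩⟩
  rcases hs.2.eq_or_lt with rfl | h1
  · refine Or.inr ⟨(Homeomorph.subLeft (1 : ℝ)).toOpenPartialHomeomorph.restrOpen (Ioi 0)
      isOpen_Ioi, by simp, by simp, fun s hs => ?_⟩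
    have hs' : 0 < s := by simpa using hs
    have : (Homeomorph.subLeft (1 : ℝ)).toOpenPartialHomeomorph.restrOpen (Ioi 0)
      isOpen_Ioi s = 1 - s := rfl
    rw [this, sub_nonneg]
    exact ⟨fun h => h.2, fun h => ⟨hs'.le, h⟩⟩
  · exact Or.inl (Icc_mem_nhds h0 h1)

/-- The product of the line with a quadrant is homeomorphic to a half-space. -/
def cornerHomeomorph : ℂ × ℝ ≃ₜ ℂ × ℝ where
  -- The quadrant where `re` and the last coordinate are nonnegative is the set where their minimum
  -- is; the minimum and the difference are coordinates on the plane.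
  toFun x := (x.1.im + (x.1.re - x.2 : ℝ) * Complex.I, min x.1.re x.2)
  invFun x := ((x.2 + max x.1.im 0 : ℝ) + x.1.re * Complex.I, x.2 + max (-x.1.im) 0)
  left_inv x := by
    rcases le_total x.1.re x.2 with h | h
    · refine Prod.ext (Complex.ext ?_ ?_) ?_ <;> simp [h]
    · refine Prod.ext (Complex.ext ?_ ?_) ?_ <;> simp [h]
  right_inv x := by
    rcases le_total x.1.im 0 with h | h
    · refine Prod.ext (Complex.ext ?_ ?_) ?_ <;> simp [h]
    · refine Prod.ext (Complex.ext ?_ ?_) ?_ <;> simp [h]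
  continuous_toFun := by fun_prop
  continuous_invFun := by fun_prop

/-- The transposition of the last two coordinates. -/
def sideHomeomorph : ℂ × ℝ ≃ₜ ℂ × ℝ where
  toFun x := (x.1.im + x.2 * Complex.I, x.1.re)
  invFun x := (x.2 + x.1.re * Complex.I, x.1.im)
  left_inv x := by refine Prod.ext (Complex.ext ?_ ?_) ?_ <;> simp
  right_inv x := by refine Prod.ext (Complex.ext ?_ ?_) ?_ <;> simp
  continuous_toFun := by fun_prop
  continuous_invFun := by fun_prop

/-- Each factor of the product is locally all or a half-line direction. The combinations give an
interior point, which is excluded, a point of the top or bottom, a point of the side wall, and an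
edge, where the corner must be flattened. -/
theorem hasBoundaryCharts_stdHandlebody (g : ℕ) :
    HasBoundaryCharts {x : stdHandlebody g | x.1 ∈ frontier (stdHandlebody g)} := by
  rintro ⟨⟨z₀, s₀⟩, hz, hs⟩ hp
  rcases planarDomain_flat g hz with hK | ⟨η, η1, η2, η3⟩ <;>
    rcases Icc_flat hs with hI | ⟨ν, ν1, ν2, ν3⟩
  · exact absurd (mem_interior_iff_mem_nhds.2 (prod_mem_nhds hK hI)) hp.2
  · let η := (Homeomorph.subRight z₀).toOpenPartialHomeomorph.restrOpen
      (interior (planarDomain g)) isOpen_interior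
    have hη : η.source = interior (planarDomain g) := by simp [η]
    refine exists_boundaryChart_of_flat (η.prod ν) ?_ ?_ ?_
    · rintro ⟨z, s⟩ ⟨h1, h2⟩
      have h1' : z ∈ planarDomain g := interior_subset (hη ▸ h1)
      exact ⟨fun h => (ν3 s h2).1 h.2, fun h => ⟨h1', (ν3 s h2).2 h⟩⟩
    · exact ⟨hη ▸ mem_interior_iff_mem_nhds.2 hK, ν1⟩
    · exact Prod.ext (sub_self z₀) ν2
  · let ν := (Homeomorph.subRight s₀).toOpenPartialHomeomorph.restrOpen
      (interior (Icc (0 : ℝ) 1)) isOpen_interior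
    have hν : ν.source = interior (Icc (0 : ℝ) 1) := by simp [ν]
    refine exists_boundaryChart_of_flat
      ((η.prod ν).trans sideHomeomorph.toOpenPartialHomeomorph) ?_ ?_ ?_
    · rintro ⟨z, s⟩ ⟨⟨h1, h2⟩, -⟩
      have h2' : s ∈ Icc (0 : ℝ) 1 := interior_subset (hν ▸ h2)
      exact ⟨fun h => (η3 z h1).1 h.1, fun h => ⟨(η3 z h1).2 h, h2'⟩⟩
    · exact ⟨⟨η1, hν ▸ mem_interior_iff_mem_nhds.2 hI⟩, mem_univ _⟩
    · have : ν s₀ = 0 := sub_self s₀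
      change sideHomeomorph (η z₀, ν s₀) = 0
      rw [η2, this]
      simp [sideHomeomorph]
  · refine exists_boundaryChart_of_flat
      ((η.prod ν).trans cornerHomeomorph.toOpenPartialHomeomorph) ?_ ?_ ?_
    · rintro ⟨z, s⟩ ⟨⟨h1, h2⟩, -⟩
      change z ∈ planarDomain g ∧ s ∈ Icc (0 : ℝ) 1 ↔ 0 ≤ min (η z).re (ν s)
      rw [le_min_iff, η3 z h1, ν3 s h2]
    · exact ⟨⟨η1, ν1⟩, mem_univ _⟩
    · change cornerHomeomorph (η z₀, ν s₀) = 0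
      rw [η2, ν2]
      simp [cornerHomeomorph]

theorem isClosed_planarDomain (g : ℕ) : IsClosed (planarDomain g) := by
  have : planarDomain g = {z : ℂ | ‖z‖ ≤ g + 1} ∩
      ⋂ k : ℕ, ⋂ _ : 1 ≤ k, ⋂ _ : k ≤ g, {z : ℂ | 1 / 4 ≤ ‖z - k‖} := by
    ext; simp [planarDomain]
  rw [this]
  refine (isClosed_le continuous_norm continuous_const).inter (isClosed_iInter fun k =>
    isClosed_iInter fun _ => isClosed_iInter fun _ => isClosed_le continuous_const (by fun_prop))

theorem sphere_subset_planarDomain (g : ℕ) :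
    Metric.sphere (0 : ℂ) (g + 1) ⊆ planarDomain g := by
  intro z hz
  rw [mem_sphere_zero_iff_norm] at hz
  refine ⟨hz.le, fun k _ hk => ?_⟩
  have h2 := norm_sub_norm_le z k
  have h3 : (k : ℝ) ≤ g := by exact_mod_cast hk
  rw [hz, Complex.norm_natCast] at h2
  linarith

/-- All holes are centred on the real axis, so moving a point vertically away from the axis
increases its distance to every centre. The point reaches the outer circle, which is connected,
without entering a hole. -/
theorem isPreconnected_planarDomain (g : ℕ) : IsPreconnected (planarDomain g) := by
  have hg : (0 : ℝ) ≤ g := Nat.cast_nonneg g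
  have hsph : IsPreconnected (Metric.sphere (0 : ℂ) (g + 1)) :=
    isPreconnected_sphere (by simp) 0 _
  have key : ∀ z ∈ planarDomain g, ∃ t ⊆ planarDomain g, Metric.sphere (0 : ℂ) (g + 1) ⊆ t ∧
      z ∈ t ∧ IsPreconnected t := by
    intro z hz
    set σ : ℝ := if 0 ≤ z.im then 1 else -1 with hσ
    have hσ2 : σ ^ 2 = 1 := by rw [hσ]; split_ifs <;> norm_num
    have hσz : 0 ≤ σ * z.im := by
      rw [hσ]
      split_ifs with h
      · linarith
      · linarith
    let γ : ℝ → ℂ := fun t => z + (t * σ : ℝ) * Complex.I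
    have cγ : Continuous γ := by fun_prop
    have hn : ∀ t, ‖γ t‖ ^ 2 = ‖z‖ ^ 2 + 2 * t * (σ * z.im) + t ^ 2 := fun t => by
      rw [Complex.sq_norm, Complex.sq_norm, Complex.normSq_apply, Complex.normSq_apply]
      simp [γ]
      linear_combination t ^ 2 * hσ2
    have hn' : ∀ t, 0 ≤ t → ∀ k : ℕ, ‖z - k‖ ≤ ‖γ t - k‖ := fun t ht k => by
      rw [← sq_le_sq₀ (norm_nonneg _) (norm_nonneg _)]
      rw [Complex.sq_norm, Complex.sq_norm, Complex.normSq_apply, Complex.normSq_apply]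
      simp [γ]
      nlinarith [mul_nonneg ht hσz, sq_nonneg (t * σ)]
    -- The nonnegative root of the quadratic equation `‖γ b‖ ^ 2 = (g + 1) ^ 2`.
    let b : ℝ := √((σ * z.im) ^ 2 + ((g + 1) ^ 2 - ‖z‖ ^ 2)) - σ * z.im
    have hz2 : 0 ≤ ((g : ℝ) + 1) ^ 2 - ‖z‖ ^ 2 := by
      have := hz.1
      nlinarith [norm_nonneg z]
    have hb : 0 ≤ b := sub_nonneg.2 (Real.le_sqrt_of_sq_le (by linarith))
    have hbe : ‖γ b‖ = g + 1 := by
      rw [← sq_eq_sq₀ (norm_nonneg _) (by linarith), hn]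
      have h1 : (b + σ * z.im) ^ 2 = (σ * z.im) ^ 2 + ((g + 1) ^ 2 - ‖z‖ ^ 2) := by
        simp only [b, sub_add_cancel]
        exact Real.sq_sqrt (by positivity)
      linear_combination h1
    refine ⟨Metric.sphere (0 : ℂ) (g + 1) ∪ γ '' Icc 0 b, union_subset
      (sphere_subset_planarDomain g) ?_, subset_union_left, Or.inr ⟨0, ⟨le_rfl, hb⟩, by simp [γ]⟩,
      hsph.union (γ b) (by simpa using hbe) ⟨b, ⟨hb, le_rfl⟩, rfl⟩
        (isPreconnected_Icc.image _ cγ.continuousOn)⟩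
    rintro _ ⟨t, ⟨ht0, htb⟩, rfl⟩
    refine ⟨?_, fun k hk hk' => (hz.2 k hk hk').trans (hn' t ht0 k)⟩
    rw [← hbe, ← sq_le_sq₀ (norm_nonneg _) (norm_nonneg _), hn, hn]
    nlinarith [mul_nonneg (sub_nonneg.2 htb) hσz]
  have h0 : ((g + 1 : ℝ) : ℂ) ∈ Metric.sphere (0 : ℂ) (g + 1) := by
    rw [mem_sphere_zero_iff_norm, Complex.norm_of_nonneg (by linarith)]
  refine isPreconnected_of_forall ((g + 1 : ℝ) : ℂ) fun z hz => ?_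
  obtain ⟨t, h1, h2, h3, h4⟩ := key z hz
  exact ⟨t, h1, h2 h0, h3, h4⟩

/-- The frontier is the union of the bottom, the top and the side walls. Every vertical segment of a
wall meets the connected bottom, and one of them joins it to the connected top. -/
theorem isPreconnected_frontier_stdHandlebody (g : ℕ) :
    IsPreconnected (frontier (stdHandlebody g)) := by
  have hfr : frontier (stdHandlebody g) = planarDomain g ×ˢ ({0, 1} : Set ℝ) ∪
      frontier (planarDomain g) ×ˢ Icc (0 : ℝ) 1 := by
    change frontier (planarDomain g ×ˢ Icc (0 : ℝ) 1) = _
    rw [frontier_prod_eq, (isClosed_planarDomain g).closure_eq, isClosed_Icc.closure_eq,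
      frontier_Icc zero_le_one]
  have hlev : ∀ s : ℝ, IsPreconnected (planarDomain g ×ˢ ({s} : Set ℝ)) := fun s =>
    (isPreconnected_planarDomain g).prod isPreconnected_singleton
  have hver : ∀ z : ℂ, IsPreconnected (({z} : Set ℂ) ×ˢ Icc (0 : ℝ) 1) := fun z =>
    isPreconnected_singleton.prod isPreconnected_Icc
  have hcl : frontier (planarDomain g) ⊆ planarDomain g :=
    (isClosed_planarDomain g).frontier_subset
  obtain ⟨z₁, hz₁⟩ : (frontier (planarDomain g)).Nonempty := by
    refine nonempty_frontier_iff.2 ⟨⟨((g + 1 : ℝ) : ℂ), sphere_subset_planarDomain g ?_⟩, ?_⟩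
    · rw [mem_sphere_zero_iff_norm, Complex.norm_of_nonneg (by positivity)]
    · intro h
      have : (((g + 2 : ℝ) : ℂ)) ∈ planarDomain g := h ▸ mem_univ _
      have h2 := this.1
      rw [Complex.norm_of_nonneg (by positivity)] at h2
      linarith
  have hbot : planarDomain g ×ˢ ({0} : Set ℝ) ⊆ frontier (stdHandlebody g) := by
    rw [hfr]
    exact (prod_mono subset_rfl (by simp)).trans subset_union_left
  have htop : planarDomain g ×ˢ ({1} : Set ℝ) ⊆ frontier (stdHandlebody g) := by
    rw [hfr]
    exact (prod_mono subset_rfl (by simp)).trans subset_union_left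
  have hside : ∀ z ∈ frontier (planarDomain g),
      ({z} : Set ℂ) ×ˢ Icc (0 : ℝ) 1 ⊆ frontier (stdHandlebody g) := fun z hz => by
    rw [hfr]
    exact (prod_mono (singleton_subset_iff.2 hz) subset_rfl).trans subset_union_right
  have hu : ∀ z ∈ frontier (planarDomain g),
      IsPreconnected (planarDomain g ×ˢ ({0} : Set ℝ) ∪ ({z} : Set ℂ) ×ˢ Icc (0 : ℝ) 1) :=
    fun z hz => (hlev 0).union (z, 0) ⟨hcl hz, rfl⟩ ⟨rfl, by simp⟩ (hver z)
  refine isPreconnected_of_forall (z₁, 0) ?_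
  rintro ⟨z, s⟩ h
  rw [hfr] at h
  rcases h with ⟨h1, h2⟩ | ⟨h1, h2⟩
  · refine ⟨(planarDomain g ×ˢ ({0} : Set ℝ) ∪ ({z₁} : Set ℂ) ×ˢ Icc (0 : ℝ) 1) ∪
      planarDomain g ×ˢ ({1} : Set ℝ), union_subset (union_subset hbot (hside _ hz₁)) htop,
      Or.inl (Or.inl ⟨hcl hz₁, rfl⟩), ?_, (hu _ hz₁).union (z₁, 1) (Or.inr ⟨rfl, by simp⟩)
      ⟨hcl hz₁, rfl⟩ (hlev 1)⟩
    rcases h2 with h2 | h2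
    · exact Or.inl (Or.inl ⟨h1, h2⟩)
    · exact Or.inr ⟨h1, h2⟩
  · exact ⟨_, union_subset hbot (hside z h1), Or.inl ⟨hcl hz₁, rfl⟩, Or.inr ⟨rfl, h2⟩, hu z h1⟩

section

variable {H : Type*} [TopologicalSpace H] {T : Set H} {g : ℕ}

theorem IsHandlebody.hasBoundaryCharts (h : IsHandlebody g H T) : HasBoundaryCharts T := by
  obtain ⟨h, hT⟩ := h
  intro p hp
  obtain ⟨e, he, he0⟩ := hasBoundaryCharts_stdHandlebody g (h p) ((hT p).1 hp)
  refine ⟨h.symm ∘ e, ⟨h.symm.isOpenEmbedding.comp he.1, fun x => ?_⟩, ?_⟩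
  · rw [hT, Function.comp_apply, h.apply_symm_apply]
    exact he.2 x
  · rw [Function.comp_apply, he0, h.symm_apply_apply]

theorem IsHandlebody.isPreconnected (h : IsHandlebody g H T) : IsPreconnected T := by
  obtain ⟨h, hT⟩ := h
  have hcl : IsClosed (stdHandlebody g) := (isClosed_planarDomain g).prod isClosed_Icc
  have h1 : IsPreconnected {x : stdHandlebody g | x.1 ∈ frontier (stdHandlebody g)} := by
    rw [← Topology.IsInducing.subtypeVal.isPreconnected_image]
    convert isPreconnected_frontier_stdHandlebody g
    ext x
    exact ⟨by rintro ⟨y, hy, rfl⟩; exact hy, fun hx => ⟨⟨x, hcl.frontier_subset hx⟩, hx, rfl⟩⟩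
  have h2 : T = h.symm '' {x : stdHandlebody g | x.1 ∈ frontier (stdHandlebody g)} := by
    ext x
    rw [hT]
    exact ⟨fun hx => ⟨h x, hx, h.symm_apply_apply x⟩, by
      rintro ⟨y, hy, rfl⟩
      rwa [h.apply_symm_apply]⟩
  rw [h2]
  exact h1.image _ h.symm.continuous.continuousOn

end

/-! ### Permutations preserving the pairs of labels -/

/-- Induction on the number of blocks that may be moved: a flip, if needed, makes the permutation
trivial on the last of them. The group is arbitrary because the lemma is used for `sigmaPrime n` as
well as for the image of the extendable classes. -/
theorem mem_of_block_preserving {n : ℕ} {G : Subgroup (Equiv.Perm (Fin (2 * n)))}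
    (hG : ∀ i (h : 2 * i + 1 < 2 * n), Equiv.swap (⟨2 * i, by omega⟩ : Fin (2 * n)) ⟨2 * i + 1, h⟩ ∈ G)
    {ρ : Equiv.Perm (Fin (2 * n))} (hρ : ∀ k, (ρ k : ℕ) / 2 = (k : ℕ) / 2) : ρ ∈ G := by
  have key : ∀ m : ℕ, ∀ ρ : Equiv.Perm (Fin (2 * n)), (∀ k, (ρ k : ℕ) / 2 = (k : ℕ) / 2) →
      (∀ k : Fin (2 * n), m ≤ (k : ℕ) / 2 → ρ k = k) → ρ ∈ G := by
    intro m
    induction m with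
    | zero =>
      intro ρ _ h
      rw [show ρ = 1 from Equiv.ext fun k => h k (Nat.zero_le _)]
      exact G.one_mem
    | succ m ih =>
      intro ρ h1 h2
      by_cases hm : 2 * m + 1 < 2 * n
      · let a : Fin (2 * n) := ⟨2 * m, by omega⟩
        let b : Fin (2 * n) := ⟨2 * m + 1, hm⟩
        have hab : a ≠ b := fun h => by simp [a, b] at h
        have cases2 : ∀ k : Fin (2 * n), (k : ℕ) / 2 = m → k = a ∨ k = b := fun k hk => by
          simp only [a, b, Fin.ext_iff]
          omega
        have ha : (a : ℕ) / 2 = m := by simp [a]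
        have hb : (b : ℕ) / 2 = m := by simp only [b]; omega
        have hfix : ∀ τ : Equiv.Perm (Fin (2 * n)), (∀ k, (τ k : ℕ) / 2 = (k : ℕ) / 2) →
            (∀ k : Fin (2 * n), m + 1 ≤ (k : ℕ) / 2 → τ k = k) → τ a = a → τ ∈ G := by
          intro τ t1 t2 ta
          refine ih τ t1 fun k hk => ?_
          rcases hk.eq_or_lt with hk | hk
          · rcases cases2 k hk.symm with rfl | rfl
            · exact ta
            · rcases cases2 (τ b) ((t1 b).trans hb) with h | h
              · exact absurd (τ.injective (ta.trans h.symm)) hab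
              · exact h
          · exact t2 k hk
        by_cases hρa : ρ a = a
        · exact hfix ρ h1 h2 hρa
        · have hρa' : ρ a = b := (cases2 (ρ a) ((h1 a).trans ha)).resolve_left hρa
          have hs : ∀ k, ((Equiv.swap a b k : Fin (2 * n)) : ℕ) / 2 = (k : ℕ) / 2 := fun k => by
            rw [Equiv.swap_apply_def]
            split_ifs with e1 e2
            · rw [e1, ha, hb]
            · rw [e2, ha, hb]
            · rfl
          have := hfix (Equiv.swap a b * ρ) (fun k => (hs (ρ k)).trans (h1 k)) (fun k hk => by
            rw [Equiv.Perm.mul_apply, h2 k hk]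
            refine Equiv.swap_apply_of_ne_of_ne ?_ ?_ <;> rintro rfl <;> omega) (by
            rw [Equiv.Perm.mul_apply, hρa', Equiv.swap_apply_right])
          exact (G.mul_mem_cancel_left (hG m hm)).1 this
      · exact ih ρ h1 fun k hk => by omega
  exact key n ρ hρ fun k hk => by omega

/-- The label of an endpoint as a pair. -/
def labelEquiv (n : ℕ) : Fin n × Fin 2 ≃ Fin (2 * n) where
  toFun x := ⟨2 * x.1 + x.2, by omega⟩
  invFun k := (⟨k / 2, by omega⟩, ⟨k % 2, by omega⟩)
  left_inv x := by
    refine Prod.ext (Fin.ext ?_) (Fin.ext ?_)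
    · simp only
      omega
    · simp only
      omega
  right_inv k := Fin.ext (by simp only; omega)

/-- The permutation of the labels induced by a permutation of the pairs. -/
def pairPerm (n : ℕ) : Equiv.Perm (Fin n) →* Equiv.Perm (Fin (2 * n)) where
  toFun τ := (labelEquiv n).permCongr (Equiv.prodCongr τ (Equiv.refl _))
  map_one' := by ext; simp
  map_mul' τ τ' := by ext; simp [Prod.map_map]

theorem pairPerm_apply {n : ℕ} (τ : Equiv.Perm (Fin n)) (k : Fin (2 * n)) :
    (pairPerm n τ k : ℕ) = 2 * τ ⟨k / 2, by omega⟩ + k % 2 := rfl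

theorem pairPerm_swap {n i : ℕ} (h : 2 * i + 3 < 2 * n) :
    pairPerm n (Equiv.swap ⟨i, by omega⟩ ⟨i + 1, by omega⟩) =
      Equiv.swap ⟨2 * i, by omega⟩ ⟨2 * i + 2, by omega⟩ *
          Equiv.swap ⟨2 * i + 1, by omega⟩ ⟨2 * i + 3, h⟩ := by
  ext k
  rw [pairPerm_apply, Equiv.Perm.mul_apply]
  simp only [Equiv.swap_apply_def, Fin.ext_iff]
  split_ifs <;> simp_all <;> omega

/-- Adjacent transpositions generate the permutations of the pairs, and `pairPerm` maps them to the
given generators. -/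
theorem pairPerm_mem_sigmaPrime {n : ℕ} (τ : Equiv.Perm (Fin n)) : pairPerm n τ ∈ sigmaPrime n := by
  rcases n with _ | m
  · rw [Subsingleton.elim τ 1, map_one]
    exact one_mem _
  have hτ : τ ∈ Submonoid.closure (range fun i : Fin m => Equiv.swap i.castSucc i.succ) := by
    rw [Equiv.Perm.mclosure_swap_castSucc_succ]
    trivial
  induction hτ using Submonoid.closure_induction with
  | mem x hx =>
    obtain ⟨i, rfl⟩ := hx
    refine Subgroup.subset_closure (Or.inr ⟨i, by omega, ?_⟩)
    exact pairPerm_swap (n := m + 1) (i := i) (by omega)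
  | one =>
    rw [map_one]
    exact one_mem _
  | mul x y _ _ hx hy =>
    rw [map_mul]
    exact mul_mem hx hy

theorem flip_mem_sigmaPrime {n : ℕ} (i : ℕ) (h : 2 * i + 1 < 2 * n) :
    Equiv.swap (⟨2 * i, by omega⟩ : Fin (2 * n)) ⟨2 * i + 1, h⟩ ∈ sigmaPrime n := by
  have h0 : Equiv.swap (⟨0, by omega⟩ : Fin (2 * n)) ⟨1, by omega⟩ ∈ sigmaPrime n :=
    Subgroup.subset_closure (Or.inl ⟨by omega, rfl⟩)
  have h1 := pairPerm_mem_sigmaPrime (n := n) (Equiv.swap ⟨0, by omega⟩ ⟨i, by omega⟩)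
  set τ := pairPerm n (Equiv.swap ⟨0, by omega⟩ ⟨i, by omega⟩) with hτ
  have e0 : τ ⟨0, by omega⟩ = ⟨2 * i, by omega⟩ := by
    ext
    rw [hτ, pairPerm_apply]
    simp
  have e1 : τ ⟨1, by omega⟩ = ⟨2 * i + 1, h⟩ := by
    ext
    rw [hτ, pairPerm_apply]
    simp
  -- The flip of pair `i` is the flip of pair `0` conjugated by the exchange of these pairs.
  rw [← e0, ← e1, Equiv.swap_apply_apply]
  exact mul_mem (mul_mem h1 h0) (inv_mem h1)

/-- The induced permutation of the pairs lifts to `sigmaPrime n` by `pairPerm`, and dividing by the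
lift leaves a product of flips. -/
theorem mem_sigmaPrime_of_pair_preserving {n : ℕ} {σ : Equiv.Perm (Fin (2 * n))}
    (hσ : ∀ k l : Fin (2 * n), (k : ℕ) / 2 = (l : ℕ) / 2 → (σ k : ℕ) / 2 = (σ l : ℕ) / 2) :
    σ ∈ sigmaPrime n := by
  let t : Fin n → Fin n := fun i => ⟨(σ ⟨2 * i, by omega⟩ : ℕ) / 2, by omega⟩
  have ht : ∀ k : Fin (2 * n), (t ⟨k / 2, by omega⟩ : ℕ) = (σ k : ℕ) / 2 := fun k =>
    hσ _ _ (by simp)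
  have hsurj : Function.Surjective t := fun j => by
    obtain ⟨k, hk⟩ := σ.surjective ⟨2 * j, by omega⟩
    refine ⟨⟨k / 2, by omega⟩, Fin.ext ?_⟩
    rw [ht, hk]
    simp
  let τ : Equiv.Perm (Fin n) := Equiv.ofBijective t (Finite.surjective_iff_bijective.1 hsurj)
  have h1 : (pairPerm n τ)⁻¹ * σ ∈ sigmaPrime n := by
    refine mem_of_block_preserving flip_mem_sigmaPrime fun k => ?_
    have h2 : (pairPerm n τ⁻¹ (σ k) : ℕ) / 2 = (k : ℕ) / 2 := by
      rw [pairPerm_apply]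
      have h3 : τ ⟨k / 2, by omega⟩ = ⟨(σ k : ℕ) / 2, by omega⟩ := Fin.ext (ht k)
      rw [← h3, Equiv.Perm.inv_def, Equiv.symm_apply_apply]
      simp only
      omega
    rwa [map_inv] at h2
  exact ((sigmaPrime n).mul_mem_cancel_left (inv_mem (pairPerm_mem_sigmaPrime τ))).1 h1

/-! ### The exact sequences -/

namespace ArcSystem

variable {H : Type u} [TopologicalSpace H] [T2Space H] {T : Set H} {n : ℕ} (A : ArcSystem T n)

theorem isClosed_range_arc (i : Fin n) : IsClosed (range (A.arc i)) :=
  (isCompact_range (A.isEmbedding i).continuous).isClosed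

omit [T2Space H] in
theorem puncture_mem_arc (k : Fin (2 * n)) :
    (A.puncture k : H) ∈ range (A.arc ⟨k / 2, by omega⟩) :=
  mem_range_self _

omit [T2Space H] in
theorem eq_of_mem_arc {x : H} {i j : Fin n} (hi : x ∈ range (A.arc i)) (hj : x ∈ range (A.arc j)) :
    i = j := by
  by_contra h
  exact disjoint_left.1 (A.disjoint i j h) hi hj

omit [T2Space H] in
theorem exists_puncture {x : H} (hx : x ∈ T) (hx' : x ∈ A.union) :
    ∃ k, (A.puncture k : H) = x := by
  obtain ⟨i, t, rfl⟩ := mem_iUnion.1 hx'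
  rcases (A.mem_boundary_iff i t).1 hx with rfl | rfl
  · refine ⟨⟨2 * i, by omega⟩, ?_⟩
    simp [puncture]
  · refine ⟨⟨2 * i + 1, by omega⟩, ?_⟩
    have : (2 * (i : ℕ) + 1) / 2 = i := by omega
    simp [puncture, this]

omit [T2Space H] in
theorem finite_inter_union : (T ∩ A.union).Finite := by
  refine (finite_range fun k => (A.puncture k : H)).subset ?_
  rintro x ⟨h, h'⟩
  exact A.exists_puncture h h'

omit [T2Space H] in
theorem puncture_mem_union (k : Fin (2 * n)) : (A.puncture k : H) ∈ A.union :=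
  mem_iUnion.2 ⟨_, A.puncture_mem_arc k⟩

theorem p_spec (f : homeoPlus T (range A.puncture)) (k : Fin (2 * n)) :
    A.puncture (A.p (mappingClass T _ f) k) = f.1 (A.puncture k) :=
  permHom_spec A.puncture_injective f k

omit [T2Space H] in
/-- An admissible homeomorphism which permutes the punctures has a mapping class. -/
theorem exists_homeoPlus {F : H ≃ₜ H} (hF : Admissible T F)
    (h : ∀ k, ∃ l, F (A.puncture k) = A.puncture l) :
    ∃ f : homeoPlus T (range A.puncture), ∀ x : T, (f.1 x : H) = F x := by
  choose s hs using h
  have hinj : Function.Injective s := fun a b hab => by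
    apply A.puncture_injective
    apply Subtype.ext
    apply F.injective
    rw [hs, hs, hab]
  refine ⟨⟨hF.restrict, hF.orientationPreserving, ?_⟩, fun _ => rfl⟩
  have h1 : ∀ k, hF.restrict (A.puncture k) = A.puncture (s k) := fun k => Subtype.ext (hs k)
  rw [← range_comp]
  have : hF.restrict ∘ A.puncture = A.puncture ∘ s := funext h1
  rw [this, (Finite.injective_iff_surjective.1 hinj).range_comp]

theorem p_eq_one_iff (c : A.mcg) : A.p c = 1 ↔ c ∈ A.pmcg := by
  constructor
  · obtain ⟨f, rfl⟩ := QuotientGroup.mk'_surjective _ c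
    intro h
    refine ⟨f, ?_, rfl⟩
    rintro _ ⟨k, rfl⟩
    rw [← A.p_spec f k]
    rw [h, Equiv.Perm.one_apply]
  · rintro ⟨f, hf, rfl⟩
    ext k
    refine congrArg _ (A.puncture_injective ?_)
    rw [A.p_spec f k, hf _ (mem_range_self k), Equiv.Perm.one_apply]

/-- It suffices to realize transpositions: two punctures are swapped while the others are held
fixed. The arcs play no role here. -/
theorem p_surjective (hT : HasBoundaryCharts T) (hc : IsPreconnected T) :
    Function.Surjective A.p := by
  rw [← MonoidHom.range_eq_top, ← top_le_iff, ← Equiv.Perm.closure_isSwap, Subgroup.closure_le]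
  rintro _ ⟨k, l, hkl, rfl⟩
  let Z : Set H := (fun m => (A.puncture m : H)) '' {k, l}ᶜ
  have hZ : Z.Finite := (Set.toFinite _).image _
  have hinj : Function.Injective fun m => (A.puncture m : H) :=
    Subtype.val_injective.comp A.puncture_injective
  have hmem : ∀ m, (A.puncture m : H) ∈ Z ↔ m ≠ k ∧ m ≠ l := fun m => by
    simp only [Z]
    rw [hinj.mem_set_image (s := {k, l}ᶜ) (a := m)]
    simp
  obtain ⟨F, h1, h2, h3, h4⟩ := exists_admissible_swap hT hc hZ.isClosed (hZ.inter_of_right T)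
    (p := A.puncture k) (q := A.puncture l) ⟨(A.puncture k).2, fun h => ((hmem k).1 h).1 rfl⟩
    ⟨(A.puncture l).2, fun h => ((hmem l).1 h).2 rfl⟩ fun h => hkl (hinj h)
  have hF : ∀ m, F (A.puncture m) = A.puncture (Equiv.swap k l m) := fun m => by
    rw [Equiv.swap_apply_def]
    split_ifs with e1 e2
    · rw [e1, h3]
    · rw [e2, h4]
    · exact h2 _ ((hmem m).2 ⟨e1, e2⟩)
  obtain ⟨f, hf⟩ := A.exists_homeoPlus h1 fun m => ⟨_, hF m⟩
  refine ⟨mappingClass T _ f, Equiv.ext fun m => A.puncture_injective (Subtype.ext ?_)⟩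
  rw [A.p_spec f m, hf, hF]

/-- A homeomorphism preserving the union of the arcs maps arcs to arcs. -/
theorem exists_arc_of_image_union {F : H ≃ₜ H} (hF : F '' A.union = A.union) (i : Fin n) :
    ∃ j, ∀ t, F (A.arc i t) ∈ range (A.arc j) := by
  have h1 : ∀ t, ∃ j, F (A.arc i t) ∈ range (A.arc j) := fun t => by
    have : F (A.arc i t) ∈ A.union :=
      hF ▸ mem_image_of_mem F (mem_iUnion.2 ⟨i, mem_range_self t⟩)
    exact mem_iUnion.1 this
  choose s hs using h1
  -- The arcs are closed, disjoint and finite in number, so the index of the arc containing the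
  -- image point is locally constant on the interval.
  have hcont : Continuous s := by
    rw [continuous_iff_isClosed]
    intro J _
    have : s ⁻¹' J = ⋃ j ∈ J, (fun t => F (A.arc i t)) ⁻¹' range (A.arc j) := by
      ext t
      simp only [mem_preimage, mem_iUnion, exists_prop]
      exact ⟨fun h => ⟨_, h, hs t⟩, fun ⟨j, hj, h⟩ => A.eq_of_mem_arc (hs t) h ▸ hj⟩
    rw [this]
    exact (Set.toFinite J).isClosed_biUnion fun j _ => (A.isClosed_range_arc j).preimage
      (F.continuous.comp (A.isEmbedding i).continuous)
  refine ⟨s 0, fun t => ?_⟩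
  rw [← PreconnectedSpace.constant inferInstance hcont (x := t) (y := 0)]
  exact hs t

/-- The two ends of an arc go to points of one and the same arc, so the pairs of labels are
respected. -/
theorem p_mem_sigmaPrime {c : A.mcg} (hc : c ∈ A.extendable) : A.p c ∈ sigmaPrime n := by
  obtain ⟨f, ⟨F, hF, hF'⟩, rfl⟩ := hc
  refine mem_sigmaPrime_of_pair_preserving fun k l hkl => ?_
  have key : ∀ m : Fin (2 * n), ∀ j, (∀ t, F (A.arc ⟨m / 2, by omega⟩ t) ∈ range (A.arc j)) →
      (A.p (mappingClass T _ f) m : ℕ) / 2 = j := by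
    intro m j hj
    obtain ⟨t, ht⟩ := A.puncture_mem_arc m
    have h1 := A.puncture_mem_arc (A.p (mappingClass T _ f) m)
    rw [A.p_spec f m, ← hF, ← ht] at h1
    exact congrArg Fin.val (A.eq_of_mem_arc h1 (hj t))
  obtain ⟨j, hj⟩ := A.exists_arc_of_image_union hF' ⟨k / 2, by omega⟩
  rw [key k j hj, key l j]
  have : (⟨(l : ℕ) / 2, by omega⟩ : Fin n) = ⟨(k : ℕ) / 2, by omega⟩ := Fin.ext hkl.symm
  rw [this]
  exact hj

/-- The mapping class of an admissible homeomorphism preserving the arcs. -/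
theorem exists_extendable {F : H ≃ₜ H} (hF : Admissible T F) (h : F '' A.union = A.union) :
    ∃ c ∈ A.extendable, ∀ k, (A.puncture (A.p c k) : H) = F (A.puncture k) := by
  obtain ⟨f, hf⟩ := A.exists_homeoPlus hF fun k => by
    have h1 : F (A.puncture k) ∈ A.union := h ▸ mem_image_of_mem F (A.puncture_mem_union k)
    obtain ⟨l, hl⟩ := A.exists_puncture ((hF.1 _).2 (A.puncture k).2) h1
    exact ⟨l, hl.symm⟩
  refine ⟨mappingClass T _ f, ⟨f, ⟨F, fun x => (hf x).symm, h⟩, rfl⟩, fun k => ?_⟩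
  rw [A.p_spec f k, hf]

/-! ### Realizing the pair-preserving permutations -/

variable {A}

/-- The arcs of a trivial system have charts which do not meet the other arcs. -/
theorem IsTrivial.exists_charts (hA : A.IsTrivial) (i : Fin n) :
    ∃ e : HS → H, IsArcChart T (range (A.arc i)) e ∧
      ∀ j ≠ i, Disjoint (range e) (range (A.arc j)) := by
  obtain ⟨D, hD, hD'⟩ := hA
  have hsub : ∀ j, range (A.arc j) ⊆ D j := fun j => by
    obtain ⟨e, -, -, h1, h2⟩ := hD' j
    rw [← h1, ← h2]
    exact image_mono fun x hx => ⟨hx.1, hx.2.le⟩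
  have hcl : IsClosed (⋃ j ∈ {j | j ≠ i}, range (A.arc j)) :=
    (Set.toFinite _).isClosed_biUnion fun j _ => A.isClosed_range_arc j
  obtain ⟨e, h1, h2⟩ := (hD' i).exists_isArcChart hcl.isOpen_compl fun x hx hx' => by
    obtain ⟨j, hj, hxj⟩ := mem_iUnion₂.1 hx'
    exact disjoint_left.1 (hD j i hj) (hsub j hxj) hx
  refine ⟨e, h1, fun j hj => disjoint_left.2 fun x hx hx' => h2 hx ?_⟩
  exact mem_iUnion₂.2 ⟨j, hj, hx'⟩

omit [T2Space H] in
theorem image_union_of_perm {F : H ≃ₜ H} (s : Equiv.Perm (Fin n))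
    (h : ∀ i, F '' range (A.arc i) = range (A.arc (s i))) : F '' A.union = A.union := by
  rw [union, image_iUnion]
  simp only [h]
  exact s.surjective.iUnion_comp fun i => range (A.arc i)

theorem IsTrivial.flip_mem (hA : A.IsTrivial) (i : ℕ) (h : 2 * i + 1 < 2 * n) :
    Equiv.swap (⟨2 * i, by omega⟩ : Fin (2 * n)) ⟨2 * i + 1, h⟩ ∈ A.extendable.map A.p := by
  obtain ⟨e, he, hd⟩ := hA.exists_charts ⟨i, by omega⟩
  obtain ⟨F, h1, h2, h3, h4, h5⟩ := he.exists_flip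
  have hid : ∀ j ≠ (⟨i, by omega⟩ : Fin n), ∀ x ∈ range (A.arc j), F x = x := fun j hj x hx =>
    h5 x fun hx' => disjoint_left.1 (hd j hj) hx' hx
  have hU : F '' A.union = A.union := by
    refine image_union_of_perm 1 fun j => ?_
    by_cases hj : j = ⟨i, by omega⟩
    · rw [hj]
      exact h2
    · rw [image_congr (g := id) (hid j hj), image_id]
      rfl
  obtain ⟨c, hc, hp⟩ := A.exists_extendable h1 hU
  refine ⟨c, hc, ?_⟩
  have hends : ∀ m : Fin (2 * n), (m : ℕ) / 2 = i →
      (A.puncture m : H) = e 0 ∨ (A.puncture m : H) = e (2, 0) := fun m hm => by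
    have h6 := A.puncture_mem_arc m
    have h7 : (⟨(m : ℕ) / 2, by omega⟩ : Fin n) = ⟨i, by omega⟩ := Fin.ext hm
    rw [h7] at h6
    have : (A.puncture m : H) ∈ T ∩ range (A.arc ⟨i, by omega⟩) := ⟨(A.puncture m).2, h6⟩
    rwa [he.inter_eq] at this
  have h02 : e 0 ≠ e (2, 0) := fun h => by
    have := congrArg Prod.fst (he.isOpenEmbedding.injective h)
    norm_num at this
  have hinj : Function.Injective fun m => (A.puncture m : H) :=
    Subtype.val_injective.comp A.puncture_injective
  have hab : (⟨2 * i, by omega⟩ : Fin (2 * n)) ≠ ⟨2 * i + 1, h⟩ := fun h => by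
    have := congrArg Fin.val h
    simp at this
  have key : F (A.puncture ⟨2 * i, by omega⟩) = A.puncture ⟨2 * i + 1, h⟩ ∧
      F (A.puncture ⟨2 * i + 1, h⟩) = A.puncture ⟨2 * i, by omega⟩ := by
    have n1 : (A.puncture ⟨2 * i, by omega⟩ : H) ≠ A.puncture ⟨2 * i + 1, h⟩ :=
      fun h => hab (hinj h)
    -- The arc chart does not remember the parametrization, so either end of the arc may be the one
    -- at the origin; the flip swaps them in both cases.
    rcases hends ⟨2 * i, by omega⟩ (by simp) with e1 | e1 <;>
      rcases hends ⟨2 * i + 1, h⟩ (by simp only; omega) with e2 | e2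
    · exact absurd (e1.trans e2.symm) n1
    · rw [e1, e2]
      exact ⟨h3, h4⟩
    · rw [e1, e2]
      exact ⟨h4, h3⟩
    · exact absurd (e1.trans e2.symm) n1
  refine Equiv.ext fun m => hinj ?_
  simp only [hp]
  rw [Equiv.swap_apply_def]
  split_ifs with e1 e2
  · rw [e1, key.1]
  · rw [e2, key.2]
  · refine hid ⟨m / 2, by omega⟩ (fun hm => ?_) _ (A.puncture_mem_arc m)
    have h8 : (m : ℕ) / 2 = i := congrArg Fin.val hm
    rw [Fin.ext_iff] at e1 e2
    simp only at e1 e2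
    omega

/-- Only the effect on the pairs is recorded, as `exists_arc_exchange` controls the arcs as sets but
not the matching of their endpoints. -/
theorem IsTrivial.exists_exchange (hA : A.IsTrivial) (hT : HasBoundaryCharts T)
    (hc : IsPreconnected T) {i j : Fin n} (hij : i ≠ j) :
    ∃ σ ∈ A.extendable.map A.p, ∀ k : Fin (2 * n),
      (⟨(σ k : ℕ) / 2, by omega⟩ : Fin n) = Equiv.swap i j ⟨k / 2, by omega⟩ := by
  obtain ⟨e, he, hd⟩ := hA.exists_charts i
  obtain ⟨e', he', hd'⟩ := hA.exists_charts j
  let Z : Set H := ⋃ l ∈ {l | l ≠ i ∧ l ≠ j}, range (A.arc l)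
  have hZ : IsClosed Z := (Set.toFinite _).isClosed_biUnion fun l _ => A.isClosed_range_arc l
  have hZU : Z ⊆ A.union := iUnion₂_subset fun l _ => subset_iUnion (fun l => range (A.arc l)) l
  obtain ⟨F, h1, h2, h3, h4⟩ := exists_arc_exchange hT hc hZ
    (A.finite_inter_union.subset (inter_subset_inter_right T hZU)) he he' (A.isClosed_range_arc j)
    (disjoint_union_right.2 ⟨disjoint_iUnion₂_right.2 fun l hl => hd l hl.1, hd j hij.symm⟩)
    (disjoint_iUnion₂_right.2 fun l hl => hd' l hl.2)
  have himg : ∀ l, F '' range (A.arc l) = range (A.arc (Equiv.swap i j l)) := fun l => by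
    rw [Equiv.swap_apply_def]
    split_ifs with e1 e2
    · rw [e1, h3]
    · rw [e2, h4]
    · rw [image_congr (g := id) fun x hx => h2 x (mem_iUnion₂.2 ⟨l, ⟨e1, e2⟩, hx⟩), image_id]
  obtain ⟨c, hc, hp⟩ := A.exists_extendable h1 (image_union_of_perm _ himg)
  refine ⟨A.p c, ⟨c, hc, rfl⟩, fun k => ?_⟩
  refine A.eq_of_mem_arc (A.puncture_mem_arc _) ?_
  rw [hp, ← himg]
  exact mem_image_of_mem F (A.puncture_mem_arc k)

theorem IsTrivial.sigmaPrime_le (hA : A.IsTrivial) (hT : HasBoundaryCharts T)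
    (hc : IsPreconnected T) : sigmaPrime n ≤ A.extendable.map A.p := by
  rw [sigmaPrime, Subgroup.closure_le]
  rintro σ (⟨h, rfl⟩ | ⟨i, h, hσ⟩)
  · exact hA.flip_mem 0 h
  · rw [← pairPerm_swap h] at hσ
    have hij : (⟨i, by omega⟩ : Fin n) ≠ ⟨i + 1, by omega⟩ := fun h => by
      have := congrArg Fin.val h
      simp at this
    obtain ⟨τ, h1, h2⟩ := hA.exists_exchange hT hc hij
    -- The realized exchange `τ` and the generator `σ` induce the same transposition of pairs, so
    -- their product preserves every pair and is a product of realizable flips.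
    have : σ * τ ∈ A.extendable.map A.p := by
      refine mem_of_block_preserving hA.flip_mem fun k => ?_
      rw [Equiv.Perm.mul_apply, hσ, pairPerm_apply, h2 k, Equiv.swap_apply_self]
      simp only
      omega
    exact ((A.extendable.map A.p).mul_mem_cancel_right h1).1 this

end ArcSystem

theorem mainTheorem5 {H : Type*} [TopologicalSpace H] [T2Space H] (g n : ℕ) (hn : 1 ≤ n)
    (T : Set H) (hH : IsHandlebody g H T) (A : ArcSystem T n) (hA : A.IsTrivial) :
    ShortExactGroups A.pmcg.subtype A.p ∧
    ∃ q : A.extendable →* sigmaPrime n,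
      (∀ ε : A.extendable, (q ε : Equiv.Perm (Fin (2 * n))) = A.p ε) ∧
      ShortExactGroups A.pureInclusion q := by
  refine ⟨⟨Subtype.val_injective, fun c => ?_,
    A.p_surjective hH.hasBoundaryCharts hH.isPreconnected⟩,
    (A.p.comp A.extendable.subtype).codRestrict (sigmaPrime n) fun ε => A.p_mem_sigmaPrime ε.2,
    fun _ => rfl, Subgroup.inclusion_injective _, fun ε => ?_, ?_⟩
  · rw [A.p_eq_one_iff]
    exact ⟨fun h => ⟨⟨c, h⟩, rfl⟩, fun ⟨x, hx⟩ => hx ▸ x.2⟩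
  · rw [Subtype.ext_iff]
    refine (A.p_eq_one_iff ε.1).trans ⟨fun h => ⟨⟨ε.1, h, ε.2⟩, rfl⟩, ?_⟩
    rintro ⟨x, rfl⟩
    exact x.2.1
  · rintro ⟨σ, hσ⟩
    obtain ⟨c, hc, h⟩ := hA.sigmaPrime_le hH.hasBoundaryCharts hH.isPreconnected hσ
    exact ⟨⟨c, hc⟩, Subtype.ext h⟩
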